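/- Fix integers $n,m\ge 1$. Let $G=N(m)$ be the electrical network on a cylinder with vertices $M^{(k)}_i$ ($0\le k\le m$, $i\in\mathbb Z/n$) which has, for each $0\le k<m$ and each $i$, a low edge joining $M^{(k)}_i$ to $M^{(k+1)}_i$ and a high edge joining $M^{(k)}_i$ to $M^{(k+1)}_{i-1}$, all with arbitrary positive conductances (weights). The vertices $i:=M^{(0)}_i$ and $i':=M^{(m)}_i$ are the boundary vertices; all others are interior. For $1\le k\le m$ let $R_k$ be the product of the conductances of the $n$ high edges between layers $k-1$ and $k$, divided by the product of the conductances of the $n$ low edges between these layers. Let $G(\infty)$ be the universal cover of $G$ (the same description with lower indices in $\mathbb Z$ and $n$-periodic conductances), with boundary vertices $i=M^{(0)}_i$ and $i'=M^{(m)}_i$ for $i\in\mathbb Z$. Let $V_1\subset V_2\subset\cdots$ be finite sets of vertices of $G(\infty)$ that eventually cover all vertices, and let $G(N)$ be the subgraph of $G(\infty)$ consisting of all edges incident to a vertex in $V_N$; a vertex of $G(N)$ is interior if it lies in $V_N$ and is interior in $G(\infty)$, and it is a boundary vertex otherwise. A grove in $G(N)$ is a spanning forest each of whose components contains a boundary vertex;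 its weight is the product of its edge weights, and its boundary partition is the partition of the boundary vertices according to the components of the forest. For a partition $\pi$ of the boundary vertices let $\Pr(\pi)$ be the probability that a random grove, chosen with probability proportional to its weight, has boundary partition $\pi$, and let $\mathrm{uPr}(\pi)_{G(N)}=\Pr(\pi)/\Pr(\text{all singletons})$. For $K\ge 0$ let $\tau_K$ be the partition with parts $\{k,(k-1)'\}$ for $2\le k\le K$, parts $\{k,k'\}$ for $-K\le k\le 0$, and all other boundary vertices of $G(N)$ singletons. Let $\sigma_K$ be obtained from $\tau_K$ by replacing the parts $\{0,0'\}$ and $\{1\}$ by the single part $\{1,0,0'\}$. Suppose that $R_1\ge R_2\ge\cdots\ge R_m$. Then the following limits exist (the inner one for every $K$) and $$\lim_{K\to\infty}\ \lim_{N\to\infty}\ \frac{\mathrm{uPr}(\sigma_K)_{G(N)}}{\mathrm{uPr}(\tau_K)_{G(N)}}=a,$$ where $a$ is the conductance of the high edge of $G$ at the vertex $1$, that is, of the edge joining $M^{(0)}_1$ to $M^{(1)}_0$. -/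

import Mathlib

open Filter Topology

noncomputable section

/-- An electrical network on the vertices `V` with edges `E`: a weighted undirected graph (loops and
parallel edges allowed) with a distinguished set of boundary vertices; all other vertices are
interior. -/
structure ElectricalNetwork (V E : Type) where
  ends : E → Sym2 V
  conductance : E → ℝ
  boundary : Set V

namespace ElectricalNetwork

variable {V E : Type}

/-- The simple graph on `V` which has the same connected components as the subgraph of the network
with edge set `Γ`. -/
def subgraph (H : ElectricalNetwork V E) (Γ : Finset E) : SimpleGraph V :=
  SimpleGraph.fromEdgeSet {z | ∃ e ∈ Γ, H.ends e = z}

/-- The edge set `Γ` contains no cycle: no loop, no two parallel edges, and no longer cycle. -/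
def IsForest (H : ElectricalNetwork V E) (Γ : Finset E) : Prop :=
  (∀ e ∈ Γ, ¬ (H.ends e).IsDiag) ∧
  (∀ e ∈ Γ, ∀ f ∈ Γ, H.ends e = H.ends f → e = f) ∧
  (H.subgraph Γ).IsAcyclic

/-- A grove is a spanning forest each of whose connected components meets the boundary. -/
def IsGrove (H : ElectricalNetwork V E) (Γ : Finset E) : Prop :=
  H.IsForest Γ ∧ ∀ v, ∃ b ∈ H.boundary, (H.subgraph Γ).Reachable v b

/-- The boundary partition of `Γ` is `τ`: two boundary vertices lie in the same component of `Γ`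
if and only if they lie in the same part of `τ`. -/
def HasBoundaryPartition (H : ElectricalNetwork V E) (Γ : Finset E)
    (τ : Setoid H.boundary) : Prop :=
  ∀ b c : H.boundary, (H.subgraph Γ).Reachable b c ↔ τ b c

/-- The weight of a set of edges is the product of the conductances. -/
def weight (H : ElectricalNetwork V E) (Γ : Finset E) : ℝ :=
  ∏ e ∈ Γ, H.conductance e

open Classical in
/-- The probability that a random grove, chosen with probability proportional to its weight, has
boundary partition `τ`. -/
def grovePr [Fintype E] (H : ElectricalNetwork V E) (τ : Setoid H.boundary) : ℝ :=
  (∑ Γ : Finset E with H.IsGrove Γ ∧ H.HasBoundaryPartition Γ τ, H.weight Γ) /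
    (∑ Γ : Finset E with H.IsGrove Γ, H.weight Γ)

/-- The normalized grove partition function `Pr(τ) / Pr(singletons)`; here `⊥` is the partition of
the boundary into singletons. -/
def uPr [Fintype E] (H : ElectricalNetwork V E) (τ : Setoid H.boundary) : ℝ :=
  H.grovePr τ / H.grovePr ⊥

/-- The edge `e` is incident to a vertex of `S`. -/
def Meets (H : ElectricalNetwork V E) (S : Finset V) (e : E) : Prop :=
  ∃ u ∈ S, u ∈ H.ends e

/-- The edges of the truncation of `H` to `S`: all edges incident to a vertex in `S`. -/
abbrev TruncEdge (H : ElectricalNetwork V E) (S : Finset V) : Type :=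
  {e : E // H.Meets S e}

/-- The vertices of the truncation of `H` to `S`: all end points of edges incident to a vertex in
`S`. -/
abbrev TruncVertex (H : ElectricalNetwork V E) (S : Finset V) : Type :=
  {v : V // ∃ e, H.Meets S e ∧ v ∈ H.ends e}

/-- The truncation of `H` to `S`: the subgraph consisting of all edges incident to a vertex in `S`.
Its interior vertices are those in `S` that are interior in `H`. -/
def truncation (H : ElectricalNetwork V E) (S : Finset V) :
    ElectricalNetwork (H.TruncVertex S) (H.TruncEdge S) where
  ends e := (H.ends e.1).attachWith fun _ hv => ⟨e.1, e.2, hv⟩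
  conductance e := H.conductance e.1
  boundary := {v | ¬ (v.1 ∈ S ∧ v.1 ∉ H.boundary)}

/-- The partition of the boundary vertices of a truncation induced by a partition of the vertices
of `H`. -/
def truncPartition (H : ElectricalNetwork V E) (S : Finset V) (π : Setoid V) :
    Setoid (H.truncation S).boundary :=
  π.comap fun b => b.1.1

end ElectricalNetwork

/-- The partition of `X` whose parts are the given disjoint sets, and singletons otherwise. -/
def partitionOfParts {X : Type} (P : Set (Set X)) (hP : P.PairwiseDisjoint id) : Setoid X where
  r x y := x = y ∨ ∃ p ∈ P, x ∈ p ∧ y ∈ p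
  iseqv :=
    { refl := fun _ => Or.inl rfl
      symm := by
        rintro x y (h | ⟨p, hp, hx, hy⟩)
        · exact Or.inl h.symm
        · exact Or.inr ⟨p, hp, hy, hx⟩
      trans := by
        rintro x y z (rfl | ⟨p, hp, hx, hy⟩) (rfl | ⟨q, hq, hy', hz⟩)
        · exact Or.inl rfl
        · exact Or.inr ⟨q, hq, hy', hz⟩
        · exact Or.inr ⟨p, hp, hx, hy⟩
        · have hpq : p = q := hP.elim_set hp hq y hy hy'
          exact Or.inr ⟨p, hp, hx, hpq ▸ hz⟩ }

/-- The two kinds of edges from the vertex `M_i^{(k)}`: the low edge leads to `M_i^{(k+1)}` and the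
high edge leads to `M_{i-1}^{(k+1)}`. -/
inductive EdgeKind where
  | low
  | high

namespace NNetwork

/-- The vertices `M_i^{(k)}`, written `(k, i)`, with `0 ≤ k ≤ m`. The lower index lies in `ZMod n`
for the network on the cylinder, and in `ℤ` for its universal cover. -/
abbrev Vertex (m : ℕ) (A : Type) : Type := Fin (m + 1) × A

/-- `(k, i, t)` is the edge of kind `t` from `M_i^{(k)}` to the layer `k + 1`, `0 ≤ k < m`. -/
abbrev Edge (m : ℕ) (A : Type) : Type := Fin m × A × EdgeKind

/-- The ends of an edge. -/
def ends {m : ℕ} {A : Type} [Ring A] : Edge m A → Sym2 (Vertex m A)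
  | (k, i, EdgeKind.low) => s((k.castSucc, i), (k.succ, i))
  | (k, i, EdgeKind.high) => s((k.castSucc, i), (k.succ, i - 1))

/-- The network with the vertices `M_i^{(k)}`, the low and high edges, and the boundary vertices
`i = M_i^{(0)}` and `i' = M_i^{(m)}`. -/
def network {m : ℕ} {A : Type} [Ring A] (c : Edge m A → ℝ) :
    ElectricalNetwork (Vertex m A) (Edge m A) where
  ends := ends
  conductance := c
  boundary := {v | v.1 = 0 ∨ v.1 = Fin.last m}

/-- The cylindrical network `N(m)` with `n` boundary vertices on each of the two boundary
components and conductances `c`. -/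
def cylinder {n m : ℕ} (c : Edge m (ZMod n) → ℝ) :
    ElectricalNetwork (Vertex m (ZMod n)) (Edge m (ZMod n)) :=
  network c

/-- The universal cover of `N(m)`, an infinite periodic network in a strip: the lower indices are
integers, and the covering map reduces them modulo `n`. -/
def universalCover {n m : ℕ} (c : Edge m (ZMod n) → ℝ) :
    ElectricalNetwork (Vertex m ℤ) (Edge m ℤ) :=
  network fun e => (cylinder c).conductance (e.1, (e.2.1 : ZMod n), e.2.2)

/-- The radius `R_{k+1}`, `0 ≤ k < m`: the product of the conductances of the high edges from layer
`k` to layer `k + 1`, divided by the product of the conductances of the low ones. -/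
def radius {n m : ℕ} [NeZero n] (c : Edge m (ZMod n) → ℝ) (k : Fin m) : ℝ :=
  (∏ i : ZMod n, (cylinder c).conductance (k, i, EdgeKind.high)) /
    (∏ i : ZMod n, (cylinder c).conductance (k, i, EdgeKind.low))

/-- The left boundary vertex `i` of the universal cover. -/
def leftVertex (m : ℕ) (i : ℤ) : Vertex m ℤ := (0, i)

/-- The right boundary vertex `i'` of the universal cover. -/
def rightVertex (m : ℕ) (i : ℤ) : Vertex m ℤ := (Fin.last m, i)

/-- The parts `{k, (k-1)'}` for `2 ≤ k ≤ K` and `{k, k'}` for `-K ≤ k < 0`. -/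
def commonParts (m K : ℕ) : Set (Set (Vertex m ℤ)) :=
  {p | ∃ k : ℤ, 2 ≤ k ∧ k ≤ K ∧ p = {leftVertex m k, rightVertex m (k - 1)}} ∪
  {p | ∃ k : ℤ, -K ≤ k ∧ k < 0 ∧ p = {leftVertex m k, rightVertex m k}}

/-- The non-singleton parts of `τ_K`: `{k, (k-1)'}` for `2 ≤ k ≤ K`, and `{k, k'}` for
`-K ≤ k ≤ 0`. -/
def tauParts (m K : ℕ) : Set (Set (Vertex m ℤ)) :=
  insert {leftVertex m 0, rightVertex m 0} (commonParts m K)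

/-- The non-singleton parts of `σ_K`: those of `τ_K`, with `{0, 0'}` replaced by `{1, 0, 0'}`. -/
def sigmaParts (m K : ℕ) : Set (Set (Vertex m ℤ)) :=
  insert {leftVertex m 1, leftVertex m 0, rightVertex m 0} (commonParts m K)

lemma leftVertex_ne_rightVertex (m : ℕ) [NeZero m] (i j : ℤ) :
    leftVertex m i ≠ rightVertex m j := by
  intro h
  have h0 : (0 : Fin (m + 1)) = Fin.last m := congrArg Prod.fst h
  have h1 := congrArg Fin.val h0
  simp only [Fin.val_zero, Fin.val_last] at h1
  exact NeZero.ne m h1.symm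

lemma tauParts_pairwiseDisjoint (m K : ℕ) [NeZero m] :
    (tauParts m K).PairwiseDisjoint id := by
  have hlr := leftVertex_ne_rightVertex m
  have hl : ∀ i j : ℤ, leftVertex m i = leftVertex m j → i = j := fun _ _ h => congrArg Prod.snd h
  have hr : ∀ i j : ℤ, rightVertex m i = rightVertex m j → i = j :=
    fun _ _ h => congrArg Prod.snd h
  intro p hp q hq hne
  refine Set.disjoint_left.mpr fun x hxp hxq => hne ?_
  simp only [tauParts, commonParts, Set.mem_insert_iff, Set.mem_union, Set.mem_ofPred_eq] at hp hq
  rcases hp with rfl | ⟨k, hk, hk', rfl⟩ | ⟨k, hk, hk', rfl⟩ <;>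
  rcases hq with rfl | ⟨l, hl1, hl', rfl⟩ | ⟨l, hl1, hl', rfl⟩ <;>
  simp only [id, Set.mem_insert_iff, Set.mem_singleton_iff] at hxp hxq <;>
  grind

lemma sigmaParts_pairwiseDisjoint (m K : ℕ) [NeZero m] :
    (sigmaParts m K).PairwiseDisjoint id := by
  have hlr := leftVertex_ne_rightVertex m
  have hl : ∀ i j : ℤ, leftVertex m i = leftVertex m j → i = j := fun _ _ h => congrArg Prod.snd h
  have hr : ∀ i j : ℤ, rightVertex m i = rightVertex m j → i = j :=
    fun _ _ h => congrArg Prod.snd h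
  intro p hp q hq hne
  refine Set.disjoint_left.mpr fun x hxp hxq => hne ?_
  simp only [sigmaParts, commonParts, Set.mem_insert_iff, Set.mem_union, Set.mem_ofPred_eq] at hp hq
  rcases hp with rfl | ⟨k, hk, hk', rfl⟩ | ⟨k, hk, hk', rfl⟩ <;>
  rcases hq with rfl | ⟨l, hl1, hl', rfl⟩ | ⟨l, hl1, hl', rfl⟩ <;>
  simp only [id, Set.mem_insert_iff, Set.mem_singleton_iff] at hxp hxq <;>
  grind

/-- The partition `τ_K`. A vertex in no listed part (such as `1`) is a singleton. -/
def tau (m K : ℕ) [NeZero m] : Setoid (Vertex m ℤ) :=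
  partitionOfParts (tauParts m K) (tauParts_pairwiseDisjoint m K)

/-- The partition `σ_K`. A vertex in no listed part is a singleton. -/
def sigma (m K : ℕ) [NeZero m] : Setoid (Vertex m ℤ) :=
  partitionOfParts (sigmaParts m K) (sigmaParts_pairwiseDisjoint m K)

instance : Finite EdgeKind :=
  Finite.of_injective (fun t => match t with | EdgeKind.low => true | EdgeKind.high => false) (by
    intro s t h
    cases s <;> cases t <;> simp_all)

/-- Only finitely many edges of the universal cover meet a given finite set of vertices. -/
instance truncEdge_finite {n m : ℕ} (c : Edge m (ZMod n) → ℝ) (S : Finset (Vertex m ℤ)) :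
    Finite ((universalCover c).TruncEdge S) := by
  have hfin : (Set.univ ×ˢ (((S.image Prod.snd ∪ S.image fun v => v.2 + 1 : Finset ℤ) : Set ℤ) ×ˢ
      Set.univ) : Set (Edge m ℤ)).Finite :=
    Set.finite_univ.prod ((Finset.finite_toSet _).prod Set.finite_univ)
  refine (hfin.subset ?_).to_subtype
  rintro ⟨k, i, t⟩ ⟨u, hu, hue⟩
  refine ⟨trivial, ?_, trivial⟩
  simp only [Finset.coe_union, Finset.coe_image, Set.mem_union, Set.mem_image]
  cases t <;> simp only [universalCover, network, ends, Sym2.mem_iff] at hue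
  · rcases hue with rfl | rfl
    · exact Or.inl ⟨_, hu, rfl⟩
    · exact Or.inl ⟨_, hu, rfl⟩
  · rcases hue with rfl | rfl
    · exact Or.inl ⟨_, hu, rfl⟩
    · exact Or.inr ⟨_, hu, by simp⟩

instance truncEdge_fintype {n m : ℕ} (c : Edge m (ZMod n) → ℝ) (S : Finset (Vertex m ℤ)) :
    Fintype ((universalCover c).TruncEdge S) :=
  Fintype.ofFinite _

/-- `uPr(π)` on the truncation `G(N)` of the universal cover to the finite vertex set `S`, for a
partition `π` of the vertices of the universal cover. -/
def uPrTrunc {n m : ℕ} (c : Edge m (ZMod n) → ℝ) (S : Finset (Vertex m ℤ))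
    (π : Setoid (Vertex m ℤ)) : ℝ :=
  ((universalCover c).truncation S).uPr ((universalCover c).truncPartition S π)

end NNetwork

end

/-!
Groves are treated as edge sets of the universal cover. The interior vertices form a set `I`, and
`wsum c F (Good ends I π)` is the total weight `Z(π)` of the groves with edges in `F` and boundary
partition `π`. On a truncation `uPr(π) = Z(π) / Z(singletons)`
(`ElectricalNetwork.uPr_truncation`).

*The inner limits.* For `π = σ_K` and `π = τ_K` the number `uPr(π)` increases with the truncation.
New edges between boundary vertices only add groves (`EdgeSet.ratio_mono_edges`). Making a
singleton boundary vertex `x` interior does not decrease `uPr(π)` either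
(`EdgeSet.wsum_mul_le_insert`): the weight of the groves in which `v` lies in the component of `x`
is a subharmonic function of `v` for the partition `π` and a superharmonic one for the singletons,
so that the maximum principle compares the two. As `uPr(π)` is also bounded
(`EdgeSet.wsum_sparse_le`) and `uPr(τ_K)` is positive, the limits exist.

*Comparison of `σ_K` and `τ_K`.* Let `e` be the high edge and `f` the low edge at the left vertex
`1`, and `a` the conductance of `e`. By planarity of the strip the component of the right vertex
`r'` stays in the rows from `r` on if sufficiently many neighbouring components cross the strip too
(`NNetwork.confined_below`). Hence in a grove of type `τ_K` the other end of `e` lies in the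
component of the left vertex `0`, and adding `e` gives a grove of type `σ_K`. Conversely a grove of
type `σ_K` without `f` contains `e`, and loses it to a grove of type `τ_K`. Therefore
`a * Z(τ_K) ≤ Z(σ_K) ≤ a * Z(τ_K) + Z(σ_K, f)`, where `Z(σ_K, f)` is the weight of the groves of
type `σ_K` which contain `f`.

*The groves containing `f`.* It remains to see that `Z(σ_K, f) / Z(σ_K)` is small for large `K`,
uniformly in the truncation (`NNetwork.mul_wsum_sigma_low_le`). Above the row `0` the components
of a grove of type `σ_K` run along two neighbouring rows each. The layers in which a component has
descended to its lower row form a set which shrinks from one component to the next, so that it is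
constant along a long block of rows (`NNetwork.exists_constant_block`). In such a block all
components are parallel paths along low edges with one high edge, after the same layer `j`
(`NNetwork.exists_clean`). Now `n * t` rows of the block are deleted, and as many new rows are
inserted next to the row `0`, each of them descending along a high edge in the first gap. The rows
in between move up, and the result is again a grove of type `σ_K`
(`NNetwork.Insertable.good_insertRows`). Its weight is that of the original grove times
`(R_1 / R_{j+1}) ^ t`, which is at least `1` by assumption. As `t` and the original grove can be
recovered from the result, up to the choice of the block and of `j`, letting `t` vary over `N`
values gives `N * Z(σ_K, f) ≤ m ^ 2 * Z(σ_K)`.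
-/

noncomputable section

/-! ### Connectivity and forests given by sets of edges -/

namespace EdgeSet

variable {V E : Type} (ends : E → Sym2 V)

/-- Two vertices are the ends of an edge of `Γ`. -/
def Linked (Γ : Finset E) (a b : V) : Prop := ∃ e ∈ Γ, ends e = s(a, b)

/-- Two vertices lie in the same component of the graph with edge set `Γ`. -/
def Conn (Γ : Finset E) : V → V → Prop := Relation.ReflTransGen (Linked ends Γ)

/-- Every edge of `Γ` is a bridge: its ends are not joined by the remaining edges. This excludes
loops, parallel edges and longer cycles at once. -/
def Forest [DecidableEq E] (Γ : Finset E) : Prop :=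
  ∀ e ∈ Γ, ∀ a b, ends e = s(a, b) → ¬ Conn ends (Γ.erase e) a b

/-- `Γ` is a grove with set of interior vertices `I` and boundary partition `π`. -/
structure Good [DecidableEq E] (I : Set V) (π : V → V → Prop) (Γ : Finset E) : Prop where
  forest : Forest ends Γ
  grounded : ∀ v ∈ I, ∃ b, b ∉ I ∧ Conn ends Γ v b
  type : ∀ b c, b ∉ I → c ∉ I → (Conn ends Γ b c ↔ π b c)

variable {ends} {Γ Δ : Finset E} {a b x y z v : V}

lemma Linked.symm (h : Linked ends Γ a b) : Linked ends Γ b a := by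
  obtain ⟨e, he, h⟩ := h
  exact ⟨e, he, h.trans Sym2.eq_swap⟩

lemma Linked.mono (hs : Γ ⊆ Δ) (h : Linked ends Γ a b) : Linked ends Δ a b := by
  obtain ⟨e, he, h⟩ := h
  exact ⟨e, hs he, h⟩

lemma Conn.refl (a : V) : Conn ends Γ a a := Relation.ReflTransGen.refl

lemma Conn.trans (h : Conn ends Γ a b) (h' : Conn ends Γ b x) : Conn ends Γ a x :=
  Relation.ReflTransGen.trans h h'

lemma Conn.symm (h : Conn ends Γ a b) : Conn ends Γ b a := by
  induction h with
  | refl => exact Conn.refl _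
  | tail _ h ih => exact Relation.ReflTransGen.head h.symm ih

lemma Conn.mono (hs : Γ ⊆ Δ) (h : Conn ends Γ a b) : Conn ends Δ a b :=
  Relation.ReflTransGen.mono (fun _ _ (h : Linked ends Γ _ _) => h.mono hs) _ _ h

lemma Conn.of_mem {e : E} (he : e ∈ Γ) (h : ends e = s(a, b)) : Conn ends Γ a b :=
  Relation.ReflTransGen.single ⟨e, he, h⟩

/-- A path from `v` to another vertex `x` starts with an edge at `v` and can be taken not to use
any other edge at `v`. -/
lemma Conn.exists_first [DecidableEq V] (h : Conn ends Γ v x) (hvx : v ≠ x) :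
    ∃ e ∈ Γ, ∃ u, ends e = s(v, u) ∧ Conn ends (Γ.filter fun e => v ∉ ends e) u x := by
  have key : ∀ y, Conn ends Γ y x → Conn ends (Γ.filter fun e => v ∉ ends e) y x ∨
      ∃ e ∈ Γ, ∃ u, ends e = s(v, u) ∧ Conn ends (Γ.filter fun e => v ∉ ends e) u x := by
    intro y hy
    induction hy using Relation.ReflTransGen.head_induction_on with
    | refl => exact Or.inl (Conn.refl _)
    | @head y y' h _ ih =>
      rcases ih with ih | ih
      · obtain ⟨e, he, hyy⟩ := h
        by_cases hv : v ∈ ends e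
        · rw [hyy, Sym2.mem_iff] at hv
          rcases hv with rfl | rfl
          · exact Or.inr ⟨e, he, y', hyy, ih⟩
          · rcases Relation.ReflTransGen.cases_head ih with rfl | ⟨w, ⟨e', he', hw⟩, _⟩
            · exact absurd rfl hvx
            · rw [Finset.mem_filter, hw] at he'
              exact absurd (Sym2.mem_mk_left _ _) he'.2
        · exact Or.inl (Relation.ReflTransGen.head
            ⟨e, Finset.mem_filter.mpr ⟨he, hv⟩, hyy⟩ ih)
      · exact Or.inr ih
  rcases key v h with h | h
  · rcases Relation.ReflTransGen.cases_head h with rfl | ⟨w, ⟨e', he', hw⟩, _⟩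
    · exact absurd rfl hvx
    · rw [Finset.mem_filter, hw] at he'
      exact absurd (Sym2.mem_mk_left _ _) he'.2
  · exact h

/-- A component not containing `v` does not use the edges at `v`. -/
lemma Conn.avoid [DecidableEq V] (h : Conn ends Γ x y) (hv : ¬ Conn ends Γ x v) :
    Conn ends (Γ.filter fun e => v ∉ ends e) x y := by
  induction h with
  | refl => exact Conn.refl _
  | @tail y z h1 h ih =>
    refine ih.tail ?_
    obtain ⟨e, he, hyz⟩ := h
    refine ⟨e, Finset.mem_filter.mpr ⟨he, fun hm => hv ?_⟩, hyz⟩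
    rw [hyz, Sym2.mem_iff] at hm
    rcases hm with rfl | rfl
    · exact h1
    · exact h1.tail ⟨e, he, hyz⟩

variable [DecidableEq E]

lemma conn_insert {e : E} (he : ends e = s(a, b)) :
    Conn ends (insert e Γ) x y ↔ Conn ends Γ x y ∨ (Conn ends Γ x a ∧ Conn ends Γ b y) ∨
      (Conn ends Γ x b ∧ Conn ends Γ a y) := by
  have hs : Γ ⊆ insert e Γ := Finset.subset_insert _ _
  have hab : Conn ends (insert e Γ) a b := Conn.of_mem (Finset.mem_insert_self _ _) he
  constructor
  · intro h
    induction h with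
    | refl => exact Or.inl (Conn.refl _)
    | @tail y z _ h ih =>
      obtain ⟨e', he', h⟩ := h
      rcases Finset.mem_insert.mp he' with rfl | he'
      · rw [he, Sym2.eq_iff] at h
        rcases h with ⟨rfl, rfl⟩ | ⟨rfl, rfl⟩
        · rcases ih with h | ⟨h, h'⟩ | ⟨h, h'⟩
          · exact Or.inr (Or.inl ⟨h, Conn.refl _⟩)
          · exact Or.inr (Or.inl ⟨h, Conn.refl _⟩)
          · exact Or.inl h
        · rcases ih with h | ⟨h, h'⟩ | ⟨h, h'⟩
          · exact Or.inr (Or.inr ⟨h, Conn.refl _⟩)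
          · exact Or.inl h
          · exact Or.inr (Or.inr ⟨h, Conn.refl _⟩)
      · have hyz : Conn ends Γ y z := Conn.of_mem he' h
        rcases ih with h | ⟨h, h'⟩ | ⟨h, h'⟩
        · exact Or.inl (h.trans hyz)
        · exact Or.inr (Or.inl ⟨h, h'.trans hyz⟩)
        · exact Or.inr (Or.inr ⟨h, h'.trans hyz⟩)
  · rintro (h | ⟨h, h'⟩ | ⟨h, h'⟩)
    · exact h.mono hs
    · exact (h.mono hs).trans (hab.trans (h'.mono hs))
    · exact (h.mono hs).trans (hab.symm.trans (h'.mono hs))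

lemma conn_erase {e : E} (he : ends e = s(a, b)) (hm : e ∈ Γ) :
    Conn ends Γ x y ↔ Conn ends (Γ.erase e) x y ∨
      (Conn ends (Γ.erase e) x a ∧ Conn ends (Γ.erase e) b y) ∨
      (Conn ends (Γ.erase e) x b ∧ Conn ends (Γ.erase e) a y) := by
  conv_lhs => rw [← Finset.insert_erase hm]
  exact conn_insert he

lemma Forest.insert {e : E} (hΓ : Forest ends Γ) (he : ends e = s(a, b))
    (hab : ¬ Conn ends Γ a b) : Forest ends (insert e Γ) := by
  have heΓ : e ∉ Γ := fun h => hab (Conn.of_mem h he)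
  intro e' he' c d hcd
  rcases Finset.mem_insert.mp he' with rfl | he'
  · rw [Finset.erase_insert heΓ]
    rw [he, Sym2.eq_iff] at hcd
    rcases hcd with ⟨rfl, rfl⟩ | ⟨rfl, rfl⟩
    · exact hab
    · exact fun h => hab h.symm
  · have hne : e ≠ e' := fun h => heΓ (h ▸ he')
    rw [Finset.erase_insert_of_ne hne, conn_insert he]
    have hs : Γ.erase e' ⊆ Γ := Finset.erase_subset _ _
    have hc : Conn ends Γ c d := Conn.of_mem he' hcd
    rintro (h | ⟨h, h'⟩ | ⟨h, h'⟩)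
    · exact hΓ e' he' c d hcd h
    · exact hab ((h.mono hs).symm.trans (hc.trans (h'.mono hs).symm))
    · exact hab ((h'.mono hs).trans (hc.symm.trans (h.mono hs)))

lemma Forest.mono (hΓ : Forest ends Γ) (hs : Δ ⊆ Γ) : Forest ends Δ := fun e he a b hab h =>
  hΓ e (hs he) a b hab (h.mono (Finset.erase_subset_erase _ hs))

lemma Conn.avoid_erase [DecidableEq V] {e : E} (h : Conn ends Γ x y) (hv : ¬ Conn ends Γ x v)
    (he : v ∈ ends e) : Conn ends (Γ.erase e) x y := by
  refine (h.avoid hv).mono fun e' he' => ?_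
  rw [Finset.mem_filter] at he'
  exact Finset.mem_erase.mpr ⟨fun h => he'.2 (h ▸ he), he'.1⟩

lemma Conn.exists_first_erase [DecidableEq V] (h : Conn ends Γ v x) (hvx : v ≠ x) :
    ∃ e ∈ Γ, ∃ u, ends e = s(v, u) ∧ Conn ends (Γ.erase e) u x := by
  obtain ⟨e, he, u, hu, hc⟩ := h.exists_first hvx
  refine ⟨e, he, u, hu, hc.mono fun e' he' => ?_⟩
  rw [Finset.mem_filter] at he'
  exact Finset.mem_erase.mpr ⟨fun h => he'.2 (by rw [h, hu]; exact Sym2.mem_mk_left _ _), he'.1⟩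

lemma Forest.not_conn {e : E} (hΓ : Forest ends Γ) (he : e ∈ Γ) (h : ends e = s(a, b)) :
    ¬ Conn ends (Γ.erase e) a b := hΓ e he a b h

lemma Forest.ne {e : E} (hΓ : Forest ends Γ) (he : e ∈ Γ) (h : ends e = s(a, b)) : a ≠ b := by
  rintro rfl
  exact hΓ e he a a h (Conn.refl _)

end EdgeSet

/-! ### Monotonicity of normalized grove counts when a vertex becomes interior -/

namespace EdgeSet

variable {V E : Type} {ends : E → Sym2 V} [DecidableEq E]
  {I : Set V} {π : V → V → Prop} {Γ Δ : Finset E} {v x : V} {e : E}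

/-- `Γ` is a grove, and the edge `e` leads from the component of the boundary vertex `x`, which it
leaves at `v`, to another component. -/
def Exits (ends : E → Sym2 V) (I : Set V) (π : V → V → Prop) (x v : V) (e : E) (Γ : Finset E) :
    Prop :=
  Good ends I π Γ ∧ ∃ w, ends e = s(v, w) ∧ Conn ends Γ v x ∧ ¬ Conn ends Γ w x

/-- `Γ` is a grove, and the edge `e` leads from `v` into the component of the boundary vertex `x`,
which does not contain `v`. -/
def Enters (ends : E → Sym2 V) (I : Set V) (π : V → V → Prop) (x v : V) (e : E) (Γ : Finset E) :
    Prop :=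
  Good ends I π Γ ∧ ∃ w, ends e = s(v, w) ∧ ¬ Conn ends Γ v x ∧ Conn ends Γ w x

lemma Exits.notMem (h : Exits ends I π x v e Γ) : e ∉ Γ := by
  obtain ⟨_, w, he, hv, hw⟩ := h
  exact fun hm => hw ((Conn.of_mem hm he).symm.trans hv)

lemma Enters.notMem (h : Enters ends I π x v e Γ) : e ∉ Γ := by
  obtain ⟨_, w, he, hv, hw⟩ := h
  exact fun hm => hv ((Conn.of_mem hm he).trans hw)

/-- The component of a vertex outside the component of `x` contains a boundary vertex other than
`x`. -/
lemma Good.exists_root {w : V} (h : Good ends I π Γ) (hw : ¬ Conn ends Γ w x) :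
    ∃ b, b ∉ I ∧ b ≠ x ∧ Conn ends Γ w b := by
  by_cases hI : w ∈ I
  · obtain ⟨b, hb, hc⟩ := h.grounded w hI
    exact ⟨b, hb, fun hbx => hw (hbx ▸ hc), hc⟩
  · exact ⟨w, hI, fun hbx => hw (hbx ▸ Conn.refl _), Conn.refl _⟩

variable [DecidableEq V]

/-- An edge set arises in at most one way by adding to a grove an edge which leaves the component of
`x` at `v`. -/
lemma Exits.unique {e' : E} (hx : x ∉ I) (hπ : ∀ b, π b x ↔ b = x) (he : e ∈ Δ)
    (h : Exits ends I π x v e (Δ.erase e)) (h' : Exits ends I π x v e' (Δ.erase e')) : e = e' := by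
  by_contra hne
  obtain ⟨hg, w, hw, hv, hwx⟩ := h
  obtain ⟨hg', w', hw', hv', hwx'⟩ := h'
  obtain ⟨b, hb, hbx, hc⟩ := hg.exists_root hwx
  have hvw : ¬ Conn ends (Δ.erase e) w v := fun hc => hwx (hc.trans hv)
  have hc2 : Conn ends ((Δ.erase e).erase e') w b :=
    hc.avoid_erase hvw (by rw [hw']; exact Sym2.mem_mk_left _ _)
  have hc3 : Conn ends (Δ.erase e') w b := hc2.mono fun f hf => by
    simp only [Finset.mem_erase] at hf ⊢; tauto
  have hc4 : Conn ends (Δ.erase e') v w := Conn.of_mem (Finset.mem_erase.mpr ⟨hne, he⟩) hw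
  have : Conn ends (Δ.erase e') b x := (hc4.trans hc3).symm.trans hv'
  exact hbx ((hπ b).mp ((hg'.type b x hb hx).mp this))

/-- An edge set arises in at most one way by adding to a grove an edge from `v` into the component
of `x`. -/
lemma Enters.unique {e' : E} (he : e ∈ Δ)
    (h : Enters ends I π x v e (Δ.erase e)) (h' : Enters ends I π x v e' (Δ.erase e')) :
    e = e' := by
  by_contra hne
  obtain ⟨hg, w, hw, hv, hwx⟩ := h
  obtain ⟨hg', w', hw', hv', hwx'⟩ := h'
  have hvw : ¬ Conn ends (Δ.erase e) w v := fun hc => hv (hc.symm.trans hwx)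
  have hc2 : Conn ends ((Δ.erase e).erase e') w x :=
    hwx.avoid_erase hvw (by rw [hw']; exact Sym2.mem_mk_left _ _)
  have hc3 : Conn ends (Δ.erase e') w x := hc2.mono fun f hf => by
    simp only [Finset.mem_erase] at hf ⊢; tauto
  have hc4 : Conn ends (Δ.erase e') v w := Conn.of_mem (Finset.mem_erase.mpr ⟨hne, he⟩) hw
  exact hv' (hc4.trans hc3)

/-- Exchange an edge leaving the component of `x` at `v` for the first edge on the path from `v` to
`x`: the component of `x` shrinks, and the boundary partition stays. -/
lemma Exits.exists_enters (hx : x ∉ I) (hπ : ∀ b, π b x ↔ b = x)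
    (hv : v ∈ I) (he : e ∈ Δ) (h : Exits ends I π x v e (Δ.erase e)) :
    ∃ e' ∈ Δ, Enters ends I π x v e' (Δ.erase e') := by
  have heΓ := h.notMem
  obtain ⟨hg, w, hw, hvx, hwx⟩ := h
  set Γ := Δ.erase e with hΓ
  have hne : v ≠ x := fun h => hx (h ▸ hv)
  obtain ⟨e', he', u, hu, hux⟩ := hvx.exists_first_erase hne
  have hee : e ≠ e' := fun h => heΓ (h ▸ he')
  have hΔ : Δ.erase e' = insert e (Γ.erase e') := by
    rw [← Finset.erase_insert_of_ne hee, hΓ, Finset.insert_erase he]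
  have hs : Γ.erase e' ⊆ Γ := Finset.erase_subset _ _
  have hvu := hg.forest.not_conn he' hu
  have hvG : ¬ Conn ends (Γ.erase e') v x := fun h => hvu (h.trans hux.symm)
  have hwv : ¬ Conn ends Γ w v := fun h => hwx (h.trans hvx)
  obtain ⟨b, hb, hbx, hwb⟩ := hg.exists_root hwx
  have hwb' : Conn ends (Γ.erase e') w b :=
    hwb.avoid_erase hwv (by rw [hu]; exact Sym2.mem_mk_left _ _)
  have hvroot : ∀ c, c ∉ I → ¬ Conn ends (Γ.erase e') v c := fun c hc h => by
    have h1 : Conn ends Γ c x := (h.mono hs).symm.trans hvx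
    rw [hg.type c x hc hx, hπ] at h1
    exact hvG (h1 ▸ h)
  refine ⟨e', Finset.mem_of_mem_erase he', ?_⟩
  rw [hΔ]
  refine ⟨⟨?_, ?_, ?_⟩, u, hu, ?_, hux.mono (Finset.subset_insert _ _)⟩
  · exact (hg.forest.mono hs).insert hw fun h => hwv (h.mono hs).symm
  · intro y hy
    obtain ⟨c, hc, hyc⟩ := hg.grounded y hy
    rw [conn_erase hu he'] at hyc
    rcases hyc with hyc | ⟨hyv, -⟩ | ⟨hyu, -⟩
    · exact ⟨c, hc, (conn_insert hw).mpr (Or.inl hyc)⟩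
    · exact ⟨b, hb, (conn_insert hw).mpr (Or.inr (Or.inl ⟨hyv, hwb'⟩))⟩
    · exact ⟨x, hx, (conn_insert hw).mpr (Or.inl (hyu.trans hux))⟩
  · intro c d hc hd
    rw [← hg.type c d hc hd, conn_insert hw, conn_erase hu he']
    constructor
    · rintro (h | ⟨h, -⟩ | ⟨-, h⟩)
      · exact Or.inl h
      · exact absurd h.symm (hvroot c hc)
      · exact absurd h (hvroot d hd)
    · rintro (h | ⟨h, -⟩ | ⟨-, h⟩)
      · exact Or.inl h
      · exact absurd h.symm (hvroot c hc)
      · exact absurd h (hvroot d hd)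
  · rw [conn_insert hw]
    rintro (h | ⟨-, h⟩ | ⟨h, -⟩)
    · exact hvG h
    · exact hwx (h.mono hs)
    · exact hwv (h.mono hs).symm

/-- If all boundary vertices are singletons, the exchange can be reversed: an edge from `v` into the
component of `x` replaces the first edge on the path from `v` to its own boundary vertex. -/
lemma Enters.exists_exits (hx : x ∉ I) (hv : v ∈ I) (he : e ∈ Δ)
    (h : Enters ends I Eq x v e (Δ.erase e)) :
    ∃ e' ∈ Δ, Exits ends I Eq x v e' (Δ.erase e') := by
  have heΓ := h.notMem
  obtain ⟨hg, u, hu, hvx, hux⟩ := h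
  set Γ := Δ.erase e with hΓ
  obtain ⟨b, hb, hbx, hvb⟩ := hg.exists_root hvx
  have hne : v ≠ b := fun h => hb (h ▸ hv)
  obtain ⟨e', he', w, hw, hwb⟩ := hvb.exists_first_erase hne
  have hee : e ≠ e' := fun h => heΓ (h ▸ he')
  have hΔ : Δ.erase e' = insert e (Γ.erase e') := by
    rw [← Finset.erase_insert_of_ne hee, hΓ, Finset.insert_erase he]
  have hs : Γ.erase e' ⊆ Γ := Finset.erase_subset _ _
  have hvw := hg.forest.not_conn he' hw
  have huv : ¬ Conn ends Γ v u := fun h => hvx (h.trans hux)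
  have hux' : Conn ends (Γ.erase e') u x :=
    hux.avoid_erase (fun h => huv h.symm) (by rw [hw]; exact Sym2.mem_mk_left _ _)
  have hvroot : ∀ c, c ∉ I → ¬ Conn ends (Γ.erase e') v c := fun c hc h => by
    have h1 : Conn ends Γ c b := (h.mono hs).symm.trans hvb
    rw [hg.type c b hc hb] at h1
    exact hvw ((h1 ▸ h).trans hwb.symm)
  refine ⟨e', Finset.mem_of_mem_erase he', ?_⟩
  rw [hΔ]
  refine ⟨⟨?_, ?_, ?_⟩, w, hw, (conn_insert hu).mpr (Or.inr (Or.inl ⟨Conn.refl _, hux'⟩)), ?_⟩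
  · exact (hg.forest.mono hs).insert hu fun h => huv (h.mono hs)
  · intro y hy
    obtain ⟨c, hc, hyc⟩ := hg.grounded y hy
    rw [conn_erase hw he'] at hyc
    rcases hyc with hyc | ⟨hyv, -⟩ | ⟨hyw, -⟩
    · exact ⟨c, hc, (conn_insert hu).mpr (Or.inl hyc)⟩
    · exact ⟨x, hx, (conn_insert hu).mpr (Or.inr (Or.inl ⟨hyv, hux'⟩))⟩
    · exact ⟨b, hb, (conn_insert hu).mpr (Or.inl (hyw.trans hwb))⟩
  · intro c d hc hd
    rw [← hg.type c d hc hd, conn_insert hu, conn_erase hw he']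
    constructor
    · rintro (h | ⟨h, -⟩ | ⟨-, h⟩)
      · exact Or.inl h
      · exact absurd h.symm (hvroot c hc)
      · exact absurd h (hvroot d hd)
    · rintro (h | ⟨h, -⟩ | ⟨-, h⟩)
      · exact Or.inl h
      · exact absurd h.symm (hvroot c hc)
      · exact absurd h (hvroot d hd)
  · have hvw' : Conn ends Γ v w := Conn.of_mem he' hw
    rw [conn_insert hu]
    rintro (h | ⟨h, -⟩ | ⟨h, -⟩)
    · exact hvx (hvw'.trans (h.mono hs))
    · exact hvw h.symm
    · exact huv (hvw'.trans (h.mono hs))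

/-- If an edge at `x` joins the component of `x` to another one, then `x` becomes interior. -/
lemma Exits.good_insert (hx : x ∉ I) (hπ : ∀ b, π b x ↔ b = x) (hπ' : ∀ b, π x b ↔ b = x)
    (he : e ∈ Δ) (h : Exits ends I π x x e (Δ.erase e)) : Good ends (insert x I) π Δ := by
  obtain ⟨hg, w, hw, hvx, hwx⟩ := h
  obtain ⟨b, hb, hbx, hwb⟩ := hg.exists_root hwx
  have hbI : b ∉ insert x I := by simp [hbx, hb]
  have hxb : Conn ends Δ x b :=
    (Conn.of_mem he hw).trans (hwb.mono (Finset.erase_subset _ _))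
  refine ⟨?_, ?_, ?_⟩
  · rw [← Finset.insert_erase he]
    exact hg.forest.insert hw fun h => hwx h.symm
  · rintro y (rfl | hy)
    · exact ⟨b, hbI, hxb⟩
    · obtain ⟨c, hc, hyc⟩ := hg.grounded y hy
      have hyc' := hyc.mono (Finset.erase_subset _ _)
      by_cases hcx : c = x
      · exact ⟨b, hbI, (hcx ▸ hyc').trans hxb⟩
      · exact ⟨c, by simp [hcx, hc], hyc'⟩
  · intro c d hc hd
    simp only [Set.mem_insert_iff, not_or] at hc hd
    rw [← hg.type c d hc.2 hd.2, conn_erase hw he]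
    constructor
    · rintro (h | ⟨h, -⟩ | ⟨-, h⟩)
      · exact h
      · rw [hg.type c x hc.2 hx, hπ] at h
        exact absurd h hc.1
      · rw [hg.type x d hx hd.2, hπ'] at h
        exact absurd h hd.1
    · exact Or.inl

/-- In a grove which separates all boundary vertices, removing the first edge on the path from an
interior vertex `x` to the boundary turns `x` into a singleton boundary vertex. -/
lemma Good.exists_exits (hx : x ∉ I) (h : Good ends (insert x I) Eq Δ) :
    ∃ e ∈ Δ, Exits ends I Eq x x e (Δ.erase e) := by
  obtain ⟨b, hb, hxb⟩ := h.grounded x (Set.mem_insert _ _)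
  have hb' : b ≠ x ∧ b ∉ I := by simpa using hb
  obtain ⟨e, he, w, hw, hwb⟩ := hxb.exists_first_erase (Ne.symm hb'.1)
  have hs : Δ.erase e ⊆ Δ := Finset.erase_subset _ _
  have hxw := h.forest.not_conn he hw
  have hxc : ∀ c, c ∉ I → c ≠ x → ¬ Conn ends (Δ.erase e) x c := fun c hc hcx hxc => by
    have h1 : Conn ends Δ c b := (hxc.mono hs).symm.trans hxb
    rw [h.type c b (by simp [hc, hcx]) hb] at h1
    exact hxw ((h1 ▸ hxc).trans hwb.symm)
  refine ⟨e, he, ⟨h.forest.mono hs, ?_, ?_⟩, w, hw, Conn.refl _, fun h => hxw h.symm⟩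
  · intro y hy
    obtain ⟨c, hc, hyc⟩ := h.grounded y (Set.mem_insert_of_mem _ hy)
    rw [conn_erase hw he] at hyc
    rcases hyc with hyc | ⟨hyx, -⟩ | ⟨hyw, -⟩
    · exact ⟨c, fun h => hc (Set.mem_insert_of_mem _ h), hyc⟩
    · exact ⟨x, hx, hyx⟩
    · exact ⟨b, hb'.2, hyw.trans hwb⟩
  · intro c d hc hd
    constructor
    · intro hcd
      by_cases hcx : c = x
      · by_cases hdx : d = x
        · rw [hcx, hdx]
        · exact absurd (hcx ▸ hcd) (hxc d hd hdx)
      · by_cases hdx : d = x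
        · exact absurd (hdx ▸ hcd).symm (hxc c hc hcx)
        · exact (h.type c d (by simp [hc, hcx]) (by simp [hd, hdx])).mp (hcd.mono hs)
    · rintro rfl
      exact Conn.refl _

end EdgeSet

/-! ### Weighted counts of groves and the maximum principle -/

namespace EdgeSet

variable {V E : Type} {ends : E → Sym2 V}
  {I : Set V} {π : V → V → Prop} {F : Finset E} {c : E → ℝ}

open Classical in
/-- The total weight of the subsets of `F` with property `P`. -/
def wsum (c : E → ℝ) (F : Finset E) (P : Finset E → Prop) : ℝ :=
  ∑ Γ ∈ F.powerset with P Γ, ∏ e ∈ Γ, c e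

open Classical in
lemma wsum_eq (P : Finset E → Prop) :
    wsum c F P = ∑ Γ ∈ F.powerset, if P Γ then ∏ e ∈ Γ, c e else 0 := by
  rw [wsum, Finset.sum_filter]

lemma wsum_congr {P Q : Finset E → Prop} (h : ∀ Γ ⊆ F, P Γ ↔ Q Γ) : wsum c F P = wsum c F Q := by
  classical
  rw [wsum_eq, wsum_eq]
  refine Finset.sum_congr rfl fun Γ hΓ => ?_
  simp only [h Γ (Finset.mem_powerset.mp hΓ)]

lemma prod_nonneg' (hc : ∀ e, 0 < c e) (Γ : Finset E) : 0 ≤ ∏ e ∈ Γ, c e :=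
  Finset.prod_nonneg fun e _ => (hc e).le

lemma wsum_nonneg (hc : ∀ e, 0 < c e) (P : Finset E → Prop) : 0 ≤ wsum c F P :=
  Finset.sum_nonneg fun Γ _ => prod_nonneg' hc Γ

lemma wsum_mono (hc : ∀ e, 0 < c e) {F' : Finset E} {P Q : Finset E → Prop} (hF : F ⊆ F')
    (h : ∀ Γ ⊆ F, P Γ → Q Γ) : wsum c F P ≤ wsum c F' Q := by
  classical
  refine Finset.sum_le_sum_of_subset_of_nonneg (fun Γ hΓ => ?_) fun Γ _ _ => prod_nonneg' hc Γ
  simp only [Finset.mem_filter, Finset.mem_powerset] at hΓ ⊢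
  exact ⟨hΓ.1.trans hF, h Γ hΓ.1 hΓ.2⟩

lemma wsum_pos (hc : ∀ e, 0 < c e) {P : Finset E → Prop} {Γ : Finset E} (hΓ : Γ ⊆ F) (h : P Γ) :
    0 < wsum c F P := by
  classical
  refine Finset.sum_pos (fun Γ _ => Finset.prod_pos fun e _ => hc e) ⟨Γ, ?_⟩
  simp [hΓ, h]

lemma wsum_add (P Q R : Finset E → Prop) (h : ∀ Γ ⊆ F, P Γ ↔ Q Γ ∨ R Γ)
    (h' : ∀ Γ ⊆ F, Q Γ → ¬ R Γ) : wsum c F P = wsum c F Q + wsum c F R := by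
  classical
  simp only [wsum_eq, ← Finset.sum_add_distrib]
  refine Finset.sum_congr rfl fun Γ hΓ => ?_
  have hs := Finset.mem_powerset.mp hΓ
  have h1 := h Γ hs
  have h2 := h' Γ hs
  by_cases hQ : Q Γ <;> by_cases hR : R Γ <;> simp_all

/-- Maximum principle: a function which is subharmonic on the finite set `I` and not positive
outside is nowhere positive, provided that every vertex of `I` is connected to the complement. -/
lemma max_principle (hc : ∀ e, 0 < c e) (hI : I.Finite) (D : V → ℝ)
    (hD0 : ∀ b, b ∉ I → D b ≤ 0) (X : V → E → ℝ)
    (hX : ∀ v e w, ends e = s(v, w) → X v e = D v - D w)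
    (hX0 : ∀ v e, v ∉ ends e → X v e = 0)
    (hsub : ∀ v ∈ I, ∑ e ∈ F, c e * X v e ≤ 0)
    (hconn : ∀ v ∈ I, ∃ b, b ∉ I ∧ Conn ends F v b) (v : V) : D v ≤ 0 := by
  by_contra! hv
  have hvI : v ∈ I := by
    by_contra h
    exact absurd (hD0 v h) (not_le.mpr hv)
  obtain ⟨u, huI, hmax⟩ := hI.exists_maximalFor D I ⟨v, hvI⟩
  have hmax' : ∀ w, D w ≤ D u := by
    intro w
    have huv : D v ≤ D u := by
      by_contra! h
      exact absurd (hmax hvI h.le) (not_le.mpr h)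
    by_cases hw : w ∈ I
    · by_contra! h
      exact absurd (hmax hw h.le) (not_le.mpr h)
    · exact (hD0 w hw).trans (hv.le.trans huv)
  have hpos : 0 < D u := hv.trans_le (hmax' v)
  obtain ⟨b, hb, hub⟩ := hconn u huI
  have key : ∀ w, Conn ends F u w → D w = D u := by
    intro w hw
    induction hw with
    | refl => rfl
    | @tail y z _ h ih =>
      obtain ⟨e, he, hyz⟩ := h
      have hyI : y ∈ I := by
        by_contra h
        exact absurd (hD0 y h) (by rw [ih]; exact not_le.mpr hpos)
      have hnn : ∀ e ∈ F, 0 ≤ c e * X y e := by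
        intro e _
        refine mul_nonneg (hc e).le ?_
        by_cases hye : y ∈ ends e
        · obtain ⟨w, hw⟩ := hye
          rw [hX y e w hw, ih]
          exact sub_nonneg.mpr (hmax' w)
        · exact (hX0 y e hye).ge
      have h0 := (Finset.sum_eq_zero_iff_of_nonneg hnn).mp
        (le_antisymm (hsub y hyI) (Finset.sum_nonneg hnn)) e he
      rw [hX y e z hyz, mul_eq_zero] at h0
      rcases h0 with h0 | h0
      · exact absurd h0 (hc e).ne'
      · linarith
  have := key b hub
  exact absurd (hD0 b hb) (by rw [this]; exact not_le.mpr hpos)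

variable [DecidableEq E]

open Classical in
/-- Both sides count the pairs of a set `Δ` and an edge `e ∈ Δ` such that `P e (Δ \ {e})`. -/
lemma sum_mul_wsum (P : E → Finset E → Prop) (hP : ∀ e Γ, P e Γ → e ∉ Γ) :
    ∑ e ∈ F, c e * wsum c F (P e) =
      ∑ Δ ∈ F.powerset, (∏ e ∈ Δ, c e) * ((Δ.filter fun e => P e (Δ.erase e)).card : ℝ) := by
  have h1 : ∀ e ∈ F, c e * wsum c F (P e) =
      ∑ Δ ∈ F.powerset, if e ∈ Δ ∧ P e (Δ.erase e) then ∏ e ∈ Δ, c e else 0 := by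
    intro e he
    rw [wsum, Finset.mul_sum, ← Finset.sum_filter]
    refine Finset.sum_bij' (fun Γ _ => insert e Γ) (fun Δ _ => Δ.erase e) ?_ ?_ ?_ ?_ ?_
    · intro Γ hΓ
      simp only [Finset.mem_filter, Finset.mem_powerset] at hΓ ⊢
      have := hP e Γ hΓ.2
      refine ⟨Finset.insert_subset he hΓ.1, Finset.mem_insert_self _ _, ?_⟩
      rw [Finset.erase_insert this]
      exact hΓ.2
    · intro Δ hΔ
      simp only [Finset.mem_filter, Finset.mem_powerset] at hΔ ⊢
      exact ⟨(Finset.erase_subset _ _).trans hΔ.1, hΔ.2.2⟩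
    · intro Γ hΓ
      simp only [Finset.mem_filter] at hΓ
      exact Finset.erase_insert (hP e Γ hΓ.2)
    · intro Δ hΔ
      simp only [Finset.mem_filter] at hΔ
      exact Finset.insert_erase hΔ.2.1
    · intro Γ hΓ
      simp only [Finset.mem_filter] at hΓ
      rw [Finset.prod_insert (hP e Γ hΓ.2)]
  rw [Finset.sum_congr rfl h1, Finset.sum_comm]
  refine Finset.sum_congr rfl fun Δ hΔ => ?_
  rw [← Finset.sum_filter, Finset.sum_const, nsmul_eq_mul, mul_comm]
  congr 3
  ext e
  simp only [Finset.mem_filter]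
  have := Finset.mem_powerset.mp hΔ
  constructor
  · rintro ⟨_, h⟩
    exact h
  · intro h
    exact ⟨this h.1, h⟩

/-- The pairs of a set and an added edge are bounded by the resulting sets, if each of these arises
in at most one way. -/
lemma sum_mul_wsum_le (hc : ∀ e, 0 < c e) (P : E → Finset E → Prop) (hP : ∀ e Γ, P e Γ → e ∉ Γ)
    (R : Finset E → Prop)
    (huniq : ∀ Δ : Finset E, ∀ e ∈ Δ, ∀ e' ∈ Δ, P e (Δ.erase e) → P e' (Δ.erase e') → e = e')
    (h : ∀ Δ : Finset E, ∀ e ∈ Δ, P e (Δ.erase e) → R Δ) :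
    ∑ e ∈ F, c e * wsum c F (P e) ≤ wsum c F R := by
  classical
  rw [sum_mul_wsum P hP, wsum_eq]
  refine Finset.sum_le_sum fun Δ _ => ?_
  have hw := prod_nonneg' hc Δ
  have hcard : (Δ.filter fun e => P e (Δ.erase e)).card ≤ 1 := by
    refine Finset.card_le_one.mpr fun e he e' he' => ?_
    rw [Finset.mem_filter] at he he'
    exact huniq Δ e he.1 e' he'.1 he.2 he'.2
  by_cases hR : R Δ
  · rw [if_pos hR]
    have : ((Δ.filter fun e => P e (Δ.erase e)).card : ℝ) ≤ 1 := by exact_mod_cast hcard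
    nlinarith
  · rw [if_neg hR, Finset.filter_eq_empty_iff.mpr fun e he hPe => hR (h Δ e he hPe)]
    simp

/-- The sets with property `R` are bounded by the pairs of a set and an added edge, if each of them
arises from such a pair. -/
lemma wsum_le_sum_mul (hc : ∀ e, 0 < c e) (P : E → Finset E → Prop) (hP : ∀ e Γ, P e Γ → e ∉ Γ)
    (R : Finset E → Prop) (h : ∀ Δ : Finset E, R Δ → ∃ e ∈ Δ, P e (Δ.erase e)) :
    wsum c F R ≤ ∑ e ∈ F, c e * wsum c F (P e) := by
  classical
  rw [sum_mul_wsum P hP, wsum_eq]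
  refine Finset.sum_le_sum fun Δ _ => ?_
  have hw := prod_nonneg' hc Δ
  by_cases hR : R Δ
  · rw [if_pos hR]
    obtain ⟨e, he, hPe⟩ := h Δ hR
    have h1 : 1 ≤ (Δ.filter fun e => P e (Δ.erase e)).card :=
      Finset.card_pos.mpr ⟨e, Finset.mem_filter.mpr ⟨he, hPe⟩⟩
    have : (1 : ℝ) ≤ ((Δ.filter fun e => P e (Δ.erase e)).card : ℝ) := by exact_mod_cast h1
    nlinarith
  · rw [if_neg hR]
    positivity

/-- The total weight of the groves in which `v` lies in the component of `x`. -/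
def hit (ends : E → Sym2 V) (c : E → ℝ) (F : Finset E) (I : Set V) (π : V → V → Prop) (x v : V) :
    ℝ :=
  wsum c F fun Γ => Good ends I π Γ ∧ Conn ends Γ v x

/-- The groves in which both ends of `e` lie in the component of `x` cancel in the difference. -/
lemma wsum_exits_sub_wsum_enters {x v w : V} {e : E} (he : ends e = s(v, w)) :
    wsum c F (Exits ends I π x v e) - wsum c F (Enters ends I π x v e) =
      hit ends c F I π x v - hit ends c F I π x w := by
  have h1 : hit ends c F I π x v = wsum c F (Exits ends I π x v e) +
      wsum c F (fun Γ => Good ends I π Γ ∧ Conn ends Γ v x ∧ Conn ends Γ w x) := by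
    refine wsum_add _ _ _ (fun Γ _ => ?_) ?_
    · constructor
      · rintro ⟨h, hv⟩
        by_cases hw : Conn ends Γ w x
        · exact Or.inr ⟨h, hv, hw⟩
        · exact Or.inl ⟨h, w, he, hv, hw⟩
      · rintro (⟨h, w', -, hv, -⟩ | ⟨h, hv, -⟩)
        · exact ⟨h, hv⟩
        · exact ⟨h, hv⟩
    · rintro Γ _ ⟨_, w', he', _, hw⟩ ⟨_, _, hw'⟩
      rw [he, Sym2.congr_right] at he'
      exact hw (he' ▸ hw')
  have h2 : hit ends c F I π x w = wsum c F (Enters ends I π x v e) +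
      wsum c F (fun Γ => Good ends I π Γ ∧ Conn ends Γ v x ∧ Conn ends Γ w x) := by
    refine wsum_add _ _ _ (fun Γ _ => ?_) ?_
    · constructor
      · rintro ⟨h, hw⟩
        by_cases hv : Conn ends Γ v x
        · exact Or.inr ⟨h, hv, hw⟩
        · exact Or.inl ⟨h, w, he, hv, hw⟩
      · rintro (⟨h, w', he', -, hw⟩ | ⟨h, -, hw⟩)
        · rw [he, Sym2.congr_right] at he'
          exact ⟨h, he' ▸ hw⟩
        · exact ⟨h, hw⟩
    · rintro Γ _ ⟨_, w', he', hv, _⟩ ⟨_, hv', _⟩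
      exact hv hv'
  rw [h1, h2]
  ring

lemma wsum_exits_of_notMem {x v : V} {e : E} (he : v ∉ ends e) :
    wsum c F (Exits ends I π x v e) = 0 := by
  classical
  rw [wsum_eq]
  refine Finset.sum_eq_zero fun Γ _ => if_neg ?_
  rintro ⟨_, w, hw, _⟩
  exact he (hw ▸ Sym2.mem_mk_left _ _)

lemma wsum_enters_of_notMem {x v : V} {e : E} (he : v ∉ ends e) :
    wsum c F (Enters ends I π x v e) = 0 := by
  classical
  rw [wsum_eq]
  refine Finset.sum_eq_zero fun Γ _ => if_neg ?_
  rintro ⟨_, w, hw, _⟩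
  exact he (hw ▸ Sym2.mem_mk_left _ _)

lemma wsum_enters_self {x : V} {e : E} : wsum c F (Enters ends I π x x e) = 0 := by
  classical
  rw [wsum_eq]
  refine Finset.sum_eq_zero fun Γ _ => if_neg ?_
  rintro ⟨_, w, _, h, _⟩
  exact h (Conn.refl _)

variable [DecidableEq V]

/-- In a random grove, the probability that `v` lies in the component of `x` is at most what it is
when all boundary vertices are singletons. -/
lemma hit_mul_le (hc : ∀ e, 0 < c e) {x : V} (hI : I.Finite) (hx : x ∉ I)
    (hπ : ∀ b, π b x ↔ b = x) (hconn : ∀ v ∈ I, ∃ b, b ∉ I ∧ Conn ends F v b) (v : V) :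
    hit ends c F I π x v * wsum c F (Good ends I Eq) ≤
      hit ends c F I Eq x v * wsum c F (Good ends I π) := by
  set Zπ := wsum c F (Good ends I π)
  set Z := wsum c F (Good ends I Eq)
  have h0 : 0 ≤ Zπ := wsum_nonneg hc _
  have h0' : 0 ≤ Z := wsum_nonneg hc _
  have hout : ∀ (ρ : V → V → Prop), (∀ b, ρ b x ↔ b = x) → ∀ b, b ∉ I → b ≠ x →
      hit ends c F I ρ x b = 0 := by
    intro ρ hρ b hb hbx
    classical
    rw [hit, wsum_eq]
    refine Finset.sum_eq_zero fun Γ _ => if_neg ?_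
    rintro ⟨hg, h⟩
    exact hbx ((hρ b).mp ((hg.type b x hb hx).mp h))
  have hself : ∀ (ρ : V → V → Prop), hit ends c F I ρ x x = wsum c F (Good ends I ρ) := by
    intro ρ
    exact wsum_congr fun Γ _ => ⟨fun h => h.1, fun h => ⟨h, Conn.refl _⟩⟩
  have key := max_principle hc hI
    (fun v => hit ends c F I π x v * Z - hit ends c F I Eq x v * Zπ) (F := F) (ends := ends) ?_
    (fun v e => (wsum c F (Exits ends I π x v e) - wsum c F (Enters ends I π x v e)) * Z -
      (wsum c F (Exits ends I Eq x v e) - wsum c F (Enters ends I Eq x v e)) * Zπ) ?_ ?_ ?_ hconn v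
  · linarith
  · intro b hb
    by_cases hbx : b = x
    · subst hbx
      simp only [hself]
      exact (sub_eq_zero.mpr (mul_comm _ _)).le
    · simp only [hout π hπ b hb hbx, hout Eq (fun _ => Iff.rfl) b hb hbx]
      simp
  · intro v e w he
    simp only [wsum_exits_sub_wsum_enters he]
    ring
  · intro v e he
    simp only [wsum_exits_of_notMem he, wsum_enters_of_notMem he]
    simp
  · intro v hv
    -- `hit` is subharmonic at `v` for `π`: every pair which exits can be exchanged for one which
    -- enters.
    have h1 : ∑ e ∈ F, c e * wsum c F (Exits ends I π x v e) ≤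
        ∑ e ∈ F, c e * wsum c F (Enters ends I π x v e) :=
      (sum_mul_wsum_le hc _ (fun _ _ h => h.notMem)
        (fun Δ => ∃ e ∈ Δ, Enters ends I π x v e (Δ.erase e))
        (fun Δ e he e' _ h h' => h.unique hx hπ he h')
        (fun Δ e he h => h.exists_enters hx hπ hv he)).trans
      (wsum_le_sum_mul hc _ (fun _ _ h => h.notMem) _ fun Δ h => h)
    -- It is superharmonic at `v` for the partition into singletons.
    have h2 : ∑ e ∈ F, c e * wsum c F (Enters ends I Eq x v e) ≤
        ∑ e ∈ F, c e * wsum c F (Exits ends I Eq x v e) :=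
      (sum_mul_wsum_le hc _ (fun _ _ h => h.notMem)
        (fun Δ => ∃ e ∈ Δ, Exits ends I Eq x v e (Δ.erase e))
        (fun Δ e he e' _ h h' => h.unique he h')
        (fun Δ e he h => h.exists_exits hx hv he)).trans
      (wsum_le_sum_mul hc _ (fun _ _ h => h.notMem) _ fun Δ h => h)
    have h3 : ∀ A B A' B' : E → ℝ, ∑ e ∈ F, c e * ((A e - B e) * Z - (A' e - B' e) * Zπ) =
        (∑ e ∈ F, c e * A e - ∑ e ∈ F, c e * B e) * Z -
          (∑ e ∈ F, c e * A' e - ∑ e ∈ F, c e * B' e) * Zπ := by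
      intro A B A' B'
      simp only [← Finset.sum_sub_distrib, Finset.sum_mul]
      exact Finset.sum_congr rfl fun e _ => by ring
    rw [h3]
    nlinarith [mul_nonneg (sub_nonneg.mpr h1) h0', mul_nonneg (sub_nonneg.mpr h2) h0]

/-- Making a singleton boundary vertex interior does not decrease the normalized weight of a
boundary partition. -/
lemma wsum_mul_le_insert (hc : ∀ e, 0 < c e) {x : V} (hI : I.Finite) (hx : x ∉ I)
    (hπ : ∀ b, π b x ↔ b = x) (hπ' : ∀ b, π x b ↔ b = x) :
    wsum c F (Good ends I π) * wsum c F (Good ends (insert x I) Eq) ≤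
      wsum c F (Good ends (insert x I) π) * wsum c F (Good ends I Eq) := by
  by_cases hex : ∃ Γ ⊆ F, Good ends I π Γ
  swap
  · have : wsum c F (Good ends I π) = 0 := by
      classical
      rw [wsum_eq]
      refine Finset.sum_eq_zero fun Γ hΓ => if_neg fun h => hex ⟨Γ, ?_, h⟩
      exact Finset.mem_powerset.mp hΓ
    rw [this, zero_mul]
    exact mul_nonneg (wsum_nonneg hc _) (wsum_nonneg hc _)
  have hconn : ∀ v ∈ I, ∃ b, b ∉ I ∧ Conn ends F v b := by
    obtain ⟨Γ, hΓ, hg⟩ := hex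
    intro v hv
    obtain ⟨b, hb, h⟩ := hg.grounded v hv
    exact ⟨b, hb, h.mono hΓ⟩
  have hself : ∀ (ρ : V → V → Prop), hit ends c F I ρ x x = wsum c F (Good ends I ρ) := by
    intro ρ
    exact wsum_congr fun Γ _ => ⟨fun h => h.1, fun h => ⟨h, Conn.refl _⟩⟩
  set Zπ := wsum c F (Good ends I π)
  set Z := wsum c F (Good ends I Eq)
  have h0 : 0 ≤ Zπ := wsum_nonneg hc _
  have h0' : 0 ≤ Z := wsum_nonneg hc _
  -- After `x` has become interior, the weights are compared with those of the pairs of a grove and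
  -- an edge from `x` to another component.
  have h1 : ∑ e ∈ F, c e * wsum c F (Exits ends I π x x e) ≤
      wsum c F (Good ends (insert x I) π) :=
    sum_mul_wsum_le hc _ (fun _ _ h => h.notMem) _
      (fun Δ e he e' _ h h' => h.unique hx hπ he h')
      (fun Δ e he h => h.good_insert hx hπ hπ' he)
  have h2 : wsum c F (Good ends (insert x I) Eq) ≤
      ∑ e ∈ F, c e * wsum c F (Exits ends I Eq x x e) :=
    wsum_le_sum_mul hc _ (fun _ _ h => h.notMem) _ (fun Δ h => h.exists_exits hx)
  have h3 : (∑ e ∈ F, c e * wsum c F (Exits ends I Eq x x e)) * Zπ ≤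
      (∑ e ∈ F, c e * wsum c F (Exits ends I π x x e)) * Z := by
    rw [Finset.sum_mul, Finset.sum_mul]
    refine Finset.sum_le_sum fun e _ => ?_
    by_cases he : x ∈ ends e
    · obtain ⟨w, hw⟩ := he
      have e1 := wsum_exits_sub_wsum_enters (c := c) (F := F) (I := I) (π := π) (x := x) hw
      have e2 := wsum_exits_sub_wsum_enters (c := c) (F := F) (I := I) (π := Eq) (x := x) hw
      rw [wsum_enters_self, sub_zero, hself] at e1 e2
      rw [e1, e2]
      have := hit_mul_le hc hI hx hπ hconn w
      rw [mul_assoc, mul_assoc]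
      refine mul_le_mul_of_nonneg_left ?_ (hc e).le
      change (Z - _) * Zπ ≤ (Zπ - _) * Z
      change _ * Z ≤ _ * Zπ at this
      linarith [mul_comm Z Zπ]
    · rw [wsum_exits_of_notMem he, wsum_exits_of_notMem he]
      simp
  calc _ ≤ Zπ * ∑ e ∈ F, c e * wsum c F (Exits ends I Eq x x e) :=
        mul_le_mul_of_nonneg_left h2 h0
    _ ≤ (∑ e ∈ F, c e * wsum c F (Exits ends I π x x e)) * Z := by rw [mul_comm]; exact h3
    _ ≤ _ := mul_le_mul_of_nonneg_right h1 h0'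

end EdgeSet

namespace EdgeSet

variable {V E : Type} {ends : E → Sym2 V} {I : Set V} {π : V → V → Prop} {F F' : Finset E}
  {c : E → ℝ}

lemma wsum_eq_zero {P : Finset E → Prop} (h : ∀ Γ ⊆ F, ¬ P Γ) : wsum c F P = 0 := by
  classical
  rw [wsum_eq]
  exact Finset.sum_eq_zero fun Γ hΓ => if_neg (h Γ (Finset.mem_powerset.mp hΓ))

lemma exists_of_wsum_pos {P : Finset E → Prop} (h : 0 < wsum c F P) : ∃ Γ ⊆ F, P Γ := by
  by_contra! h'
  exact h.ne' (wsum_eq_zero h')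

variable [DecidableEq E]

/-- Edges without interior ends cannot be used by a grove which separates all boundary vertices. -/
lemma Good.subset_of_eq (hF : ∀ e ∈ F', e ∉ F → ∀ v ∈ ends e, v ∉ I) {Γ : Finset E} (hΓ : Γ ⊆ F')
    (h : Good ends I Eq Γ) : Γ ⊆ F := by
  intro e he
  by_contra heF
  obtain ⟨⟨a, b⟩, hab⟩ : ∃ z : V × V, ends e = s(z.1, z.2) := by
    induction h : ends e with
    | _ a b => exact ⟨(a, b), rfl⟩
  have ha : a ∉ I := hF e (hΓ he) heF a (by rw [hab]; exact Sym2.mem_mk_left _ _)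
  have hb : b ∉ I := hF e (hΓ he) heF b (by rw [hab]; exact Sym2.mem_mk_right _ _)
  exact h.forest.ne he hab ((h.type a b ha hb).mp (Conn.of_mem he hab))

/-- The normalized weight of a boundary partition. -/
def ratio (ends : E → Sym2 V) (c : E → ℝ) (F : Finset E) (I : Set V) (π : V → V → Prop) : ℝ :=
  wsum c F (Good ends I π) / wsum c F (Good ends I Eq)

/-- New edges between boundary vertices do not affect the groves which separate all boundary
vertices. -/
lemma ratio_mono_edges (hc : ∀ e, 0 < c e) (hF : F ⊆ F')
    (hF' : ∀ e ∈ F', e ∉ F → ∀ v ∈ ends e, v ∉ I) :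
    ratio ends c F I π ≤ ratio ends c F' I π := by
  have h1 : wsum c F' (Good ends I Eq) = wsum c F (Good ends I Eq) := by
    refine le_antisymm ?_ (wsum_mono hc hF fun _ _ h => h)
    refine Finset.sum_le_sum_of_subset_of_nonneg (fun Γ hΓ => ?_) fun Γ _ _ => prod_nonneg' hc Γ
    simp only [Finset.mem_filter, Finset.mem_powerset] at hΓ ⊢
    exact ⟨hΓ.2.subset_of_eq hF' hΓ.1, hΓ.2⟩
  rw [ratio, ratio, h1]
  exact div_le_div_of_nonneg_right (wsum_mono hc hF fun _ _ h => h) (wsum_nonneg hc _)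

/-- Making singleton boundary vertices interior does not decrease the normalized weight. -/
lemma ratio_mono_vertices [DecidableEq V] (hc : ∀ e, 0 < c e) (hI : I.Finite) (J : Finset V)
    (hJ : ∀ x ∈ J, x ∉ I) (hπ : ∀ x ∈ J, ∀ b, π b x ↔ b = x) (hπ' : ∀ x ∈ J, ∀ b, π x b ↔ b = x)
    (hpos : 0 < wsum c F (Good ends (↑J ∪ I) Eq)) :
    0 < wsum c F (Good ends I Eq) ∧ ratio ends c F I π ≤ ratio ends c F (↑J ∪ I) π := by
  induction J using Finset.induction_on with
  | empty => simpa using hpos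
  | insert x J hx ih =>
    have hins : (↑(insert x J) ∪ I : Set V) = insert x (↑J ∪ I) := by
      rw [Finset.coe_insert, Set.insert_union]
    rw [hins] at hpos ⊢
    have hxI : x ∉ (↑J ∪ I : Set V) := by
      rintro (h | h)
      · exact hx h
      · exact hJ x (Finset.mem_insert_self _ _) h
    obtain ⟨Γ, hΓ, hg⟩ := exists_of_wsum_pos hpos
    obtain ⟨e, he, hg', -⟩ := hg.exists_exits hxI
    have hpos' : 0 < wsum c F (Good ends (↑J ∪ I) Eq) :=
      wsum_pos hc ((Finset.erase_subset _ _).trans hΓ) hg'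
    obtain ⟨h1, h2⟩ := ih (fun y hy => hJ y (Finset.mem_insert_of_mem hy))
      (fun y hy => hπ y (Finset.mem_insert_of_mem hy))
      (fun y hy => hπ' y (Finset.mem_insert_of_mem hy)) hpos'
    refine ⟨h1, h2.trans ?_⟩
    rw [ratio, ratio, div_le_div_iff₀ hpos' hpos]
    exact wsum_mul_le_insert hc (J.finite_toSet.union hI) hxI
      (hπ x (Finset.mem_insert_self _ _)) (hπ' x (Finset.mem_insert_self _ _))

/-! ### Boundedness of normalized grove counts -/

/-- A spanning forest without isolated interior components, in which two connected boundary vertices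
are equal unless one of them lies in `B`. -/
structure Sparse (ends : E → Sym2 V) (I : Set V) (B : Set V) (Γ : Finset E) : Prop where
  forest : Forest ends Γ
  grounded : ∀ v ∈ I, ∃ b, b ∉ I ∧ Conn ends Γ v b
  type : ∀ b c, b ∉ I → c ∉ I → Conn ends Γ b c → b = c ∨ b ∈ B ∨ c ∈ B

/-- If `b` is joined to a boundary vertex outside `B`, the first edge on the path to it can be
removed. -/
lemma Sparse.exists_erase [DecidableEq V] {B : Set V} {b : V} {Δ : Finset E} (hb : b ∉ I)
    (h : Sparse ends I (insert b B) Δ) (h' : ¬ Sparse ends I B Δ) :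
    ∃ e ∈ Δ, b ∈ ends e ∧ e ∉ Δ.erase e ∧ Sparse ends I B (Δ.erase e) := by
  obtain ⟨q, hq, hqb, hqB, hbq⟩ : ∃ q, q ∉ I ∧ q ≠ b ∧ q ∉ B ∧ Conn ends Δ b q := by
    by_contra! hcon
    refine h' ⟨h.forest, h.grounded, fun p q hp hq hpq => ?_⟩
    by_contra! hne
    rcases h.type p q hp hq hpq with h1 | (rfl | h1) | (rfl | h1)
    · exact hne.1 h1
    · exact hcon q hq (Ne.symm hne.1) hne.2.2 hpq
    · exact hne.2.1 h1
    · exact hcon p hp hne.1 hne.2.1 hpq.symm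
    · exact hne.2.2 h1
  obtain ⟨e, he, w, hw, hwq⟩ := hbq.exists_first_erase (Ne.symm hqb)
  have hs : Δ.erase e ⊆ Δ := Finset.erase_subset _ _
  have hbw := h.forest.not_conn he hw
  have key : ∀ p, p ∉ I → p ≠ b → p ∉ B → ¬ Conn ends (Δ.erase e) b p := by
    intro p hp hpb hpB hbp
    have : p = q := by
      rcases h.type p q hp hq ((hbp.mono hs).symm.trans hbq) with h1 | (h1 | h1) | (h1 | h1)
      · exact h1
      · exact absurd h1 hpb
      · exact absurd h1 hpB
      · exact absurd h1 hqb
      · exact absurd h1 hqB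
    exact hbw ((this ▸ hbp).trans hwq.symm)
  refine ⟨e, he, by rw [hw]; exact Sym2.mem_mk_left _ _, Finset.notMem_erase _ _,
    h.forest.mono hs, ?_, ?_⟩
  · intro y hy
    obtain ⟨d, hd, hyd⟩ := h.grounded y hy
    rw [conn_erase hw he] at hyd
    rcases hyd with hyd | ⟨hyb, -⟩ | ⟨hyw, -⟩
    · exact ⟨d, hd, hyd⟩
    · exact ⟨b, hb, hyb⟩
    · exact ⟨q, hq, hyw.trans hwq⟩
  · intro p r hp hr hpr
    by_contra! hne
    rcases h.type p r hp hr (hpr.mono hs) with h1 | (rfl | h1) | (rfl | h1)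
    · exact hne.1 h1
    · exact key r hr (Ne.symm hne.1) hne.2.2 hpr
    · exact hne.2.1 h1
    · exact key p hp hne.1 hne.2.1 hpr.symm
    · exact hne.2.2 h1

/-- The weight of the forests in which only the vertices of `B` are joined to other boundary
vertices is bounded in terms of the conductances at `B` alone: one vertex of `B` after the other is
separated by removing an edge at it. -/
lemma wsum_sparse_le [DecidableEq V] (hc : ∀ e, 0 < c e) {M : ℝ} (B : Finset V)
    (hB : ∀ b ∈ B, b ∉ I) (hM : ∀ b ∈ B, ∑ e ∈ F with b ∈ ends e, c e ≤ M) :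
    wsum c F (Sparse ends I ↑B) ≤ (1 + M) ^ B.card * wsum c F (Good ends I Eq) := by
  induction B using Finset.induction_on with
  | empty =>
    rw [Finset.card_empty, pow_zero, one_mul]
    refine wsum_mono hc subset_rfl fun Γ _ h => ⟨h.forest, h.grounded, fun b d hb hd => ?_⟩
    refine ⟨fun hbd => ?_, fun hbd => hbd ▸ Conn.refl _⟩
    simpa using h.type b d hb hd hbd
  | insert b B hb ih =>
    have ih' := ih (fun y hy => hB y (Finset.mem_insert_of_mem hy))
      (fun y hy => hM y (Finset.mem_insert_of_mem hy))
    have hbI := hB b (Finset.mem_insert_self _ _)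
    have hMb := hM b (Finset.mem_insert_self _ _)
    have hM0 : 0 ≤ M := (Finset.sum_nonneg fun e _ => (hc e).le).trans hMb
    have hZ := wsum_nonneg (F := F) hc (Sparse ends I (B : Set V))
    have h1 : wsum c F (fun Γ => Sparse ends I (insert b (B : Set V)) Γ ∧ ¬ Sparse ends I ↑B Γ) ≤
        M * wsum c F (Sparse ends I ↑B) := by
      refine (wsum_le_sum_mul hc (fun e Γ => b ∈ ends e ∧ e ∉ Γ ∧ Sparse ends I ↑B Γ)
        (fun e Γ h => h.2.1) _ fun Δ h => h.1.exists_erase hbI h.2).trans ?_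
      refine le_trans ?_ (mul_le_mul_of_nonneg_right hMb hZ)
      rw [Finset.sum_mul, Finset.sum_filter]
      refine Finset.sum_le_sum fun e _ => ?_
      by_cases he : b ∈ ends e
      · rw [if_pos he]
        exact mul_le_mul_of_nonneg_left (wsum_mono hc subset_rfl fun _ _ h => h.2.2) (hc e).le
      · rw [if_neg he, wsum_eq_zero (fun _ _ h => he h.1), mul_zero]
    have h2 : wsum c F (Sparse ends I (insert b (B : Set V))) ≤
        wsum c F (Sparse ends I ↑B) +
        wsum c F (fun Γ => Sparse ends I (insert b (B : Set V)) Γ ∧ ¬ Sparse ends I ↑B Γ) := by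
      rw [wsum_add (Sparse ends I (insert b (B : Set V)))
        (fun Γ => Sparse ends I (insert b (B : Set V)) Γ ∧ Sparse ends I ↑B Γ)
        (fun Γ => Sparse ends I (insert b (B : Set V)) Γ ∧ ¬ Sparse ends I ↑B Γ)
        (fun Γ _ => by tauto) (fun Γ _ => by tauto)]
      gcongr
      exact wsum_mono hc subset_rfl fun _ _ h => h.2
    rw [Finset.coe_insert, Finset.card_insert_of_notMem hb, pow_succ]
    calc _ ≤ (1 + M) * wsum c F (Sparse ends I ↑B) := by linarith
      _ ≤ (1 + M) * ((1 + M) ^ B.card * wsum c F (Good ends I Eq)) :=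
        mul_le_mul_of_nonneg_left ih' (by linarith)
      _ = _ := by ring

end EdgeSet

/-! ### Groves in truncations as edge sets of the ambient network -/

namespace ElectricalNetwork

open EdgeSet

variable {V E : Type} (H : ElectricalNetwork V E)

lemma reachable_iff_conn (Γ : Finset E) (u v : V) :
    (H.subgraph Γ).Reachable u v ↔ Conn H.ends Γ u v := by
  rw [SimpleGraph.reachable_iff_reflTransGen]
  constructor
  · intro h
    induction h with
    | refl => exact Conn.refl _
    | tail _ h ih =>
      obtain ⟨⟨e, he, h⟩, -⟩ := (SimpleGraph.fromEdgeSet_adj _).mp h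
      exact ih.tail ⟨e, he, h⟩
  · intro h
    induction h with
    | refl => exact Relation.ReflTransGen.refl
    | @tail y z _ h ih =>
      by_cases hyz : y = z
      · exact hyz ▸ ih
      · exact ih.tail ((SimpleGraph.fromEdgeSet_adj _).mpr ⟨h, hyz⟩)

lemma isForest_iff [DecidableEq E] (Γ : Finset E) : H.IsForest Γ ↔ Forest H.ends Γ := by
  constructor
  · rintro ⟨h1, h2, h3⟩ e he a b hab hc
    have hne : a ≠ b := by
      rintro rfl
      exact h1 e he (by rw [hab]; exact rfl)
    have hadj : (H.subgraph Γ).Adj a b := (SimpleGraph.fromEdgeSet_adj _).mpr ⟨⟨e, he, hab⟩, hne⟩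
    have hb := SimpleGraph.isBridge_iff.mp
      (SimpleGraph.isAcyclic_iff_forall_adj_isBridge.mp h3 hadj)
    apply hb
    rw [SimpleGraph.reachable_iff_reflTransGen]
    clear hb hadj hne
    generalize s(a, b) = z at hab ⊢
    induction hc with
    | refl => exact Relation.ReflTransGen.refl
    | @tail y z _ h ih =>
      by_cases hyz : y = z
      · exact hyz ▸ ih
      · refine ih.tail ?_
        obtain ⟨e', he', h⟩ := h
        rw [Finset.mem_erase] at he'
        rw [SimpleGraph.deleteEdges_adj]
        refine ⟨(SimpleGraph.fromEdgeSet_adj _).mpr ⟨⟨e', he'.2, h⟩, hyz⟩, fun hs => he'.1 ?_⟩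
        exact h2 e' he'.2 e he (h.trans (hs.trans hab.symm))
  · intro h
    refine ⟨?_, ?_, ?_⟩
    · intro e he hd
      induction hab : H.ends e with
      | _ a b =>
        rw [hab] at hd
        exact h.ne he hab hd
    · intro e he f hf hef
      by_contra hne
      induction hab : H.ends e with
      | _ a b =>
        exact h e he a b hab (Conn.of_mem (Finset.mem_erase.mpr ⟨Ne.symm hne, hf⟩) (hef ▸ hab))
    · refine SimpleGraph.isAcyclic_iff_forall_adj_isBridge.mpr fun v w hvw => ?_
      obtain ⟨⟨e, he, hvw⟩, -⟩ := (SimpleGraph.fromEdgeSet_adj _).mp hvw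
      rw [SimpleGraph.isBridge_iff, SimpleGraph.reachable_iff_reflTransGen]
      intro hr
      refine h e he v w hvw ?_
      refine Relation.ReflTransGen.mono ?_ _ _ hr
      intro c d hcd
      rw [SimpleGraph.deleteEdges_adj] at hcd
      obtain ⟨⟨e', he', h'⟩, -⟩ := (SimpleGraph.fromEdgeSet_adj _).mp hcd.1
      refine ⟨e', Finset.mem_erase.mpr ⟨fun hee => hcd.2 ?_, he'⟩, h'⟩
      rw [Set.mem_singleton_iff, ← h', hee, hvw]

variable (S : Finset V)

lemma truncation_ends_iff (e : H.TruncEdge S) (u v : H.TruncVertex S) :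
    (H.truncation S).ends e = s(u, v) ↔ H.ends e.1 = s(u.1, v.1) := by
  rw [← (Sym2.map.injective Subtype.val_injective).eq_iff]
  simp [truncation]

/-- A vertex of the truncation. -/
def IsTruncVertex (v : V) : Prop := ∃ e, H.Meets S e ∧ v ∈ H.ends e

/-- The interior vertices of the truncation to `S`. -/
def truncInterior : Set V := {v | v ∈ S ∧ v ∉ H.boundary}

variable {H S}

/-- A set of edges of a truncation, as a set of edges of the ambient network. -/
def liftEdges (Γ : Finset (H.TruncEdge S)) : Finset E := Γ.map (Function.Embedding.subtype _)

lemma mem_liftEdges {Γ : Finset (H.TruncEdge S)} {e : E} :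
    e ∈ liftEdges Γ ↔ ∃ h : H.Meets S e, ⟨e, h⟩ ∈ Γ := by
  simp [liftEdges]

/-- A vertex outside the truncation is isolated. -/
lemma conn_liftEdges_isTruncVertex {Γ : Finset (H.TruncEdge S)} {u v : V}
    (h : Conn H.ends (liftEdges Γ) u v) : u = v ∨ (H.IsTruncVertex S u ∧ H.IsTruncVertex S v) := by
  induction h with
  | refl => exact Or.inl rfl
  | @tail y z _ h ih =>
    obtain ⟨e, he, h⟩ := h
    obtain ⟨hm, -⟩ := mem_liftEdges.mp he
    have hy : H.IsTruncVertex S y := ⟨e, hm, by rw [h]; exact Sym2.mem_mk_left _ _⟩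
    have hz : H.IsTruncVertex S z := ⟨e, hm, by rw [h]; exact Sym2.mem_mk_right _ _⟩
    rcases ih with rfl | ih
    · exact Or.inr ⟨hy, hz⟩
    · exact Or.inr ⟨ih.1, hz⟩

lemma conn_liftEdges (Γ : Finset (H.TruncEdge S)) (u v : H.TruncVertex S) :
    Conn (H.truncation S).ends Γ u v ↔ Conn H.ends (liftEdges Γ) u.1 v.1 := by
  constructor
  · intro h
    induction h with
    | refl => exact Conn.refl _
    | tail _ h ih =>
      obtain ⟨e, he, h⟩ := h
      exact ih.tail ⟨e.1, mem_liftEdges.mpr ⟨e.2, he⟩, (truncation_ends_iff _ _ _ _ _).mp h⟩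
  · obtain ⟨v, hv⟩ := v
    intro h
    dsimp only at h
    induction h with
    | refl => exact Conn.refl _
    | @tail y z _ h ih =>
      obtain ⟨e, he, h⟩ := h
      obtain ⟨hm, he⟩ := mem_liftEdges.mp he
      have hy : H.IsTruncVertex S y := ⟨e, hm, by rw [h]; exact Sym2.mem_mk_left _ _⟩
      exact (ih hy).tail ⟨⟨e, hm⟩, he, (truncation_ends_iff _ _ _ _ _).mpr h⟩

section

variable [Fintype (H.TruncEdge S)]

variable (H S) in
/-- The edges of the truncation, as edges of the ambient network. -/
def truncEdges : Finset E := liftEdges (Finset.univ : Finset (H.TruncEdge S))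

lemma mem_truncEdges {e : E} : e ∈ H.truncEdges S ↔ H.Meets S e := by
  simp [truncEdges, mem_liftEdges]

open Classical in
lemma sum_liftEdges (P : Finset E → Prop) :
    ∑ Γ : Finset (H.TruncEdge S) with P (liftEdges Γ), (H.truncation S).weight Γ =
      wsum H.conductance (H.truncEdges S) P := by
  rw [wsum]
  refine Finset.sum_nbij liftEdges ?_ ?_ ?_ ?_
  · intro Γ hΓ
    simp only [Finset.mem_filter, Finset.mem_univ, true_and, Finset.mem_powerset] at hΓ ⊢
    exact ⟨Finset.map_subset_map.mpr (Finset.subset_univ _), hΓ⟩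
  · exact (Finset.map_injective _).injOn
  · intro Δ hΔ
    simp only [Finset.coe_filter, Finset.mem_powerset, Set.mem_ofPred_eq] at hΔ
    obtain ⟨Γ, -, rfl⟩ := Finset.subset_map_iff.mp hΔ.1
    exact ⟨Γ, by rw [Finset.coe_filter]; exact ⟨Finset.mem_univ _, hΔ.2⟩, rfl⟩
  · intro Γ _
    rw [weight, liftEdges, Finset.prod_map]
    rfl

end

variable [DecidableEq E]

lemma forest_liftEdges (Γ : Finset (H.TruncEdge S)) :
    Forest (H.truncation S).ends Γ ↔ Forest H.ends (liftEdges Γ) := by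
  have herase : ∀ (e : E) (he : H.Meets S e),
      liftEdges (Γ.erase ⟨e, he⟩) = (liftEdges Γ).erase e := fun e he => by
    ext e'
    simp only [mem_liftEdges, Finset.mem_erase, ne_eq, Subtype.mk.injEq]
    tauto
  constructor
  · intro h e he a b hab
    obtain ⟨hm, he⟩ := mem_liftEdges.mp he
    have ha : H.IsTruncVertex S a := ⟨e, hm, by rw [hab]; exact Sym2.mem_mk_left _ _⟩
    have hb : H.IsTruncVertex S b := ⟨e, hm, by rw [hab]; exact Sym2.mem_mk_right _ _⟩
    have := h ⟨e, hm⟩ he ⟨a, ha⟩ ⟨b, hb⟩ ((truncation_ends_iff _ _ _ _ _).mpr hab)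
    rwa [conn_liftEdges, herase] at this
  · rintro h ⟨e, hm⟩ he a b hab
    rw [conn_liftEdges, herase]
    exact h e (mem_liftEdges.mpr ⟨hm, he⟩) _ _ ((truncation_ends_iff _ _ _ _ _).mp hab)

lemma isGrove_truncation_iff (hS : ∀ v ∈ H.truncInterior S, H.IsTruncVertex S v) (π : Setoid V)
    (hπ : ∀ b c, π b c → b = c ∨ (H.IsTruncVertex S b ∧ H.IsTruncVertex S c))
    (Γ : Finset (H.TruncEdge S)) :
    ((H.truncation S).IsGrove Γ ∧
      (H.truncation S).HasBoundaryPartition Γ (H.truncPartition S π)) ↔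
      Good H.ends (H.truncInterior S) π (liftEdges Γ) := by
  have hbd : ∀ v : H.TruncVertex S, v ∈ (H.truncation S).boundary ↔ v.1 ∉ H.truncInterior S :=
    fun v => Iff.rfl
  simp only [IsGrove, HasBoundaryPartition, isForest_iff, reachable_iff_conn, conn_liftEdges,
    forest_liftEdges]
  constructor
  · rintro ⟨⟨h1, h2⟩, h3⟩
    refine ⟨h1, ?_, ?_⟩
    · intro v hv
      obtain ⟨b, hb, h⟩ := h2 ⟨v, hS v hv⟩
      exact ⟨b.1, (hbd b).mp hb, h⟩
    · intro b c hb hc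
      by_cases hbc : b = c
      · subst hbc
        exact ⟨fun _ => π.refl _, fun _ => Conn.refl _⟩
      constructor
      · intro h
        rcases conn_liftEdges_isTruncVertex h with rfl | ⟨hb', hc'⟩
        · exact π.refl _
        · exact (h3 ⟨⟨b, hb'⟩, (hbd _).mpr hb⟩ ⟨⟨c, hc'⟩, (hbd _).mpr hc⟩).mp h
      · intro h
        rcases hπ b c h with rfl | ⟨hb', hc'⟩
        · exact Conn.refl _
        · exact (h3 ⟨⟨b, hb'⟩, (hbd _).mpr hb⟩ ⟨⟨c, hc'⟩, (hbd _).mpr hc⟩).mpr h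
  · intro h
    refine ⟨⟨h.forest, fun v => ?_⟩, fun b c => ?_⟩
    · by_cases hv : v.1 ∈ H.truncInterior S
      · obtain ⟨b, hb, hc⟩ := h.grounded v.1 hv
        rcases conn_liftEdges_isTruncVertex hc with hvb | ⟨-, hb'⟩
        · exact absurd (hvb ▸ hv) hb
        · exact ⟨⟨b, hb'⟩, (hbd _).mpr hb, hc⟩
      · exact ⟨v, (hbd _).mpr hv, Conn.refl _⟩
    · exact h.type _ _ ((hbd _).mp b.2) ((hbd _).mp c.2)

variable [Fintype (H.TruncEdge S)]

/-- The normalized partition function of a truncation is a ratio of weights of edge sets in the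
ambient network; vertices outside the truncation count as isolated boundary vertices there, so the
nontrivial parts of `π` have to lie in the truncation. -/
lemma uPr_truncation (hc : ∀ e, 0 < H.conductance e)
    (hS : ∀ v ∈ H.truncInterior S, H.IsTruncVertex S v) (π : Setoid V)
    (hπ : ∀ b c, π b c → b = c ∨ (H.IsTruncVertex S b ∧ H.IsTruncVertex S c)) :
    (H.truncation S).uPr (H.truncPartition S π) =
      ratio H.ends H.conductance (H.truncEdges S) (H.truncInterior S) π := by
  classical
  have key : ∀ π : Setoid V,
      (∀ b c, π b c → b = c ∨ (H.IsTruncVertex S b ∧ H.IsTruncVertex S c)) →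
      ∑ Γ : Finset (H.TruncEdge S) with (H.truncation S).IsGrove Γ ∧
        (H.truncation S).HasBoundaryPartition Γ (H.truncPartition S π), (H.truncation S).weight Γ =
      wsum H.conductance (H.truncEdges S) (Good H.ends (H.truncInterior S) π) := by
    intro π hπ
    rw [← sum_liftEdges]
    refine Finset.sum_congr ?_ fun _ _ => rfl
    ext Γ
    simp only [Finset.mem_filter, Finset.mem_univ, true_and]
    exact isGrove_truncation_iff hS π hπ Γ
  have hbot : (⊥ : Setoid (H.truncation S).boundary) = H.truncPartition S ⊥ := by
    ext b c
    change b = c ↔ b.1.1 = c.1.1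
    rw [← Subtype.ext_iff, ← Subtype.ext_iff]
  have hw : ∀ Γ : Finset (H.TruncEdge S), 0 ≤ (H.truncation S).weight Γ := fun Γ =>
    Finset.prod_nonneg fun e _ => (hc e.1).le
  have key0 := key ⊥ (fun b c h => Or.inl h)
  rw [uPr, hbot, grovePr, grovePr, key π hπ, key0, ratio]
  set T := ∑ Γ : Finset (H.TruncEdge S) with (H.truncation S).IsGrove Γ, (H.truncation S).weight Γ
    with hT
  -- If there are no groves at all, both sides are `0` by the convention on division by `0`.
  by_cases hT0 : T = 0
  · have : wsum H.conductance (H.truncEdges S) (Good H.ends (H.truncInterior S) (⊥ : Setoid V))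
        = 0 := by
      refine le_antisymm ?_ (wsum_nonneg hc _)
      rw [← key0, ← hT0, hT]
      refine Finset.sum_le_sum_of_subset_of_nonneg (fun Γ hΓ => ?_) fun Γ _ _ => hw Γ
      simp only [Finset.mem_filter] at hΓ ⊢
      exact ⟨hΓ.1, hΓ.2.1⟩
    have h2 : wsum H.conductance (H.truncEdges S) (Good H.ends (H.truncInterior S) Eq) = 0 := this
    rw [hT0, h2]
    simp
  · rw [div_div_div_cancel_right₀ hT0]
    rfl

end ElectricalNetwork

/-! ### Planarity of the strip: confinement of crossing components -/

namespace NNetwork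

variable {m : ℕ}

/-- `v` is the right end of an edge with left end `u`. -/
def Step (u v : Vertex m ℤ) : Prop := (v.1 : ℕ) = u.1 + 1 ∧ (v.2 = u.2 ∨ v.2 = u.2 - 1)

/-- Adjacency in the strip. -/
def StripAdj (u v : Vertex m ℤ) : Prop := Step u v ∨ Step v u

/-- The indicator function of the vertices strictly above `v` in the layer of `v`. -/
def above (v u : Vertex m ℤ) : ℤ := if (u.1 : ℕ) = v.1 ∧ v.2 < u.2 then 1 else 0

/-- For a path from `s` to `t` inside `X`, let `R v` and `L v` be the signed numbers of its
crossings of the gaps to the right and to the left of the layer of `v`, counted at the vertices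
above `v` in that layer. They differ by the contributions of the end points, and they agree for the
two ends of an edge off the path. -/
lemma exists_crossing_numbers (X : Set (Vertex m ℤ)) {s t : Vertex m ℤ} (hs : s ∈ X)
    (h : Relation.ReflTransGen (fun a b => StripAdj a b ∧ b ∈ X) s t) :
    ∃ R L : Vertex m ℤ → ℤ, (∀ v, R v - L v = above v s - above v t) ∧
      (∀ v w, Step v w → v ∉ X → w ∉ X → R v = L w) ∧
      (∀ v, (∀ u ∈ X, u.2 ≤ v.2) → R v = 0 ∧ L v = 0) ∧
      (∀ v : Vertex m ℤ, (v.1 : ℕ) = 0 → L v = 0) := by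
  have key : t ∈ X ∧ ∃ R L : Vertex m ℤ → ℤ, (∀ v, R v - L v = above v s - above v t) ∧
      (∀ v w, Step v w → v ∉ X → w ∉ X → R v = L w) ∧
      (∀ v, (∀ u ∈ X, u.2 ≤ v.2) → R v = 0 ∧ L v = 0) ∧
      (∀ v : Vertex m ℤ, (v.1 : ℕ) = 0 → L v = 0) := by
    induction h with
    | refl => exact ⟨hs, fun _ => 0, fun _ => 0, by simp, by simp, by simp, by simp⟩
    | @tail a b _ h ih =>
      obtain ⟨hadj, hb⟩ := h
      obtain ⟨ha, R, L, h1, h2, h3, h4⟩ := ih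
      refine ⟨hb,
        fun v => R v + ((if (b.1 : ℕ) = v.1 + 1 then above v a else 0) -
          (if (a.1 : ℕ) = v.1 + 1 then above v b else 0)),
        fun v => L v + ((if (a.1 : ℕ) + 1 = v.1 then above v b else 0) -
          (if (b.1 : ℕ) + 1 = v.1 then above v a else 0)), ?_, ?_, ?_, ?_⟩
      · intro v
        have := h1 v
        simp only [above] at this ⊢
        unfold StripAdj Step at hadj
        split_ifs at this ⊢ <;> omega
      · intro v w hvw hv hw
        have := h2 v w hvw hv hw
        have hav : ¬ ((a.1 : ℕ) = v.1 ∧ a.2 = v.2) := fun h =>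
          hv ((Prod.ext (Fin.ext h.1) h.2 : a = v) ▸ ha)
        have hbv : ¬ ((b.1 : ℕ) = v.1 ∧ b.2 = v.2) := fun h =>
          hv ((Prod.ext (Fin.ext h.1) h.2 : b = v) ▸ hb)
        have haw : ¬ ((a.1 : ℕ) = w.1 ∧ a.2 = w.2) := fun h =>
          hw ((Prod.ext (Fin.ext h.1) h.2 : a = w) ▸ ha)
        have hbw : ¬ ((b.1 : ℕ) = w.1 ∧ b.2 = w.2) := fun h =>
          hw ((Prod.ext (Fin.ext h.1) h.2 : b = w) ▸ hb)
        simp only [above, this]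
        unfold StripAdj Step at hadj
        unfold Step at hvw
        split_ifs <;> omega
      · intro v hv
        obtain ⟨h5, h6⟩ := h3 v hv
        have := hv a ha
        have := hv b hb
        simp only [above, h5, h6]
        constructor <;> split_ifs <;> omega
      · intro v hv
        simp only [above, h4 v hv]
        split_ifs <;> omega
  exact key.2

/-- A path which leaves the layers up to `s` first does so along an edge to the layer `s + 1`. -/
lemma exists_first_hit {r : Vertex m ℤ → Vertex m ℤ → Prop} (hr : ∀ a b, r a b → StripAdj a b)
    {a v : Vertex m ℤ} (h : Relation.ReflTransGen r a v) (s : ℕ) (ha : (a.1 : ℕ) ≤ s)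
    (hv : s < (v.1 : ℕ)) :
    ∃ t₀ t, Relation.ReflTransGen (fun a b => r a b ∧ (b.1 : ℕ) ≤ s) a t₀ ∧ r t₀ t ∧
      (t₀.1 : ℕ) ≤ s ∧ (t.1 : ℕ) = s + 1 := by
  have key : (Relation.ReflTransGen (fun a b => r a b ∧ (b.1 : ℕ) ≤ s) a v ∧ (v.1 : ℕ) ≤ s) ∨
      ∃ t₀ t, Relation.ReflTransGen (fun a b => r a b ∧ (b.1 : ℕ) ≤ s) a t₀ ∧ r t₀ t ∧
      (t₀.1 : ℕ) ≤ s ∧ (t.1 : ℕ) = s + 1 := by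
    clear hv
    induction h with
    | refl => exact Or.inl ⟨Relation.ReflTransGen.refl, ha⟩
    | @tail y z _ h ih =>
      rcases ih with ⟨h1, h2⟩ | ih
      · by_cases hz : (z.1 : ℕ) ≤ s
        · exact Or.inl ⟨h1.tail ⟨h, hz⟩, hz⟩
        · refine Or.inr ⟨y, z, h1, h, h2, ?_⟩
          have := hr y z h
          unfold StripAdj Step at this
          omega
      · exact Or.inr ih
  rcases key with ⟨-, h⟩ | h
  · omega
  · exact h

/-- The component of the left vertex `y` crosses the strip and contains no other left vertex. -/
def Crosses (r : Vertex m ℤ → Vertex m ℤ → Prop) (y : ℤ) : Prop :=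
  (∃ v : Vertex m ℤ, (v.1 : ℕ) = m ∧ Relation.ReflTransGen r (0, y) v) ∧
    ∀ z, Relation.ReflTransGen r (0, y) (0, z) → z = y

/-- If the components of the left vertices `x, …, x + s` cross the strip and are distinct, then the
part of the component of `x` which is reached within the layers up to `s` stays in the columns up to
`x`: by induction the corresponding part of the component of `x + 1` lies in the columns up to
`x + 1` and contains a barrier, which the component of `x` cannot pass. -/
lemma confined_within {r : Vertex m ℤ → Vertex m ℤ → Prop} (hr : ∀ a b, r a b → StripAdj a b)
    (hsymm : ∀ a b, r a b → r b a) (s : ℕ) (hsm : s ≤ m) :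
    ∀ x : ℤ, (∀ y, x ≤ y → y ≤ x + s → Crosses r y) → ∀ v,
      Relation.ReflTransGen (fun a b => r a b ∧ (b.1 : ℕ) ≤ s) (0, x) v → v.2 ≤ x := by
  induction s with
  | zero =>
    intro x _ v hv
    suffices h : v = (0, x) by rw [h]
    induction hv with
    | refl => rfl
    | tail _ h ih =>
      subst ih
      have := hr _ _ h.1
      unfold StripAdj Step at this
      have h2 := h.2
      simp at this
      omega
  | succ s ih =>
    intro x hx v hv
    have ih' := ih (by omega) (x + 1) fun y hy hy' => hx y (by omega) (by push_cast; omega)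
    have hmono : ∀ {k : ℕ} {a b : Vertex m ℤ},
        Relation.ReflTransGen (fun a b => r a b ∧ (b.1 : ℕ) ≤ k) a b →
        Relation.ReflTransGen r a b :=
      fun h => Relation.ReflTransGen.mono (fun _ _ h => h.1) _ _ h
    obtain ⟨⟨w, hw, hxw⟩, huniq⟩ := hx (x + 1) (by omega) (by push_cast; omega)
    obtain ⟨t₀, t, ht₀, ht, hl₀, hl⟩ := exists_first_hit hr hxw s (by simp) (by omega)
    -- The barrier: the part of the component of `x + 1` within the layers up to `s`, and the vertex
    -- where it first enters the next layer.
    let X : Set (Vertex m ℤ) :=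
      insert t {u | Relation.ReflTransGen (fun a b => r a b ∧ (b.1 : ℕ) ≤ s) (0, x + 1) u}
    have hXr : ∀ u ∈ X, Relation.ReflTransGen r (0, x + 1) u := by
      rintro u (rfl | hu)
      · exact (hmono ht₀).tail ht
      · exact hmono hu
    have hXcol : ∀ u ∈ X, u.2 ≤ x + 1 := by
      rintro u (rfl | hu)
      · have h1 := ih' t₀ ht₀
        have h2 := hr _ _ ht
        unfold StripAdj Step at h2
        omega
      · exact ih' u hu
    have hpath : Relation.ReflTransGen (fun a b => StripAdj a b ∧ b ∈ X) (0, x + 1) t := by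
      refine Relation.ReflTransGen.tail (b := t₀) ?_ ⟨hr _ _ ht, Or.inl rfl⟩
      have : ∀ u, Relation.ReflTransGen (fun a b => r a b ∧ (b.1 : ℕ) ≤ s) (0, x + 1) u →
          Relation.ReflTransGen (fun a b => StripAdj a b ∧ b ∈ X) (0, x + 1) u := by
        intro u hu
        induction hu with
        | refl => exact Relation.ReflTransGen.refl
        | tail h1 h2 ih => exact ih.tail ⟨hr _ _ h2.1, Or.inr (h1.tail h2)⟩
      exact this t₀ ht₀
    obtain ⟨R, L, h1, h2, h3, h4⟩ :=
      exists_crossing_numbers X (Or.inr Relation.ReflTransGen.refl) hpath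
    have hnot : ∀ u, Relation.ReflTransGen r (0, x) u → u ∉ X := by
      intro u hu hX
      have h5 : Relation.ReflTransGen r u (0, x) := by
        clear hX
        induction hu with
        | refl => exact Relation.ReflTransGen.refl
        | tail _ h ih => exact Relation.ReflTransGen.head (hsymm _ _ h) ih
      have := huniq x ((hXr u hX).trans h5)
      omega
    have hRL : ∀ u : Vertex m ℤ, (u.1 : ℕ) ≠ 0 → (u.1 : ℕ) ≤ s → R u = L u := by
      intro u hu hu'
      have := h1 u
      simp only [above, Fin.val_zero] at this
      split_ifs at this <;> omega
    -- The crossing number is `1` at the left vertex `x`, and it does not change along a path which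
    -- avoids the barrier; above the barrier it is `0`.
    have side : (v.1 : ℕ) ≤ s + 1 ∧ (if (v.1 : ℕ) = 0 then R v else L v) = 1 := by
      induction hv with
      | refl =>
        refine ⟨by simp, ?_⟩
        have h5 := h1 (0, x)
        have h6 := h4 (0, x) (by simp)
        simp only [above, Fin.val_zero, hl] at h5
        simp at h5 ⊢
        omega
      | @tail y z hy hyz ih =>
        obtain ⟨hy1, hy2⟩ := ih
        have hyX := hnot y (hmono hy)
        have hzX := hnot z (hmono (hy.tail hyz))
        refine ⟨hyz.2, ?_⟩
        have h6 := hyz.2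
        rcases hr _ _ hyz.1 with hst | hst
        · have h5 := h2 y z hst hyX hzX
          have h7 := hst.1
          rw [if_neg (by omega), ← h5]
          by_cases hy0 : (y.1 : ℕ) = 0
          · rwa [if_pos hy0] at hy2
          · rw [if_neg hy0] at hy2
            rw [hRL y hy0 (by omega), hy2]
        · have h5 := h2 z y hst hzX hyX
          have h7 := hst.1
          rw [if_neg (by omega), ← h5] at hy2
          by_cases hz0 : (z.1 : ℕ) = 0
          · rwa [if_pos hz0]
          · rw [if_neg hz0, ← hRL z hz0 (by omega), hy2]
    by_contra! hcol
    obtain ⟨h5, h6⟩ := h3 v fun u hu => (hXcol u hu).trans (by omega)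
    have := side.2
    rw [h5, h6] at this
    simp at this

/-- If the components of the left vertices `x, …, x + m` cross the strip and are distinct, then the
component of `x` stays in the columns up to `x`. -/
lemma confined_above {r : Vertex m ℤ → Vertex m ℤ → Prop} (hr : ∀ a b, r a b → StripAdj a b)
    (hsymm : ∀ a b, r a b → r b a) {x : ℤ} (hx : ∀ y, x ≤ y → y ≤ x + m → Crosses r y)
    {v : Vertex m ℤ} (hv : Relation.ReflTransGen r (0, x) v) : v.2 ≤ x :=
  confined_within hr hsymm m le_rfl x hx v
    (Relation.ReflTransGen.mono (fun _ _ h => ⟨h, by omega⟩) _ _ hv)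

/-- The rotation of the strip by a half turn. -/
def rotate (v : Vertex m ℤ) : Vertex m ℤ := (v.1.rev, -v.2)

lemma rotate_rotate (v : Vertex m ℤ) : rotate (rotate v) = v := by
  simp [rotate]

lemma StripAdj.rotate {u v : Vertex m ℤ} (h : StripAdj u v) :
    StripAdj (NNetwork.rotate u) (NNetwork.rotate v) := by
  unfold StripAdj Step at h ⊢
  simp only [NNetwork.rotate, Fin.val_rev]
  omega

/-- The statement `confined_above` after a half turn. -/
lemma confined_below {r : Vertex m ℤ → Vertex m ℤ → Prop} (hr : ∀ a b, r a b → StripAdj a b)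
    (hsymm : ∀ a b, r a b → r b a) {x : ℤ}
    (hx : ∀ y, x - m ≤ y → y ≤ x →
      (∃ v : Vertex m ℤ, (v.1 : ℕ) = 0 ∧ Relation.ReflTransGen r (Fin.last m, y) v) ∧
      ∀ z, Relation.ReflTransGen r (Fin.last m, y) (Fin.last m, z) → z = y)
    {v : Vertex m ℤ} (hv : Relation.ReflTransGen r (Fin.last m, x) v) : x ≤ v.2 := by
  let r' : Vertex m ℤ → Vertex m ℤ → Prop := fun a b => r (rotate a) (rotate b)
  have hto : ∀ a b, Relation.ReflTransGen r a b →
      Relation.ReflTransGen r' (rotate a) (rotate b) := by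
    intro a b h
    induction h with
    | refl => exact Relation.ReflTransGen.refl
    | tail _ h ih =>
      refine ih.tail ?_
      change r (rotate (rotate _)) (rotate (rotate _))
      rwa [rotate_rotate, rotate_rotate]
  have hfrom : ∀ a b, Relation.ReflTransGen r' a b →
      Relation.ReflTransGen r (rotate a) (rotate b) := by
    intro a b h
    induction h with
    | refl => exact Relation.ReflTransGen.refl
    | tail _ h ih => exact ih.tail h
  have h0 : ∀ y : ℤ, rotate ((Fin.last m, y) : Vertex m ℤ) = (0, -y) := by
    intro y
    simp [rotate]
  have h0' : ∀ y : ℤ, rotate ((0, y) : Vertex m ℤ) = (Fin.last m, -y) := by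
    intro y
    simp [rotate]
  have key := confined_above (r := r') (x := -x) (v := rotate v) ?_ ?_ ?_ ?_
  · simp only [rotate] at key
    omega
  · intro a b h
    have := (hr _ _ h).rotate
    rwa [rotate_rotate, rotate_rotate] at this
  · intro a b h
    exact hsymm _ _ h
  · intro y hy hy'
    obtain ⟨⟨w, hw, hyw⟩, huniq⟩ := hx (-y) (by omega) (by omega)
    refine ⟨⟨rotate w, ?_, ?_⟩, ?_⟩
    · simp [rotate, hw]
    · have := hto _ _ hyw
      rwa [h0, neg_neg] at this
    · intro z hz
      have := hfrom _ _ hz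
      rw [h0', h0'] at this
      have := huniq _ this
      omega
  · have := hto _ _ hv
    rwa [h0] at this

end NNetwork

/-! ### Recognizing groves by counting edges -/

namespace EdgeSet

variable {V E : Type} {ends : E → Sym2 V}

/-- The components of the edge set `Γ`, restricted to the vertices in `W`. -/
def compSetoid (ends : E → Sym2 V) (W : Finset V) (Γ : Finset E) : Setoid W where
  r x y := Conn ends Γ x.1 y.1
  iseqv := ⟨fun _ => Conn.refl _, fun h => h.symm, fun h h' => h.trans h'⟩

/-- The number of components of `Γ` which meet `W`. -/
def compCard (ends : E → Sym2 V) (W : Finset V) (Γ : Finset E) : ℕ :=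
  Nat.card (Quotient (compSetoid ends W Γ))

variable {W : Finset V} {Γ Γ' : Finset E} {a b : V} {e : E}

lemma compCard_empty : compCard ends W ∅ = W.card := by
  rw [compCard, ← Nat.card_eq_finsetCard W]
  refine (Nat.card_congr (Equiv.ofBijective (Quotient.mk (compSetoid ends W ∅)) ⟨?_, ?_⟩)).symm
  · intro x y h
    have h : Conn ends ∅ x.1 y.1 := Quotient.exact h
    rcases Relation.ReflTransGen.cases_head h with h | ⟨w, ⟨e, he, _⟩, _⟩
    · exact Subtype.ext h
    · exact absurd he (Finset.notMem_empty _)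
  · exact Quotient.mk_surjective

lemma exists_ends (e : E) : ∃ a b, ends e = s(a, b) := by
  induction h : ends e with
  | _ a b => exact ⟨a, b, rfl⟩

variable [DecidableEq E]

lemma compCard_insert_of_conn (he : ends e = s(a, b)) (h : Conn ends Γ a b) :
    compCard ends W (insert e Γ) = compCard ends W Γ := by
  have : compSetoid ends W (insert e Γ) = compSetoid ends W Γ := by
    ext x y
    change Conn ends (insert e Γ) x y ↔ Conn ends Γ x y
    rw [conn_insert he]
    constructor
    · rintro (h' | ⟨h1, h2⟩ | ⟨h1, h2⟩)
      · exact h'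
      · exact h1.trans (h.trans h2)
      · exact h1.trans (h.symm.trans h2)
    · exact Or.inl
  rw [compCard, compCard, this]

lemma compCard_le_insert (he : ends e = s(a, b)) :
    compCard ends W Γ ≤ compCard ends W (insert e Γ) + 1 := by
  classical
  rw [compCard, compCard, ← Finite.card_option]
  let f : W → Option (Quotient (compSetoid ends W (insert e Γ))) := fun x =>
    if Conn ends Γ x a then none else some ⟦x⟧
  have hf : ∀ x y : W, Conn ends Γ x y → f x = f y := by
    intro x y hxy
    have : Conn ends Γ x a ↔ Conn ends Γ y a :=
      ⟨fun h => hxy.symm.trans h, fun h => hxy.trans h⟩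
    simp only [f, this]
    split_ifs
    · rfl
    · exact congrArg some (Quotient.sound (hxy.mono (Finset.subset_insert _ _)))
  refine Nat.card_le_card_of_injective (Quotient.lift f hf) ?_
  intro p q
  induction p using Quotient.inductionOn with | _ x
  induction q using Quotient.inductionOn with | _ y
  intro h
  change f x = f y at h
  simp only [f] at h
  apply Quotient.sound
  change Conn ends Γ x y
  split_ifs at h with h1 h2 h2
  · exact h1.trans h2.symm
  · have h3 : Conn ends (insert e Γ) x y := Quotient.exact (Option.some_injective _ h)
    rw [conn_insert he] at h3
    rcases h3 with h3 | ⟨h3, -⟩ | ⟨-, h3⟩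
    · exact h3
    · exact absurd h3 h1
    · exact absurd h3.symm h2

lemma compCard_insert_lt (he : ends e = s(a, b)) (ha : a ∈ W) (hb : b ∈ W)
    (h : ¬ Conn ends Γ a b) : compCard ends W (insert e Γ) < compCard ends W Γ := by
  have := Fintype.ofFinite (Quotient (compSetoid ends W Γ))
  have := Fintype.ofFinite (Quotient (compSetoid ends W (insert e Γ)))
  rw [compCard, compCard, Nat.card_eq_fintype_card, Nat.card_eq_fintype_card]
  let f : Quotient (compSetoid ends W Γ) → Quotient (compSetoid ends W (insert e Γ)) :=
    Quotient.map id fun x y hxy => Conn.mono (Finset.subset_insert _ _) hxy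
  refine Fintype.card_lt_of_surjective_not_injective f ?_ ?_
  · intro q
    induction q using Quotient.inductionOn with | _ x
    exact ⟨⟦x⟧, rfl⟩
  · intro hinj
    have h1 : f ⟦⟨a, ha⟩⟧ = f ⟦⟨b, hb⟩⟧ :=
      Quotient.sound (Conn.of_mem (Finset.mem_insert_self e Γ) he)
    exact h (Quotient.exact (hinj h1))

/-- Each edge reduces the number of components by at most one. -/
lemma card_le_compCard_add : W.card ≤ compCard ends W Γ + Γ.card := by
  induction Γ using Finset.induction_on with
  | empty => simp [compCard_empty]
  | insert e Γ he ih =>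
    obtain ⟨a, b, hab⟩ := exists_ends (ends := ends) e
    have := compCard_le_insert (W := W) (Γ := Γ) hab
    rw [Finset.card_insert_of_notMem he]
    omega

/-- In a forest, each edge reduces the number of components by one. -/
lemma Forest.compCard_add_le (hΓ : Forest ends Γ) (hW : ∀ e ∈ Γ, ∀ v ∈ ends e, v ∈ W) :
    compCard ends W Γ + Γ.card ≤ W.card := by
  induction Γ using Finset.induction_on with
  | empty => simp [compCard_empty]
  | insert e Γ he ih =>
    obtain ⟨a, b, hab⟩ := exists_ends (ends := ends) e
    have hmem := Finset.mem_insert_self e Γ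
    have hn := hΓ.not_conn hmem hab
    rw [Finset.erase_insert he] at hn
    have := compCard_insert_lt hab (hW e hmem a (by rw [hab]; exact Sym2.mem_mk_left _ _))
      (hW e hmem b (by rw [hab]; exact Sym2.mem_mk_right _ _)) hn
    have := ih (hΓ.mono (Finset.subset_insert _ _))
      fun e' he' => hW e' (Finset.mem_insert_of_mem he')
    rw [Finset.card_insert_of_notMem he]
    omega

lemma forest_of_compCard_add_le (h : compCard ends W Γ + Γ.card ≤ W.card) : Forest ends Γ := by
  intro e he a b hab hc
  have h1 := compCard_insert_of_conn (W := W) hab hc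
  rw [Finset.insert_erase he] at h1
  have h2 := card_le_compCard_add (ends := ends) (W := W) (Γ := Γ.erase e)
  have h3 := Finset.card_erase_add_one he
  omega

/-- An edge set with at most as many edges as a grove of type `π`, which joins every interior vertex
to the boundary and every two boundary vertices in the same part of `π`, is a grove of type `π`:
otherwise it would have too few components for its number of edges. -/
lemma Good.of_card_le [DecidableEq V] {I : Set V} {π : V → V → Prop} (hg : Good ends I π Γ)
    (hcard : Γ'.card ≤ Γ.card) (hgr : ∀ v ∈ I, ∃ b, b ∉ I ∧ Conn ends Γ' v b)
    (htype : ∀ b c, b ∉ I → c ∉ I → π b c → Conn ends Γ' b c) : Good ends I π Γ' := by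
  classical
  let W : Finset V := (Γ ∪ Γ').biUnion fun e => (ends e).toFinset
  have hW : ∀ e ∈ Γ ∪ Γ', ∀ v ∈ ends e, v ∈ W := fun e he v hv =>
    Finset.mem_biUnion.mpr ⟨e, he, Sym2.mem_toFinset.mpr hv⟩
  have hWconn : ∀ Δ ⊆ Γ ∪ Γ', ∀ x y, Conn ends Δ x y → x ≠ y → x ∈ W := by
    intro Δ hΔ x y hxy hne
    obtain ⟨e, he, u, hu, -⟩ := hxy.exists_first hne
    exact hW e (hΔ he) x (by rw [hu]; exact Sym2.mem_mk_left _ _)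
  have hroot : ∀ x : V, ∃ b, b ∉ I ∧ Conn ends Γ x b := by
    intro x
    by_cases hx : x ∈ I
    · exact hg.grounded x hx
    · exact ⟨x, hx, Conn.refl _⟩
  -- Mapping a component of `Γ` to the component of its boundary vertices in `Γ'` is well defined
  -- and surjective; counting edges shows that it is also injective.
  choose β hβI hβ using hroot
  have hβW : ∀ x : W, β x ∈ W := by
    intro x
    by_cases hx : (x : V) = β x
    · rw [← hx]; exact x.2
    · exact hWconn Γ Finset.subset_union_left _ _ (hβ x).symm (Ne.symm hx)
  have hββ : ∀ x y : V, Conn ends Γ x y → Conn ends Γ' (β x) (β y) := fun x y hxy =>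
    htype _ _ (hβI x) (hβI y)
      ((hg.type _ _ (hβI x) (hβI y)).mp ((hβ x).symm.trans (hxy.trans (hβ y))))
  have hββ' : ∀ b, b ∉ I → Conn ends Γ' b (β b) := fun b hb =>
    htype _ _ hb (hβI b) ((hg.type _ _ hb (hβI b)).mp (hβ b))
  let f : Quotient (compSetoid ends W Γ) → Quotient (compSetoid ends W Γ') :=
    Quotient.map (fun x => ⟨β x, hβW x⟩) fun x y hxy => hββ x y hxy
  have hsurj : Function.Surjective f := by
    intro q
    induction q using Quotient.inductionOn with | _ x
    obtain ⟨b, hb, hxb⟩ : ∃ b, b ∉ I ∧ Conn ends Γ' x b := by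
      by_cases hx : (x : V) ∈ I
      · exact hgr x hx
      · exact ⟨x, hx, Conn.refl _⟩
    have hbW : b ∈ W := by
      by_cases h : (x : V) = b
      · rw [← h]; exact x.2
      · exact hWconn Γ' Finset.subset_union_right _ _ hxb.symm (Ne.symm h)
    exact ⟨⟦⟨b, hbW⟩⟧, Quotient.sound (hxb.trans (hββ' b hb)).symm⟩
  have h1 : compCard ends W Γ' ≤ compCard ends W Γ := Nat.card_le_card_of_surjective f hsurj
  have h2 := hg.forest.compCard_add_le fun e he => hW e (Finset.mem_union_left _ he)
  have h3 := card_le_compCard_add (ends := ends) (W := W) (Γ := Γ')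
  refine ⟨forest_of_compCard_add_le (W := W) (by omega), hgr, fun b c hb hc => ?_⟩
  refine ⟨fun hbc => ?_, htype b c hb hc⟩
  by_cases hne : b = c
  · subst hne
    exact (hg.type b b hb hb).mp (Conn.refl _)
  have hbW : b ∈ W := hWconn Γ' Finset.subset_union_right _ _ hbc hne
  have hcW : c ∈ W := hWconn Γ' Finset.subset_union_right _ _ hbc.symm (Ne.symm hne)
  have hinj : Function.Injective f :=
    ((Function.Surjective.bijective_of_nat_card_le hsurj (by
      change compCard ends W Γ ≤ compCard ends W Γ'; omega))).1
  have hf : f ⟦⟨b, hbW⟩⟧ = f ⟦⟨c, hcW⟩⟧ :=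
    Quotient.sound ((hββ' b hb).symm.trans (hbc.trans (hββ' c hc)))
  exact (hg.type b c hb hc).mp (Quotient.exact (hinj hf))

end EdgeSet

/-! ### Edges of the strip and the boundary partitions -/

instance : DecidableEq EdgeKind := fun s t => match s, t with
  | EdgeKind.low, EdgeKind.low => isTrue rfl
  | EdgeKind.high, EdgeKind.high => isTrue rfl
  | EdgeKind.low, EdgeKind.high => isFalse (fun h => EdgeKind.noConfusion h)
  | EdgeKind.high, EdgeKind.low => isFalse (fun h => EdgeKind.noConfusion h)

namespace NNetwork

open EdgeSet

variable {m : ℕ} {Γ : Finset (Edge m ℤ)}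

lemma linked_cases {u v : Vertex m ℤ} (h : Linked ends Γ u v) :
    (∃ k x, (k, x, EdgeKind.low) ∈ Γ ∧ ((u = (k.castSucc, x) ∧ v = (k.succ, x)) ∨
      (v = (k.castSucc, x) ∧ u = (k.succ, x)))) ∨
    (∃ k x, (k, x, EdgeKind.high) ∈ Γ ∧ ((u = (k.castSucc, x) ∧ v = (k.succ, x - 1)) ∨
      (v = (k.castSucc, x) ∧ u = (k.succ, x - 1)))) := by
  obtain ⟨⟨k, x, t⟩, he, h⟩ := h
  cases t
  · refine Or.inl ⟨k, x, he, ?_⟩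
    simp only [ends, Sym2.eq_iff] at h
    rcases h with ⟨h1, h2⟩ | ⟨h1, h2⟩
    · exact Or.inl ⟨h1.symm, h2.symm⟩
    · exact Or.inr ⟨h1.symm, h2.symm⟩
  · refine Or.inr ⟨k, x, he, ?_⟩
    simp only [ends, Sym2.eq_iff] at h
    rcases h with ⟨h1, h2⟩ | ⟨h1, h2⟩
    · exact Or.inl ⟨h1.symm, h2.symm⟩
    · exact Or.inr ⟨h1.symm, h2.symm⟩

lemma linked_low {k : Fin m} {x : ℤ} (h : (k, x, EdgeKind.low) ∈ Γ) :
    Linked ends Γ (k.castSucc, x) (k.succ, x) := ⟨_, h, rfl⟩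

lemma linked_high {k : Fin m} {x : ℤ} (h : (k, x, EdgeKind.high) ∈ Γ) :
    Linked ends Γ (k.castSucc, x) (k.succ, x - 1) := ⟨_, h, rfl⟩

lemma conn_low {k : Fin m} {x : ℤ} (h : (k, x, EdgeKind.low) ∈ Γ) :
    Conn ends Γ (k.castSucc, x) (k.succ, x) := Relation.ReflTransGen.single (linked_low h)

lemma conn_high {k : Fin m} {x : ℤ} (h : (k, x, EdgeKind.high) ∈ Γ) :
    Conn ends Γ (k.castSucc, x) (k.succ, x - 1) := Relation.ReflTransGen.single (linked_high h)

lemma linked_stripAdj {u v : Vertex m ℤ} (h : Linked ends Γ u v) : StripAdj u v := by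
  rcases linked_cases h with ⟨k, x, -, ⟨rfl, rfl⟩ | ⟨rfl, rfl⟩⟩ |
    ⟨k, x, -, ⟨rfl, rfl⟩ | ⟨rfl, rfl⟩⟩ <;>
    simp [StripAdj, Step]

/-- The boundary vertices in the part of the right vertex `r'` in the partition `τ_K`. -/
def TauPart (r : ℤ) (v : Vertex m ℤ) : Prop :=
  v = (Fin.last m, r) ∨ (v.1 = 0 ∧ (r ≤ 0 ∧ v.2 = r ∨ 1 ≤ r ∧ v.2 = r + 1))

/-- The boundary vertices in the part of the right vertex `r'` in the partition `σ_K`. -/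
def SigmaPart (r : ℤ) (v : Vertex m ℤ) : Prop :=
  v = (Fin.last m, r) ∨ (v.1 = 0 ∧ (r ≤ 0 ∧ v.2 = r ∨ 0 ≤ r ∧ v.2 = r + 1))

/-- The right vertices with a nontrivial part in `τ_K` and `σ_K`; the vertex `0'` has one even if
`K = 0`. -/
def InRange (K : ℕ) (r : ℤ) : Prop := r = 0 ∨ (-K ≤ r ∧ r < K)

lemma tau_iff [NeZero m] (K : ℕ) (b c : Vertex m ℤ) :
    tau m K b c ↔ b = c ∨ ∃ r, InRange K r ∧ TauPart r b ∧ TauPart r c := by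
  change (b = c ∨ ∃ p ∈ tauParts m K, b ∈ p ∧ c ∈ p) ↔ _
  refine or_congr_right ⟨?_, ?_⟩
  · rintro ⟨p, hp, hb, hc⟩
    simp only [tauParts, commonParts, Set.mem_insert_iff, Set.mem_union, Set.mem_ofPred_eq,
      leftVertex, rightVertex] at hp
    have key : ∀ x : Vertex m ℤ, ∀ k r : ℤ, x ∈ ({(0, k), (Fin.last m, r)} : Set (Vertex m ℤ)) →
        (r ≤ 0 ∧ k = r ∨ 1 ≤ r ∧ k = r + 1) → TauPart r x := by
      rintro x k r (rfl | rfl) h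
      · exact Or.inr ⟨rfl, h⟩
      · exact Or.inl rfl
    rcases hp with rfl | ⟨k, hk, hk', rfl⟩ | ⟨k, hk, hk', rfl⟩
    · exact ⟨0, Or.inl rfl, key _ _ _ hb (by omega), key _ _ _ hc (by omega)⟩
    · exact ⟨k - 1, Or.inr (by omega), key _ _ _ hb (by omega), key _ _ _ hc (by omega)⟩
    · exact ⟨k, Or.inr (by omega), key _ _ _ hb (by omega), key _ _ _ hc (by omega)⟩
  · rintro ⟨r, hr, hb, hc⟩
    have key : ∀ x : Vertex m ℤ, ∀ k : ℤ, TauPart r x →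
        (r ≤ 0 ∧ k = r ∨ 1 ≤ r ∧ k = r + 1) →
        x ∈ ({leftVertex m k, rightVertex m r} : Set (Vertex m ℤ)) := by
      rintro ⟨i, x⟩ k (h | ⟨h1, h⟩) hk
      · exact Or.inr h
      · left
        simp only at h1 h
        rw [h1, leftVertex]
        congr 1
        omega
    rcases lt_trichotomy r 0 with h0 | h0 | h0
    · refine ⟨_, Or.inr (Or.inr ⟨r, ?_, h0, rfl⟩), key _ _ hb (by omega), key _ _ hc (by omega)⟩
      rcases hr with hr | hr <;> omega
    · subst h0
      exact ⟨_, Or.inl rfl, key _ _ hb (by omega), key _ _ hc (by omega)⟩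
    · refine ⟨_, Or.inr (Or.inl ⟨r + 1, by omega, ?_, rfl⟩), ?_, ?_⟩
      · rcases hr with hr | hr <;> omega
      · rw [add_sub_cancel_right]; exact key _ _ hb (by omega)
      · rw [add_sub_cancel_right]; exact key _ _ hc (by omega)

lemma sigma_iff [NeZero m] (K : ℕ) (b c : Vertex m ℤ) :
    sigma m K b c ↔ b = c ∨ ∃ r, InRange K r ∧ SigmaPart r b ∧ SigmaPart r c := by
  change (b = c ∨ ∃ p ∈ sigmaParts m K, b ∈ p ∧ c ∈ p) ↔ _
  refine or_congr_right ⟨?_, ?_⟩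
  · rintro ⟨p, hp, hb, hc⟩
    simp only [sigmaParts, commonParts, Set.mem_insert_iff, Set.mem_union, Set.mem_ofPred_eq,
      leftVertex, rightVertex] at hp
    have key : ∀ x : Vertex m ℤ, ∀ k r : ℤ, x ∈ ({(0, k), (Fin.last m, r)} : Set (Vertex m ℤ)) →
        (r ≤ 0 ∧ k = r ∨ 0 ≤ r ∧ k = r + 1) → SigmaPart r x := by
      rintro x k r (rfl | rfl) h
      · exact Or.inr ⟨rfl, h⟩
      · exact Or.inl rfl
    have key0 : ∀ x : Vertex m ℤ, x ∈ ({(0, 1), (0, 0), (Fin.last m, 0)} : Set (Vertex m ℤ)) →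
        SigmaPart 0 x := by
      rintro x (rfl | rfl | rfl)
      · exact Or.inr ⟨rfl, by simp⟩
      · exact Or.inr ⟨rfl, by simp⟩
      · exact Or.inl rfl
    rcases hp with rfl | ⟨k, hk, hk', rfl⟩ | ⟨k, hk, hk', rfl⟩
    · exact ⟨0, Or.inl rfl, key0 _ hb, key0 _ hc⟩
    · exact ⟨k - 1, Or.inr (by omega), key _ _ _ hb (by omega), key _ _ _ hc (by omega)⟩
    · exact ⟨k, Or.inr (by omega), key _ _ _ hb (by omega), key _ _ _ hc (by omega)⟩
  · rintro ⟨r, hr, hb, hc⟩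
    have key : ∀ x : Vertex m ℤ, ∀ k : ℤ, r ≠ 0 → SigmaPart r x →
        (r < 0 ∧ k = r ∨ 1 ≤ r ∧ k = r + 1) →
        x ∈ ({leftVertex m k, rightVertex m r} : Set (Vertex m ℤ)) := by
      rintro ⟨i, x⟩ k h0 (h | ⟨h1, h⟩) hk
      · exact Or.inr h
      · left
        simp only at h1 h
        rw [h1, leftVertex]
        congr 1
        omega
    rcases lt_trichotomy r 0 with h0 | h0 | h0
    · refine ⟨_, Or.inr (Or.inr ⟨r, ?_, h0, rfl⟩), key _ _ h0.ne hb (by omega),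
        key _ _ h0.ne hc (by omega)⟩
      rcases hr with hr | hr <;> omega
    · subst h0
      have key0 : ∀ x : Vertex m ℤ, SigmaPart 0 x →
          x ∈ ({leftVertex m 1, leftVertex m 0, rightVertex m 0} : Set (Vertex m ℤ)) := by
        rintro ⟨i, x⟩ (h | ⟨h1, h⟩)
        · exact Or.inr (Or.inr h)
        · simp only at h1 h
          rw [h1]
          rcases h with ⟨-, rfl⟩ | ⟨-, rfl⟩
          · exact Or.inr (Or.inl rfl)
          · exact Or.inl rfl
      exact ⟨_, Or.inl rfl, key0 _ hb, key0 _ hc⟩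
    · refine ⟨_, Or.inr (Or.inl ⟨r + 1, by omega, ?_, rfl⟩), ?_, ?_⟩
      · rcases hr with hr | hr <;> omega
      · rw [add_sub_cancel_right]; exact key _ _ h0.ne' hb (by omega)
      · rw [add_sub_cancel_right]; exact key _ _ h0.ne' hc (by omega)

/-- The interior vertices of the universal cover. -/
def stripInterior (m : ℕ) : Set (Vertex m ℤ) := {v | v.1 ≠ 0 ∧ v.1 ≠ Fin.last m}

lemma left_notMem {I : Set (Vertex m ℤ)} (hI : I ⊆ stripInterior m) (x : ℤ) : (0, x) ∉ I :=
  fun h => (hI h).1 rfl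

lemma right_notMem {I : Set (Vertex m ℤ)} (hI : I ⊆ stripInterior m) (x : ℤ) :
    (Fin.last m, x) ∉ I :=
  fun h => (hI h).2 rfl

section Confinement

variable [NeZero m] {I : Set (Vertex m ℤ)} {K : ℕ}

lemma last_ne_zero : (Fin.last m) ≠ 0 := fun h => NeZero.ne m (congrArg Fin.val h)

lemma sigma_left_left {x y : ℤ} (h : sigma m K (0, x) (0, y)) (hne : x ≠ y) :
    (x = 0 ∧ y = 1) ∨ (x = 1 ∧ y = 0) := by
  rcases (sigma_iff K _ _).mp h with h | ⟨r, -, (h1 | ⟨-, h1⟩), (h2 | ⟨-, h2⟩)⟩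
  · exact absurd (congrArg Prod.snd h) hne
  · exact absurd (congrArg Prod.fst h1).symm last_ne_zero
  · exact absurd (congrArg Prod.fst h1).symm last_ne_zero
  · exact absurd (congrArg Prod.fst h2).symm last_ne_zero
  · simp only at h1 h2
    omega

lemma sigma_right_right {x y : ℤ} (h : sigma m K (Fin.last m, x) (Fin.last m, y)) : x = y := by
  rcases (sigma_iff K _ _).mp h with h | ⟨r, -, (h1 | ⟨h1, -⟩), (h2 | ⟨h2, -⟩)⟩
  · exact congrArg Prod.snd h
  · exact (congrArg Prod.snd h1).trans (congrArg Prod.snd h2).symm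
  · exact absurd h2 last_ne_zero
  · exact absurd h1 last_ne_zero
  · exact absurd h1 last_ne_zero

lemma tau_right_right {x y : ℤ} (h : tau m K (Fin.last m, x) (Fin.last m, y)) : x = y := by
  rcases (tau_iff K _ _).mp h with h | ⟨r, -, (h1 | ⟨h1, -⟩), (h2 | ⟨h2, -⟩)⟩
  · exact congrArg Prod.snd h
  · exact (congrArg Prod.snd h1).trans (congrArg Prod.snd h2).symm
  · exact absurd h2 last_ne_zero
  · exact absurd h1 last_ne_zero
  · exact absurd h1 last_ne_zero

lemma sigma_left_right {x r : ℤ} (hr : InRange K r) (h : r ≤ 0 ∧ x = r ∨ 0 ≤ r ∧ x = r + 1) :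
    sigma m K (0, x) (Fin.last m, r) :=
  (sigma_iff K _ _).mpr (Or.inr ⟨r, hr, Or.inr ⟨rfl, h⟩, Or.inl rfl⟩)

lemma tau_left_right {x r : ℤ} (hr : InRange K r) (h : r ≤ 0 ∧ x = r ∨ 1 ≤ r ∧ x = r + 1) :
    tau m K (0, x) (Fin.last m, r) :=
  (tau_iff K _ _).mpr (Or.inr ⟨r, hr, Or.inr ⟨rfl, h⟩, Or.inl rfl⟩)

variable (hI : I ⊆ stripInterior m)
include hI

lemma sigma_crosses (hg : Good ends I (sigma m K) Γ) {x : ℤ}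
    (hx : (-K ≤ x ∧ x < 0) ∨ (2 ≤ x ∧ x ≤ K)) : Crosses (Linked ends Γ) x := by
  refine ⟨?_, fun z hz => ?_⟩
  · rcases hx with hx | hx
    · refine ⟨(Fin.last m, x), by simp, ?_⟩
      exact (hg.type _ _ (left_notMem hI _) (right_notMem hI _)).mpr
        (sigma_left_right (Or.inr (by omega)) (by omega))
    · refine ⟨(Fin.last m, x - 1), by simp, ?_⟩
      exact (hg.type _ _ (left_notMem hI _) (right_notMem hI _)).mpr
        (sigma_left_right (Or.inr (by omega)) (by omega))
  · have := (hg.type _ _ (left_notMem hI _) (left_notMem hI _)).mp hz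
    by_contra hne
    have := sigma_left_left this (Ne.symm hne)
    omega

lemma sigma_confined_above (hg : Good ends I (sigma m K) Γ) {x : ℤ}
    (hx : (-K ≤ x ∧ x + m < 0) ∨ (2 ≤ x ∧ x + m ≤ K)) {v : Vertex m ℤ}
    (hv : Conn ends Γ (0, x) v) : v.2 ≤ x :=
  confined_above (fun _ _ h => linked_stripAdj h) (fun _ _ h => h.symm)
    (fun y hy hy' => sigma_crosses hI hg (by omega)) hv

lemma sigma_confined_below (hg : Good ends I (sigma m K) Γ) {r : ℤ}
    (hr : -K + m ≤ r ∧ r < K) {v : Vertex m ℤ}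
    (hv : Conn ends Γ (Fin.last m, r) v) : r ≤ v.2 := by
  refine confined_below (fun _ _ h => linked_stripAdj h) (fun _ _ h => h.symm)
    (fun y hy hy' => ⟨⟨(0, if y ≤ 0 then y else y + 1), by simp, ?_⟩, fun z hz => ?_⟩) hv
  · refine ((hg.type _ _ (left_notMem hI _) (right_notMem hI _)).mpr
      (sigma_left_right (Or.inr (by omega)) ?_)).symm
    split_ifs <;> omega
  · exact (sigma_right_right
      ((hg.type _ _ (right_notMem hI _) (right_notMem hI _)).mp hz)).symm

lemma tau_confined_below (hg : Good ends I (tau m K) Γ) {r : ℤ}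
    (hr : -K + m ≤ r ∧ r < K) {v : Vertex m ℤ}
    (hv : Conn ends Γ (Fin.last m, r) v) : r ≤ v.2 := by
  refine confined_below (fun _ _ h => linked_stripAdj h) (fun _ _ h => h.symm)
    (fun y hy hy' => ⟨⟨(0, if y ≤ 0 then y else y + 1), by simp, ?_⟩, fun z hz => ?_⟩) hv
  · refine ((hg.type _ _ (left_notMem hI _) (right_notMem hI _)).mpr
      (tau_left_right (Or.inr (by omega)) ?_)).symm
    split_ifs <;> omega
  · exact (tau_right_right
      ((hg.type _ _ (right_notMem hI _) (right_notMem hI _)).mp hz)).symm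

end Confinement

end NNetwork

/-! ### Explicit groves -/

namespace NNetwork

open EdgeSet

variable {m : ℕ} {Γ : Finset (Edge m ℤ)}

/-- An edge of `Γ` leads from `u` to `v` in the next layer. -/
def Fwd (Γ : Finset (Edge m ℤ)) (u v : Vertex m ℤ) : Prop :=
  (∃ k x, (k, x, EdgeKind.low) ∈ Γ ∧ u = (k.castSucc, x) ∧ v = (k.succ, x)) ∨
    (∃ k x, (k, x, EdgeKind.high) ∈ Γ ∧ u = (k.castSucc, x) ∧ v = (k.succ, x - 1))

lemma Fwd.linked {u v : Vertex m ℤ} (h : Fwd Γ u v) : Linked ends Γ u v := by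
  rcases h with ⟨k, x, h, rfl, rfl⟩ | ⟨k, x, h, rfl, rfl⟩
  · exact linked_low h
  · exact linked_high h

lemma Fwd.lt {u v : Vertex m ℤ} (h : Fwd Γ u v) : (v.1 : ℕ) = u.1 + 1 := by
  rcases h with ⟨k, x, h, rfl, rfl⟩ | ⟨k, x, h, rfl, rfl⟩ <;> simp

lemma linked_iff_fwd {u v : Vertex m ℤ} : Linked ends Γ u v ↔ Fwd Γ u v ∨ Fwd Γ v u := by
  constructor
  · intro h
    rcases linked_cases h with ⟨k, x, h, ⟨h1, h2⟩ | ⟨h1, h2⟩⟩ | ⟨k, x, h, ⟨h1, h2⟩ | ⟨h1, h2⟩⟩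
    · exact Or.inl (Or.inl ⟨k, x, h, h1, h2⟩)
    · exact Or.inr (Or.inl ⟨k, x, h, h1, h2⟩)
    · exact Or.inl (Or.inr ⟨k, x, h, h1, h2⟩)
    · exact Or.inr (Or.inr ⟨k, x, h, h1, h2⟩)
  · rintro (h | h)
    · exact h.linked
    · exact h.linked.symm

lemma Fwd.unique (hdet : ∀ k x, (k, x, EdgeKind.low) ∈ Γ → (k, x, EdgeKind.high) ∉ Γ)
    {u v w : Vertex m ℤ} (h : Fwd Γ u v) (h' : Fwd Γ u w) : v = w := by
  rcases h with ⟨k, x, h, hu, hv⟩ | ⟨k, x, h, hu, hv⟩ <;>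
  rcases h' with ⟨l, y, h', hu', hw⟩ | ⟨l, y, h', hu', hw⟩ <;>
  · rw [hu, Prod.mk.injEq] at hu'
    obtain ⟨h1, rfl⟩ := hu'
    obtain rfl := Fin.castSucc_injective _ h1
    first
    | exact hv.trans hw.symm
    | exact absurd h' (hdet _ _ h)
    | exact absurd h (hdet _ _ h')

lemma conn_of_fwd {u v : Vertex m ℤ} (h : Relation.ReflTransGen (Fwd Γ) u v) : Conn ends Γ u v :=
  Relation.ReflTransGen.mono (fun _ _ h => Fwd.linked h) _ _ h

/-- An edge set with at most one edge from each vertex to the next layer is a forest. -/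
lemma forest_of_unique_fwd
    (hdet : ∀ k x, (k, x, EdgeKind.low) ∈ Γ → (k, x, EdgeKind.high) ∉ Γ) : Forest ends Γ := by
  have key : ∀ k x t, (k, x, t) ∈ Γ → ∀ w : Vertex m ℤ, w.1 = k.succ →
      ¬ Conn ends (Γ.erase (k, x, t)) (k.castSucc, x) w := by
    intro k x t he w hw hc
    -- The vertices from which `(k, x)` is reached by edges to the next layer are a union of
    -- components once the edge is removed.
    let D : Vertex m ℤ → Prop := fun u => Relation.ReflTransGen (Fwd Γ) u (k.castSucc, x)
    have hstep : ∀ p q, Fwd (Γ.erase (k, x, t)) p q → (D p ↔ D q) := by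
      intro p q hpq
      have hpq' : Fwd Γ p q := by
        rcases hpq with ⟨l, y, h, h'⟩ | ⟨l, y, h, h'⟩
        · exact Or.inl ⟨l, y, Finset.mem_of_mem_erase h, h'⟩
        · exact Or.inr ⟨l, y, Finset.mem_of_mem_erase h, h'⟩
      refine ⟨fun hp => ?_, fun hq => Relation.ReflTransGen.head hpq' hq⟩
      rcases Relation.ReflTransGen.cases_head hp with rfl | ⟨z, hz, hzx⟩
      · exfalso
        rcases hpq with ⟨l, y, h, h1, -⟩ | ⟨l, y, h, h1, -⟩ <;>
        · rw [Prod.mk.injEq] at h1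
          obtain ⟨h1, rfl⟩ := h1
          obtain rfl := Fin.castSucc_injective _ h1
          rw [Finset.mem_erase] at h
          cases t
          · first
            | exact h.1 rfl
            | exact hdet _ _ he h.2
          · first
            | exact h.1 rfl
            | exact hdet _ _ h.2 he
      · rwa [hz.unique hdet hpq'] at hzx
    have hD : D (k.castSucc, x) ↔ D w := by
      clear hw
      induction hc with
      | refl => exact Iff.rfl
      | tail _ h ih =>
        rcases linked_iff_fwd.mp h with h | h
        · exact ih.trans (hstep _ _ h)
        · exact ih.trans (hstep _ _ h).symm
    have hmono : ∀ u, D u → (u.1 : ℕ) ≤ k := by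
      intro u hu
      induction hu using Relation.ReflTransGen.head_induction_on with
      | refl => simp
      | head h _ ih =>
        have := h.lt
        omega
    have := hmono w (hD.mp Relation.ReflTransGen.refl)
    rw [hw] at this
    simp at this
  rintro ⟨k, x, t⟩ he a b hab hc
  have h1 : ends (k, x, t) =
      s((k.castSucc, x), (k.succ, if t = EdgeKind.low then x else x - 1)) := by
    cases t <;> simp [ends]
  rw [h1, Sym2.eq_iff] at hab
  rcases hab with ⟨rfl, rfl⟩ | ⟨rfl, rfl⟩
  · exact key k x t he _ rfl hc
  · exact key k x t he _ rfl hc.symm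

/-- Following the edges to the next layer from `u` ends at `w`. -/
def FwdRoot (Γ : Finset (Edge m ℤ)) (u w : Vertex m ℤ) : Prop :=
  Relation.ReflTransGen (Fwd Γ) u w ∧ ∀ z, ¬ Fwd Γ w z

lemma FwdRoot.unique (hdet : ∀ k x, (k, x, EdgeKind.low) ∈ Γ → (k, x, EdgeKind.high) ∉ Γ)
    {u v w z : Vertex m ℤ} (h : Conn ends Γ u v) (hu : FwdRoot Γ u w) (hv : FwdRoot Γ v z) :
    w = z := by
  have hstep : ∀ p q, Fwd Γ p q → ∀ w, FwdRoot Γ p w ↔ FwdRoot Γ q w := by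
    intro p q hpq w
    refine ⟨fun ⟨h, h'⟩ => ⟨?_, h'⟩, fun ⟨h, h'⟩ => ⟨Relation.ReflTransGen.head hpq h, h'⟩⟩
    rcases Relation.ReflTransGen.cases_head h with rfl | ⟨z, hz, hzx⟩
    · exact absurd hpq (h' q)
    · rwa [hz.unique hdet hpq] at hzx
  have hconn : ∀ w, FwdRoot Γ u w ↔ FwdRoot Γ v w := by
    intro w
    clear hv hu
    induction h with
    | refl => exact Iff.rfl
    | tail _ h ih =>
      rcases linked_iff_fwd.mp h with h | h
      · exact ih.trans (hstep _ _ h w)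
      · exact ih.trans (hstep _ _ h w).symm
  have hw := (hconn w).mp hu
  obtain ⟨h1, h2⟩ := hw
  obtain ⟨h3, h4⟩ := hv
  clear h hu hconn
  induction h1 using Relation.ReflTransGen.head_induction_on with
  | refl =>
    rcases Relation.ReflTransGen.cases_head h3 with rfl | ⟨y, hy, -⟩
    · rfl
    · exact absurd hy (h2 y)
  | head h _ ih =>
    rcases Relation.ReflTransGen.cases_head h3 with rfl | ⟨y, hy, hyz⟩
    · exact absurd h (h4 _)
    · rw [hy.unique hdet h] at hyz
      exact ih hyz

variable {n : ℕ}

lemma mem_truncEdges_iff (c : Edge m (ZMod n) → ℝ) (S : Finset (Vertex m ℤ)) (e : Edge m ℤ) :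
    e ∈ (universalCover c).truncEdges S ↔ ∃ u ∈ S, u ∈ ends e :=
  ElectricalNetwork.mem_truncEdges

lemma truncInterior_eq (c : Edge m (ZMod n) → ℝ) (S : Finset (Vertex m ℤ)) :
    (universalCover c).truncInterior S = {v | v ∈ S ∧ v ∈ stripInterior m} := by
  ext v
  simp only [ElectricalNetwork.truncInterior, universalCover, network, stripInterior,
    Set.mem_ofPred_eq, not_or]

lemma truncInterior_subset (c : Edge m (ZMod n) → ℝ) (S : Finset (Vertex m ℤ)) :
    (universalCover c).truncInterior S ⊆ stripInterior m := by
  rw [truncInterior_eq]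
  exact fun v hv => hv.2

/-- The low edges from the interior vertices of the truncation to `S`, together with the edges from
the left vertices that are selected by `A`. -/
def layeredGrove (c : Edge m (ZMod n) → ℝ) (S : Finset (Vertex m ℤ)) (A : ℤ → EdgeKind → Prop) :
    Finset (Edge m ℤ) :=
  open Classical in
  ((universalCover c).truncEdges S).filter fun e => ((e.1 : ℕ) = 0 ∧ A e.2.1 e.2.2) ∨
    ((e.1 : ℕ) ≠ 0 ∧ e.2.2 = EdgeKind.low ∧ (e.1.castSucc, e.2.1) ∈ S)

variable {c : Edge m (ZMod n) → ℝ} {S : Finset (Vertex m ℤ)} {A : ℤ → EdgeKind → Prop}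

lemma layeredGrove_subset : layeredGrove c S A ⊆ (universalCover c).truncEdges S := by
  classical exact Finset.filter_subset _ _

lemma mem_layeredGrove_low {k : Fin m} {x : ℤ} (hk : (k : ℕ) ≠ 0) (h : (k.castSucc, x) ∈ S) :
    (k, x, EdgeKind.low) ∈ layeredGrove c S A := by
  classical
  rw [layeredGrove, Finset.mem_filter, mem_truncEdges_iff]
  refine ⟨⟨_, h, ?_⟩, ?_⟩
  · exact Sym2.mem_mk_left _ _
  · exact Or.inr ⟨hk, rfl, h⟩

lemma layeredGrove_det (hA : ∀ x, A x EdgeKind.low → ¬ A x EdgeKind.high) (k : Fin m) (x : ℤ)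
    (h : (k, x, EdgeKind.low) ∈ layeredGrove c S A) :
    (k, x, EdgeKind.high) ∉ layeredGrove c S A := by
  classical
  rw [layeredGrove, Finset.mem_filter] at h ⊢
  rintro ⟨-, ⟨h0, h'⟩ | ⟨-, h', -⟩⟩
  · rcases h.2 with h | h
    · exact hA x h.2 h'
    · exact h.1 h0
  · exact EdgeKind.noConfusion h'

/-- From an interior vertex, low edges lead to a boundary vertex of the truncation. -/
lemma layeredGrove_grounded (d : ℕ) :
    ∀ (i : Fin (m + 1)) (x : ℤ), (i : ℕ) + d = m → (i : ℕ) ≠ 0 →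
    ∃ b, b ∉ (universalCover c).truncInterior S ∧
      Relation.ReflTransGen (Fwd (layeredGrove c S A)) (i, x) b := by
  induction d with
  | zero =>
    intro i x hi h0
    refine ⟨(i, x), fun h => ?_, Relation.ReflTransGen.refl⟩
    rw [truncInterior_eq] at h
    exact h.2.2 (Fin.ext (by simpa using hi))
  | succ d ih =>
    intro i x hi h0
    by_cases hx : (i, x) ∈ (universalCover c).truncInterior S
    · let k : Fin m := ⟨i, by omega⟩
      have hk : k.castSucc = i := Fin.ext rfl
      obtain ⟨b, hb, h⟩ := ih k.succ x (by simp [k]; omega) (by simp [k])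
      refine ⟨b, hb, Relation.ReflTransGen.head (Or.inl ⟨k, x, ?_, by rw [hk], rfl⟩) h⟩
      rw [truncInterior_eq] at hx
      exact mem_layeredGrove_low h0 (by rw [hk]; exact hx.1)
    · exact ⟨(i, x), hx, Relation.ReflTransGen.refl⟩

lemma layeredGrove_column {x : ℤ} (hS : ∀ i : Fin (m + 1), (i, x) ∈ S) (d : ℕ) :
    ∀ i : Fin (m + 1), (i : ℕ) + d = m → (i : ℕ) ≠ 0 →
      Relation.ReflTransGen (Fwd (layeredGrove c S A)) (i, x) (Fin.last m, x) := by
  induction d with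
  | zero =>
    intro i hi _
    have : i = Fin.last m := Fin.ext (by simpa using hi)
    rw [this]
  | succ d ih =>
    intro i hi h0
    let k : Fin m := ⟨i, by omega⟩
    have hk : k.castSucc = i := Fin.ext rfl
    refine Relation.ReflTransGen.head (b := (k.succ, x)) (Or.inl ⟨k, x, ?_, by rw [hk], rfl⟩)
      (ih k.succ (by simp [k]; omega) (by simp [k]))
    exact mem_layeredGrove_low h0 (hS _)

/-- A boundary vertex of the truncation can only be left along a selected edge. -/
lemma layeredGrove_fwd {b z : Vertex m ℤ} (hb : b ∉ (universalCover c).truncInterior S)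
    (h : Fwd (layeredGrove c S A) b z) : b.1 = 0 ∧ ∃ t, A b.2 t := by
  classical
  have key : ∀ (k : Fin m) x t, (k, x, t) ∈ layeredGrove c S A → b = (k.castSucc, x) →
      b.1 = 0 ∧ ∃ t, A b.2 t := by
    rintro k x t he rfl
    rw [layeredGrove, Finset.mem_filter] at he
    rcases he.2 with ⟨h0, h⟩ | ⟨h0, -, h⟩
    · exact ⟨Fin.ext h0, t, h⟩
    · exfalso
      apply hb
      rw [truncInterior_eq]
      refine ⟨h, fun h' => h0 (congrArg Fin.val h'), fun h' => ?_⟩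
      have h1 : (k : ℕ) = m := congrArg Fin.val h'
      omega
  rcases h with ⟨k, x, h, hb', -⟩ | ⟨k, x, h, hb', -⟩
  · exact key k x _ h hb'
  · exact key k x _ h hb'

lemma grounded_layeredGrove (v : Vertex m ℤ) (hv : v ∈ (universalCover c).truncInterior S) :
    ∃ b, b ∉ (universalCover c).truncInterior S ∧ Conn ends (layeredGrove c S A) v b := by
  obtain ⟨i, x⟩ := v
  obtain ⟨b, hb, h⟩ := layeredGrove_grounded (c := c) (S := S) (A := A) (m - i) i x (by omega)
    (fun h => (truncInterior_subset c S hv).1 (Fin.ext h))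
  exact ⟨b, hb, conn_of_fwd h⟩

variable (c S) in
lemma exists_good_eq : ∃ Γ ⊆ (universalCover c).truncEdges S,
    Good ends ((universalCover c).truncInterior S) Eq Γ := by
  have hdet := layeredGrove_det (c := c) (S := S) (A := fun _ _ => False) (fun _ h => h.elim)
  refine ⟨_, layeredGrove_subset (A := fun _ _ => False), forest_of_unique_fwd hdet,
    grounded_layeredGrove, fun b d hb hd => ⟨fun h => ?_, fun h => h ▸ Conn.refl _⟩⟩
  have hroot : ∀ b, b ∉ (universalCover c).truncInterior S →
      FwdRoot (layeredGrove c S fun _ _ => False) b b := fun b hb =>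
    ⟨Relation.ReflTransGen.refl, fun z hz => (layeredGrove_fwd hb hz).2.elim fun _ h => h⟩
  exact FwdRoot.unique hdet h (hroot b hb) (hroot d hd)

/-- A set of vertices containing all vertices in the columns from `-K - 1` to `K + 1`. -/
def Window (K : ℕ) (S : Finset (Vertex m ℤ)) : Prop :=
  ∀ v : Vertex m ℤ, -(K : ℤ) - 1 ≤ v.2 → v.2 ≤ K + 1 → v ∈ S

/-- The edges at the left vertices in an explicit grove with boundary partition `τ_K`. -/
def tauSelect (K : ℕ) (x : ℤ) (t : EdgeKind) : Prop :=
  (t = EdgeKind.low ∧ InRange K x ∧ x ≤ 0) ∨ (t = EdgeKind.high ∧ 2 ≤ x ∧ x ≤ K)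

lemma exists_good_tau [NeZero m] {K : ℕ} (hS : Window K S) :
    ∃ Γ ⊆ (universalCover c).truncEdges S,
      Good ends ((universalCover c).truncInterior S) (tau m K) Γ := by
  classical
  have hm : 0 < m := Nat.pos_of_ne_zero (NeZero.ne m)
  have hdet := layeredGrove_det (c := c) (S := S) (A := tauSelect K) (by
    rintro x (h | h) (h' | h')
    · exact EdgeKind.noConfusion h'.1
    · omega
    · exact EdgeKind.noConfusion h.1
    · exact EdgeKind.noConfusion h.1)
  refine ⟨_, layeredGrove_subset (A := tauSelect K), forest_of_unique_fwd hdet,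
    grounded_layeredGrove, fun b d hb hd => ?_⟩
  set Γ := layeredGrove c S (tauSelect K)
  have hlast : ∀ x : ℤ, (Fin.last m, x) ∉ (universalCover c).truncInterior S :=
    right_notMem (truncInterior_subset c S)
  have hsink : ∀ (x : ℤ) z, ¬ Fwd Γ (Fin.last m, x) z := fun x z hz =>
    last_ne_zero (layeredGrove_fwd (hlast x) hz).1
  -- the root of a boundary vertex
  have hroot : ∀ b, b ∉ (universalCover c).truncInterior S →
      (∃ r, InRange K r ∧ TauPart r b ∧ FwdRoot Γ b (Fin.last m, r)) ∨
      (FwdRoot Γ b b ∧ ∀ r, InRange K r → TauPart r b → b = (Fin.last m, r)) := by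
    rintro ⟨i, x⟩ hb
    by_cases hi : i = 0 ∧ ∃ t, tauSelect K x t
    · left
      obtain ⟨rfl, t, ht⟩ := hi
      let k : Fin m := ⟨0, hm⟩
      have hk : k.castSucc = 0 := rfl
      have hmem : (k, x, t) ∈ Γ := by
        rw [show Γ = layeredGrove c S (tauSelect K) from rfl, layeredGrove, Finset.mem_filter,
          mem_truncEdges_iff]
        refine ⟨⟨(0, x), hS _ ?_ ?_, ?_⟩, ?_⟩
        · simp only
          rcases ht with ⟨-, h | h, -⟩ | h <;> omega
        · simp only
          rcases ht with ⟨-, h | h, -⟩ | h <;> omega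
        · cases t <;> exact Sym2.mem_mk_left _ _
        · exact Or.inl ⟨rfl, ht⟩
      rcases ht with ⟨rfl, h, h'⟩ | ⟨rfl, h, h'⟩
      · refine ⟨x, h, Or.inr ⟨rfl, Or.inl ⟨h', rfl⟩⟩,
          Relation.ReflTransGen.head (Or.inl ⟨k, x, hmem, rfl, rfl⟩) ?_, hsink x⟩
        refine layeredGrove_column (fun i => hS _ ?_ ?_) (m - 1) k.succ
          (by simp only [Fin.val_succ, k]; omega) (by simp)
        · simp only
          rcases h with h | h <;> omega
        · simp only
          rcases h with h | h <;> omega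
      · refine ⟨x - 1, Or.inr (by omega), Or.inr ⟨rfl, Or.inr (by simp only; omega)⟩,
          Relation.ReflTransGen.head (Or.inr ⟨k, x, hmem, rfl, rfl⟩) ?_, hsink _⟩
        refine layeredGrove_column (fun i => hS _ ?_ ?_) (m - 1) k.succ
          (by simp only [Fin.val_succ, k]; omega) (by simp)
        · simp only
          omega
        · simp only
          omega
    · right
      refine ⟨⟨Relation.ReflTransGen.refl, fun z hz => hi (layeredGrove_fwd hb hz)⟩, ?_⟩
      rintro r hr (h | ⟨h, h'⟩)
      · exact h
      · exfalso
        refine hi ⟨h, ?_⟩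
        simp only at h'
        rcases h' with ⟨h1, rfl⟩ | ⟨h1, rfl⟩
        · exact ⟨EdgeKind.low, Or.inl ⟨rfl, hr, h1⟩⟩
        · refine ⟨EdgeKind.high, Or.inr ⟨rfl, ?_⟩⟩
          rcases hr with hr | hr <;> omega
  have hpart : ∀ r s, TauPart r ((Fin.last m, s) : Vertex m ℤ) → s = r := by
    rintro r s (h | ⟨h, -⟩)
    · exact congrArg Prod.snd h
    · exact absurd h last_ne_zero
  rw [tau_iff]
  constructor
  · intro h
    rcases hroot b hb with ⟨r, hr, hrb, h1⟩ | ⟨h1, h1'⟩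
    · rcases hroot d hd with ⟨s, hs, hsd, h2⟩ | ⟨h2, h2'⟩
      · have := congrArg Prod.snd (FwdRoot.unique hdet h h1 h2)
        simp only at this
        subst this
        exact Or.inr ⟨r, hr, hrb, hsd⟩
      · have := FwdRoot.unique hdet h h1 h2
        exact Or.inr ⟨r, hr, hrb, Or.inl this.symm⟩
    · rcases hroot d hd with ⟨s, hs, hsd, h2⟩ | ⟨h2, h2'⟩
      · have := FwdRoot.unique hdet h h1 h2
        exact Or.inr ⟨s, hs, Or.inl this, hsd⟩
      · exact Or.inl (FwdRoot.unique hdet h h1 h2)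
  · rintro (rfl | ⟨r, hr, hrb, hrd⟩)
    · exact Conn.refl _
    · have key : ∀ b, b ∉ (universalCover c).truncInterior S → TauPart r b →
          Conn ends Γ b (Fin.last m, r) := by
        intro b hb hrb
        rcases hroot b hb with ⟨s, hs, hsb, h1⟩ | ⟨-, h1⟩
        · have hsr : s = r := by
            rcases hsb with rfl | ⟨h2, h2'⟩
            · exact hpart _ _ hrb
            · rcases hrb with rfl | ⟨h3, h3'⟩
              · exact absurd h2 last_ne_zero
              · omega
          exact hsr ▸ conn_of_fwd h1.1
        · rw [h1 r hr hrb]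
          exact Conn.refl _
      exact (key b hb hrb).trans (key d hd hrd).symm

end NNetwork

/-! ### The structure of groves with boundary partition `σ_K` far from the ends -/

namespace NNetwork

open EdgeSet

variable {m : ℕ} {Γ : Finset (Edge m ℤ)}

/-- A component meets every layer between two layers which it meets. -/
lemma exists_conn_layer {u v : Vertex m ℤ} (h : Conn ends Γ u v) :
    ∀ i : Fin (m + 1), u.1 ≤ i → i ≤ v.1 → ∃ x, Conn ends Γ u (i, x) := by
  induction h with
  | refl =>
    intro i h1 h2
    obtain rfl : i = u.1 := le_antisymm h2 h1
    exact ⟨u.2, Conn.refl _⟩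
  | @tail y z huy h ih =>
    intro i h1 h2
    by_cases hiy : i ≤ y.1
    · exact ih i h1 hiy
    · have := linked_stripAdj h
      unfold StripAdj Step at this
      have h3 : i = z.1 := by
        rw [Fin.le_def] at h2 hiy
        exact Fin.ext (by omega)
      exact ⟨z.2, h3 ▸ huy.tail h⟩

/-- A component which meets both sides of the gap between two layers uses an edge in this gap. -/
lemma exists_edge_across {u v : Vertex m ℤ} (h : Conn ends Γ u v) (k : Fin m)
    (hu : (u.1 : ℕ) ≤ k) (hv : (k : ℕ) < v.1) :
    ∃ x, Conn ends Γ u (k.castSucc, x) ∧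
      (((k, x, EdgeKind.low) ∈ Γ ∧ Conn ends Γ u (k.succ, x)) ∨
        ((k, x, EdgeKind.high) ∈ Γ ∧ Conn ends Γ u (k.succ, x - 1))) := by
  obtain ⟨s, t, hs, hst, hs1, ht1⟩ :=
    exists_first_hit (r := Linked ends Γ) (fun _ _ h => linked_stripAdj h) h k hu hv
  have hus : Conn ends Γ u s := Relation.ReflTransGen.mono (fun _ _ h => h.1) _ _ hs
  have hut : Conn ends Γ u t := hus.tail hst
  rcases linked_cases hst with ⟨l, x, he, ⟨rfl, rfl⟩ | ⟨rfl, rfl⟩⟩ |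
    ⟨l, x, he, ⟨rfl, rfl⟩ | ⟨rfl, rfl⟩⟩
  · have hl : l = k := Fin.ext (by simpa using ht1)
    subst hl
    exact ⟨x, hus, Or.inl ⟨he, hut⟩⟩
  · simp at hs1 ht1
    omega
  · have hl : l = k := Fin.ext (by simpa using ht1)
    subst hl
    exact ⟨x, hus, Or.inr ⟨he, hut⟩⟩
  · simp at hs1 ht1
    omega

lemma castSucc_zero' [NeZero m] : (0 : Fin m).castSucc = (0 : Fin (m + 1)) := Fin.ext rfl

lemma linked_left [NeZero m] {x : ℤ} {w : Vertex m ℤ} (h : Linked ends Γ (0, x) w) :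
    ((0, x, EdgeKind.low) ∈ Γ ∧ w = ((0 : Fin m).succ, x)) ∨
      ((0, x, EdgeKind.high) ∈ Γ ∧ w = ((0 : Fin m).succ, x - 1)) := by
  rcases linked_cases h with ⟨l, y, he, ⟨h1, h2⟩ | ⟨h1, h2⟩⟩ | ⟨l, y, he, ⟨h1, h2⟩ | ⟨h1, h2⟩⟩
  · rw [Prod.mk.injEq] at h1
    obtain rfl : (0 : Fin m) = l := Fin.castSucc_injective _ (castSucc_zero'.trans h1.1)
    rw [h1.2]
    exact Or.inl ⟨he, h2⟩
  · have := congrArg (fun v => (v.1 : ℕ)) h2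
    simp at this
  · rw [Prod.mk.injEq] at h1
    obtain rfl : (0 : Fin m) = l := Fin.castSucc_injective _ (castSucc_zero'.trans h1.1)
    rw [h1.2]
    exact Or.inr ⟨he, h2⟩
  · have := congrArg (fun v => (v.1 : ℕ)) h2
    simp at this

/-- The left vertex of a component which crosses the strip without passing below its row is attached
by its low edge only. -/
lemma low_mem_high_notMem [NeZero m] {x : ℤ} (h : Conn ends Γ (0, x) (Fin.last m, x))
    (hb : ∀ v, Conn ends Γ (Fin.last m, x) v → x ≤ v.2) :
    ((0, x, EdgeKind.low) : Edge m ℤ) ∈ Γ ∧ ((0, x, EdgeKind.high) : Edge m ℤ) ∉ Γ := by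
  have h2 : ((0, x, EdgeKind.high) : Edge m ℤ) ∉ Γ := by
    intro he
    have h3 := conn_high he
    rw [castSucc_zero'] at h3
    have := hb _ (h.symm.trans h3)
    simp only at this
    omega
  refine ⟨?_, h2⟩
  obtain ⟨e, he, u, hu, -⟩ := h.exists_first
    (fun h => last_ne_zero (congrArg Prod.fst h).symm)
  rcases linked_left ⟨e, he, hu⟩ with h3 | h3
  · exact h3.1
  · exact absurd h3.1 h2

open Classical in
/-- The layers in which the component of the left vertex `x` meets the row `x - 1`. -/
def descended (Γ : Finset (Edge m ℤ)) (x : ℤ) : Finset (Fin (m + 1)) :=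
  Finset.univ.filter fun i => Conn ends Γ (0, x) (i, x - 1)

lemma mem_descended {x : ℤ} {i : Fin (m + 1)} :
    i ∈ descended Γ x ↔ Conn ends Γ (0, x) (i, x - 1) := by
  classical
  simp [descended]

variable [NeZero m] {I : Set (Vertex m ℤ)} {K : ℕ}

section

variable (hI : I ⊆ stripInterior m) (hg : Good ends I (sigma m K) Γ)
include hI hg

lemma sigma_conn_left_right {x r : ℤ} (hr : InRange K r)
    (h : r ≤ 0 ∧ x = r ∨ 0 ≤ r ∧ x = r + 1) : Conn ends Γ (0, x) (Fin.last m, r) :=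
  (hg.type _ _ (left_notMem hI _) (right_notMem hI _)).mpr (sigma_left_right hr h)

lemma sigma_not_conn {x y : ℤ} (hne : x ≠ y) (hx : x ≠ 0 ∨ y ≠ 1) (hy : x ≠ 1 ∨ y ≠ 0)
    {v : Vertex m ℤ} (h : Conn ends Γ (0, x) v) : ¬ Conn ends Γ (0, y) v := fun h' => by
  have := sigma_left_left
    ((hg.type _ _ (left_notMem hI _) (left_notMem hI _)).mp (h.trans h'.symm)) hne
  omega

lemma sigma_low_mem {x : ℤ} (hx : -K + m ≤ x) (hx0 : x ≤ 0) (hK : 1 ≤ K) :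
    ((0, x, EdgeKind.low) : Edge m ℤ) ∈ Γ ∧ ((0, x, EdgeKind.high) : Edge m ℤ) ∉ Γ :=
  low_mem_high_notMem (sigma_conn_left_right hI hg (Or.inr (by omega)) (by omega))
    fun _ hv => sigma_confined_below hI hg (by omega) hv

/-- Far enough from the row `0` the components of the left vertices with negative index are the rows
of vertices with this index. -/
lemma sigma_column {x : ℤ} (hx : -K + m ≤ x) (hx0 : x + m < 0) (i : Fin (m + 1)) :
    Conn ends Γ (0, x) (i, x) := by
  have hc := sigma_conn_left_right (x := x) (r := x) hI hg (Or.inr (by omega)) (by omega)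
  obtain ⟨y, hy⟩ := exists_conn_layer hc i (Fin.zero_le _) (Fin.le_last _)
  have h1 := sigma_confined_above hI hg (by omega) hy
  have h2 := sigma_confined_below hI hg (by omega) (hc.symm.trans hy)
  simp only at h1 h2
  obtain rfl : y = x := by omega
  exact hy

lemma sigma_high_notMem {x : ℤ} (hx : -K + m ≤ x - 1) (hx0 : x + m < 0) (i : Fin m) :
    (i, x, EdgeKind.high) ∉ Γ := fun he =>
  sigma_not_conn hI hg (x := x - 1) (y := x) (by omega) (by omega) (by omega)
    (sigma_column hI hg (x := x - 1) (by omega) (by omega) i.succ)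
    ((sigma_column hI hg (x := x) (by omega) (by omega) i.castSucc).trans (conn_high he))

end

section

variable (hI : I ⊆ stripInterior m) (hg : Good ends I (sigma m K) Γ)
include hI hg

/-- Above the row `0` a component with left vertex `x` and right vertex `x - 1` stays in the rows
`x` and `x - 1`, if it is far from the upper end of the range. -/
lemma sigma_two_rows {x : ℤ} (hx : 2 ≤ x) (hx' : x + m ≤ K) {v : Vertex m ℤ}
    (h : Conn ends Γ (0, x) v) : v.2 = x ∨ v.2 = x - 1 := by
  have hc := sigma_conn_left_right (x := x) (r := x - 1) hI hg (Or.inr (by omega)) (by omega)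
  have h1 := sigma_confined_above hI hg (by omega) h
  have h2 := sigma_confined_below hI hg (by omega) (hc.symm.trans h)
  omega

lemma conn_or_descended {x : ℤ} (hx : 2 ≤ x) (hx' : x + m ≤ K) (i : Fin (m + 1)) :
    Conn ends Γ (0, x) (i, x) ∨ i ∈ descended Γ x := by
  have hc := sigma_conn_left_right (x := x) (r := x - 1) hI hg (Or.inr (by omega)) (by omega)
  obtain ⟨y, hy⟩ := exists_conn_layer hc i (Fin.zero_le _) (Fin.le_last _)
  rcases sigma_two_rows hI hg hx hx' hy with h | h
  · simp only at h
    exact Or.inl (h ▸ hy)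
  · simp only at h
    exact Or.inr (mem_descended.mpr (h ▸ hy))

lemma not_descended_succ {x : ℤ} (hx : 2 ≤ x) {i : Fin (m + 1)}
    (h : Conn ends Γ (0, x) (i, x)) : i ∉ descended Γ (x + 1) := by
  rw [mem_descended, add_sub_cancel_right]
  exact sigma_not_conn hI hg (by omega) (by omega) (by omega) h

lemma descended_succ_subset {x : ℤ} (hx : 2 ≤ x) (hx' : x + m ≤ K) :
    descended Γ (x + 1) ⊆ descended Γ x := fun i hi => by
  rcases conn_or_descended hI hg hx hx' i with h | h
  · exact absurd hi (not_descended_succ hI hg hx h)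
  · exact h

lemma descended_antitone {x y : ℤ} (hx : 2 ≤ x) (hxy : x ≤ y) (hy : y + m ≤ K) :
    descended Γ y ⊆ descended Γ x := by
  obtain ⟨d, rfl⟩ := Int.le.dest hxy
  clear hxy
  induction d with
  | zero => simp
  | succ d ih =>
    push_cast at hy ⊢
    rw [← add_assoc]
    exact (descended_succ_subset hI hg (by omega) (by omega)).trans (ih (by omega))

lemma last_mem_descended {x : ℤ} (hx : 2 ≤ x) (hx' : x ≤ K) : Fin.last m ∈ descended Γ x :=
  mem_descended.mpr (sigma_conn_left_right hI hg (Or.inr (by omega)) (by omega))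

lemma zero_notMem_descended {x : ℤ} (hx : 2 ≤ x) : (0 : Fin (m + 1)) ∉ descended Γ x := fun h =>
  sigma_not_conn hI hg (x := x) (y := x - 1) (by omega) (by omega) (by omega)
    (mem_descended.mp h) (Conn.refl _)

/-- Among `m` consecutive blocks of length `L` there is one along which the sets of layers in which
the components have descended are constant, since these sets decrease. -/
lemma exists_constant_block (L : ℕ) (hK : 2 + m * L + m ≤ K) :
    ∃ b < m, descended Γ (2 + b * L) = descended Γ (2 + (b + 1 : ℕ) * L) := by
  by_contra! hne
  have key : ∀ b ≤ m, (descended Γ (2 + b * L)).card + b ≤ m := by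
    intro b
    induction b with
    | zero =>
      intro _
      have h0 := zero_notMem_descended hI hg (x := 2 + (0 : ℕ) * L) (by simp)
      have := Finset.card_lt_univ_of_notMem h0
      simp at this ⊢
      omega
    | succ b ih =>
      intro hb
      have h1 := ih (by omega)
      have hle : (b + 1) * L ≤ m * L := Nat.mul_le_mul_right _ hb
      have hle' : ((b + 1 : ℕ) : ℤ) * L ≤ m * L := by exact_mod_cast hle
      have h2 : descended Γ (2 + (b + 1 : ℕ) * L) ⊂ descended Γ (2 + b * L) := by
        refine (descended_antitone hI hg ?_ ?_ ?_).ssubset_of_ne (hne b (by omega)).symm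
        · have : (0 : ℤ) ≤ b * L := by positivity
          omega
        · push_cast
          have : (0 : ℤ) ≤ L := by positivity
          nlinarith
        · have : (2 : ℤ) + m * L + m ≤ K := by exact_mod_cast hK
          omega
      have := Finset.card_lt_card h2
      omega
  have h1 := key m le_rfl
  have h2 : Fin.last m ∈ descended Γ (2 + m * L) := by
    refine last_mem_descended hI hg ?_ ?_
    · have : (0 : ℤ) ≤ m * L := by positivity
      omega
    · have : (2 : ℤ) + m * L + m ≤ K := by exact_mod_cast hK
      omega
  have := Finset.card_pos.mpr ⟨_, h2⟩
  omega

end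

/-- In the rows from `p` to `q` the edges of `Γ` are those of parallel paths which move along low
edges except for one high edge after the layer `j`. -/
def Clean (Γ : Finset (Edge m ℤ)) (p q : ℤ) (j : Fin m) : Prop :=
  ∀ x, p ≤ x → x ≤ q → ∀ i : Fin m,
    ((i, x, EdgeKind.low) ∈ Γ ↔ i ≠ j) ∧ ((i, x, EdgeKind.high) ∈ Γ ↔ i = j)

/-- If the components of `p` and of `q + 2` have descended in the same layers, then all components
in between descend along a high edge after the same layer. -/
lemma exists_clean (hI : I ⊆ stripInterior m) (hg : Good ends I (sigma m K) Γ) {p q : ℤ}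
    (hp : 2 ≤ p) (hq : q + 2 + m ≤ K) (hpq : p ≤ q)
    (h : descended Γ p = descended Γ (q + 2)) : ∃ j, Clean Γ p q j := by
  set B := descended Γ p with hB
  have hconst : ∀ x, p ≤ x → x ≤ q + 2 → descended Γ x = B := fun x h1 h2 =>
    subset_antisymm (descended_antitone hI hg hp h1 (by omega))
      (h ▸ descended_antitone hI hg (by omega) h2 (by omega))
  have hmem : ∀ x, p ≤ x → x ≤ q + 2 → ∀ i, Conn ends Γ (0, x) (i, x - 1) ↔ i ∈ B :=
    fun x h1 h2 i => by rw [← mem_descended, hconst x h1 h2]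
  have hnmem : ∀ x, p ≤ x → x ≤ q + 1 → ∀ i, Conn ends Γ (0, x) (i, x) ↔ i ∉ B := by
    intro x h1 h2 i
    constructor
    · intro h3
      rw [← hconst (x + 1) (by omega) (by omega)]
      exact not_descended_succ hI hg (by omega) h3
    · intro h3
      rcases conn_or_descended hI hg (x := x) (by omega) (by omega) i with h4 | h4
      · exact h4
      · rw [hconst x h1 (by omega)] at h4
        exact absurd h4 h3
  -- how the component of `x` passes from the layer `i` to the next one
  have hacross : ∀ x, p ≤ x → x ≤ q + 1 → ∀ i : Fin m,
      (i.castSucc ∉ B ∧ i.succ ∉ B ∧ (i, x, EdgeKind.low) ∈ Γ) ∨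
      (i.castSucc ∉ B ∧ i.succ ∈ B ∧ (i, x, EdgeKind.high) ∈ Γ) ∨
      (i.castSucc ∈ B ∧ i.succ ∈ B ∧ (i, x - 1, EdgeKind.low) ∈ Γ) := by
    intro x h1 h2 i
    have hc := sigma_conn_left_right (x := x) (r := x - 1) hI hg (Or.inr (by omega)) (by omega)
    obtain ⟨y, hy, ⟨he, hy'⟩ | ⟨he, hy'⟩⟩ := exists_edge_across hc i (by simp) (by simp)
    · rcases sigma_two_rows hI hg (by omega) (by omega) hy with h | h
      · simp only at h
        subst h
        exact Or.inl ⟨(hnmem y h1 h2 _).mp hy, (hnmem y h1 h2 _).mp hy', he⟩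
      · simp only at h
        subst h
        exact Or.inr (Or.inr
          ⟨(hmem x h1 (by omega) _).mp hy, (hmem x h1 (by omega) _).mp hy', he⟩)
    · have h4 := sigma_two_rows hI hg (by omega) (by omega) hy'
      rcases sigma_two_rows hI hg (by omega) (by omega) hy with h | h
      · simp only at h
        subst h
        exact Or.inr (Or.inl ⟨(hnmem y h1 h2 _).mp hy, (hmem y h1 (by omega) _).mp hy', he⟩)
      · simp only at h h4
        omega
  -- `j` is the gap at which the layers enter the upper set `B`
  have hB0 : (0 : Fin (m + 1)) ∉ B := zero_notMem_descended hI hg hp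
  have hBm : Fin.last m ∈ B := last_mem_descended hI hg hp (by omega)
  obtain ⟨j, hj1, hj2⟩ : ∃ j : Fin m, j.castSucc ∉ B ∧ j.succ ∈ B := by
    by_contra! hcon
    have : ∀ i : Fin (m + 1), i ∉ B := by
      intro i
      induction i using Fin.induction with
      | zero => exact hB0
      | succ i ih => exact hcon i ih
    exact this _ hBm
  have hup : ∀ i : Fin m, i.castSucc ∈ B → i.succ ∈ B := by
    intro i hi
    rcases hacross p le_rfl (by omega) i with h | h | h
    · exact absurd hi h.1
    · exact h.2.1
    · exact h.2.1
  have hge : ∀ i : Fin (m + 1), j.succ ≤ i → i ∈ B := by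
    intro i
    induction i using Fin.induction with
    | zero =>
      intro h
      exact absurd h (by simp)
    | succ i ih =>
      intro h
      rcases eq_or_lt_of_le h with h | h
      · exact h ▸ hj2
      · refine hup i (ih ?_)
        simp only [Fin.lt_def, Fin.le_def, Fin.val_succ, Fin.val_castSucc] at h ⊢
        omega
  have hiff : ∀ i : Fin (m + 1), i ∈ B ↔ (j : ℕ) < i := by
    intro i
    refine ⟨fun hi => ?_, fun hi => hge i (by simp only [Fin.le_def, Fin.val_succ]; omega)⟩
    by_contra! hij
    have : ∀ i : Fin (m + 1), i ∈ B → ∀ l : Fin (m + 1), i ≤ l → l ∈ B := by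
      intro i hi l
      induction l using Fin.induction with
      | zero =>
        intro h
        obtain rfl : i = 0 := le_antisymm h (Fin.zero_le _)
        exact hi
      | succ l ih =>
        intro h
        rcases eq_or_lt_of_le h with h | h
        · exact h ▸ hi
        · refine hup l (ih ?_)
          simp only [Fin.lt_def, Fin.le_def, Fin.val_succ, Fin.val_castSucc] at h ⊢
          omega
    exact hj1 (this i hi j.castSucc (by simpa [Fin.le_def] using hij))
  refine ⟨j, fun x h1 h2 i => ?_⟩
  have hx := hacross x h1 (by omega) i
  have hx1 := hacross (x + 1) (by omega) (by omega) i
  rw [add_sub_cancel_right] at hx1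
  simp only [hiff, Fin.val_castSucc, Fin.val_succ] at hx hx1
  have hT := hnmem x h1 (by omega)
  have hT' := hmem x h1 (by omega)
  refine ⟨⟨?_, fun hij => ?_⟩, ⟨fun he => ?_, ?_⟩⟩
  · rintro he rfl
    have h3 : Conn ends Γ (0, x) (i.castSucc, x) := (hT _).mpr (by rw [hiff]; simp)
    have h4 := (hT _).mp (h3.trans (conn_low he))
    rw [hiff] at h4
    simp at h4
  · have : (i : ℕ) ≠ j := fun h => hij (Fin.ext h)
    rcases Nat.lt_or_gt_of_ne this with h3 | h3
    · rcases hx with hx | hx | hx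
      · exact hx.2.2
      · omega
      · omega
    · rcases hx1 with hx | hx | hx
      · omega
      · omega
      · exact hx.2.2
  · by_contra hij
    have : (i : ℕ) ≠ j := fun h => hij (Fin.ext h)
    rcases Nat.lt_or_gt_of_ne this with h3 | h3
    · have h4 : Conn ends Γ (0, x) (i.castSucc, x) :=
        (hT _).mpr (by rw [hiff]; simp only [Fin.val_castSucc]; omega)
      have h5 := (hT' _).mp (h4.trans (conn_high he))
      rw [hiff] at h5
      simp only [Fin.val_succ] at h5
      omega
    · have h4 : Conn ends Γ (0, x) (i.succ, x - 1) :=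
        (hT' _).mpr (by rw [hiff]; simp only [Fin.val_succ]; omega)
      have h5 := (hT _).mp (h4.trans (conn_high he).symm)
      rw [hiff] at h5
      simp only [Fin.val_castSucc] at h5
      omega
  · rintro rfl
    rcases hx with hx | hx | hx
    · omega
    · exact hx.2.2
    · omega

end NNetwork

/-! ### Inserting rows into a grove -/

namespace NNetwork

open EdgeSet

variable {m : ℕ} {F Γ : Finset (Edge m ℤ)} {p T : ℤ} {j : Fin m}

/-- The index at which new edges are inserted in the gap after the layer `i`: between the left
vertices `0` and `1` in the first gap, and between the rows `-(m + 2)` and `-(m + 1)` in the others.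
The new high edges in the first gap join the left vertex `k + 1` to the row `k`; thereby the rows
from `-(m + 1)` to `-1`, which move up by `T`, become attached to the left vertices `T - m, …, T`,
and new rows to their former left vertices. -/
def cut (i : Fin m) : ℤ := if (i : ℕ) = 0 then 1 else -((m : ℤ) + 1)

/-- The edge `e` belongs to the edge set obtained from `Γ` by inserting, in each gap between two
layers, `T` new edges at the cut: high ones in the first gap and low ones in the other gaps. The
edges of `Γ` up to `p` are moved up by `T`, and those from `p + 1` to `p + T` are deleted. -/
def InsertMem (Γ : Finset (Edge m ℤ)) (p T : ℤ) (e : Edge m ℤ) : Prop :=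
  if e.2.1 < cut e.1 then e ∈ Γ
  else if e.2.1 < cut e.1 + T then ((e.1 : ℕ) = 0 ↔ e.2.2 = EdgeKind.high)
  else if e.2.1 ≤ p + T then (e.1, e.2.1 - T, e.2.2) ∈ Γ
  else e ∈ Γ

open Classical in
/-- The edge set obtained from `Γ` by inserting `T` new rows. -/
def insertRows (F Γ : Finset (Edge m ℤ)) (p T : ℤ) : Finset (Edge m ℤ) :=
  F.filter (InsertMem Γ p T)

/-- The conditions under which `T` new rows can be inserted into `Γ`, and `T` rows above the row `p`
deleted, without changing the boundary partition. -/
structure Insertable [NeZero m] (F Γ : Finset (Edge m ℤ)) (p T : ℤ) (j : Fin m) : Prop where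
  subset : Γ ⊆ F
  clean : Clean Γ p (p + T + 1) j
  /-- The rows from `-(m + 1)` on are separated from the rows below. -/
  high_notMem : ∀ i, (i, -((m : ℤ) + 1), EdgeKind.high) ∉ Γ
  /-- The left vertices next to the cut are attached by their low edges only. -/
  left : ∀ x, -((m : ℤ) + 1) ≤ x → x ≤ 0 →
    ((0, x, EdgeKind.low) : Edge m ℤ) ∈ Γ ∧ ((0, x, EdgeKind.high) : Edge m ℤ) ∉ Γ
  two_le : 2 ≤ p
  le_shift : (m : ℤ) + 2 ≤ T
  /-- All edges which may be inserted are available. -/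
  window : ∀ e : Edge m ℤ, -((m : ℤ) + 1) ≤ e.2.1 → e.2.1 ≤ p + T → e ∈ F

lemma cut_zero [NeZero m] : cut (0 : Fin m) = 1 := rfl

lemma cut_of_ne {i : Fin m} (h : (i : ℕ) ≠ 0) : cut i = -((m : ℤ) + 1) := if_neg h

lemma cut_bounds (i : Fin m) : -((m : ℤ) + 1) ≤ cut i ∧ cut i ≤ 1 := by
  unfold cut
  split_ifs <;> omega

namespace Insertable

variable [NeZero m] (h : Insertable F Γ p T j)
include h

lemma mem_iff {e : Edge m ℤ} : e ∈ insertRows F Γ p T ↔ InsertMem Γ p T e := by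
  classical
  rw [insertRows, Finset.mem_filter, and_iff_right_iff_imp]
  intro he
  have h1 := cut_bounds e.1
  have h2 := h.two_le
  have h3 := h.le_shift
  unfold InsertMem at he
  split_ifs at he
  · exact h.subset he
  · exact h.window e (by omega) (by omega)
  · exact h.window e (by omega) (by omega)
  · exact h.subset he

variable {i : Fin m} {x : ℤ} {t : EdgeKind}

lemma mem_of_lt_cut (hx : x < cut i) : (i, x, t) ∈ insertRows F Γ p T ↔ (i, x, t) ∈ Γ := by
  rw [h.mem_iff, InsertMem, if_pos hx]

lemma mem_new (hx : cut i ≤ x) (hx' : x < cut i + T) :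
    (i, x, t) ∈ insertRows F Γ p T ↔ ((i : ℕ) = 0 ↔ t = EdgeKind.high) := by
  rw [h.mem_iff, InsertMem, if_neg (by simpa using hx), if_pos hx']

lemma mem_shift (hx : cut i ≤ x) (hx' : x ≤ p) :
    (i, x + T, t) ∈ insertRows F Γ p T ↔ (i, x, t) ∈ Γ := by
  have := h.le_shift
  rw [h.mem_iff, InsertMem, if_neg (by simp only; omega), if_neg (by simp only; omega),
    if_pos (by simp only; omega), add_sub_cancel_right]

lemma mem_of_lt (hx : p + T < x) : (i, x, t) ∈ insertRows F Γ p T ↔ (i, x, t) ∈ Γ := by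
  have := h.le_shift
  have := h.two_le
  have := cut_bounds i
  rw [h.mem_iff, InsertMem, if_neg (by simp only; omega), if_neg (by simp only; omega),
    if_neg (by simp only; omega)]

end Insertable

/-- The row of a vertex, for rows which descend by one after the layer `j`. -/
def row (j : Fin m) (v : Vertex m ℤ) : ℤ := if (v.1 : ℕ) ≤ j then v.2 else v.2 + 1

/-- A map which sends the ends of an edge of `Γ` to vertices which are joined after the insertion of
`T` rows. The deleted rows are all mapped to the same vertex, and so are the ends of the edge
which joins the left vertex `0` to the next layer. -/
def transport [NeZero m] (p T : ℤ) (j : Fin m) (v : Vertex m ℤ) : Vertex m ℤ :=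
  if v.2 < -((m : ℤ) + 1) then v
  else if row j v ≤ p then
    if (v.1 : ℕ) = 0 then
      if v.2 < 0 then (0, v.2 + 1 + T) else if v.2 = 0 then ((0 : Fin m).succ, T) else (0, v.2 + T)
    else (v.1, v.2 + T)
  else if row j v ≤ p + T then (0, 0)
  else v

lemma row_bounds (v : Vertex m ℤ) : v.2 ≤ row j v ∧ row j v ≤ v.2 + 1 := by
  unfold row
  split_ifs <;> omega

lemma row_zero (x : ℤ) : row j ((0, x) : Vertex m ℤ) = x := by simp [row]

lemma row_last (x : ℤ) : row j ((Fin.last m, x) : Vertex m ℤ) = x + 1 := by simp [row]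

section transport

variable [NeZero m] {i : Fin (m + 1)} {x : ℤ} {v : Vertex m ℤ}

lemma transport_below (h : v.2 < -((m : ℤ) + 1)) : transport p T j v = v := if_pos h

lemma transport_shift (hi : (i : ℕ) ≠ 0) (h : -((m : ℤ) + 1) ≤ x) (h' : row j (i, x) ≤ p) :
    transport p T j (i, x) = (i, x + T) := by
  rw [transport, if_neg (by simp only; omega), if_pos h', if_neg hi]

lemma transport_neg (hp : 0 ≤ p) (h : -((m : ℤ) + 1) ≤ x) (h' : x < 0) :
    transport p T j (0, x) = (0, x + 1 + T) := by
  rw [transport, if_neg (by simp only; omega), if_pos (by rw [row_zero]; omega),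
    if_pos (by simp), if_pos h']

lemma transport_zero (hp : 0 ≤ p) : transport p T j (0, 0) = ((0 : Fin m).succ, T) := by
  rw [transport, if_neg (by simp only; omega), if_pos (by rw [row_zero]; omega),
    if_pos (by simp), if_neg (by simp), if_pos rfl]

lemma transport_pos (h : 0 < x) (h' : x ≤ p) : transport p T j (0, x) = (0, x + T) := by
  rw [transport, if_neg (by simp only; omega), if_pos (by rw [row_zero]; omega),
    if_pos (by simp), if_neg (by simp only; omega), if_neg (by simp only; omega)]

lemma transport_deleted (hp : 0 ≤ p) (h : p < row j v) (h' : row j v ≤ p + T) :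
    transport p T j v = (0, 0) := by
  have := row_bounds (j := j) v
  rw [transport, if_neg (by omega), if_neg (by omega), if_pos h']

lemma transport_above (hp : 0 ≤ p) (hT : 0 ≤ T) (h : p + T < row j v) :
    transport p T j v = v := by
  have := row_bounds (j := j) v
  rw [transport, if_neg (by omega), if_neg (by omega), if_neg (by omega)]

end transport

namespace Insertable

variable [NeZero m] (h : Insertable F Γ p T j)
include h

lemma conn_transport_low {i : Fin m} {x : ℤ} (he : (i, x, EdgeKind.low) ∈ Γ) :
    Conn ends (insertRows F Γ p T) (transport p T j (i.castSucc, x))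
      (transport p T j (i.succ, x)) := by
  have hp := h.two_le
  have hT := h.le_shift
  by_cases h1 : x < -((m : ℤ) + 1)
  · rw [transport_below h1, transport_below h1]
    have := cut_bounds i
    exact conn_low ((h.mem_of_lt_cut (by omega)).mpr he)
  have hrow : row j (i.castSucc, x) ≤ row j (i.succ, x) := by
    simp only [row, Fin.val_castSucc, Fin.val_succ]
    split_ifs <;> omega
  have hb := row_bounds (j := j) (i.succ, x)
  simp only at hb
  by_cases h2 : row j (i.succ, x) ≤ p
  · rw [transport_shift (i := i.succ) (by simp) (by omega) h2]
    by_cases hi : (i : ℕ) = 0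
    · obtain rfl : i = 0 := Fin.ext hi
      rw [castSucc_zero']
      rcases lt_trichotomy x 0 with h3 | rfl | h3
      · rw [transport_neg (by omega) (by omega) h3]
        have := conn_high ((h.mem_new (i := 0) (x := x + 1 + T) (t := EdgeKind.high)
          (by rw [cut_zero]; omega) (by rw [cut_zero]; omega)).mpr (by simp))
        rwa [castSucc_zero', show x + 1 + T - 1 = x + T by ring] at this
      · rw [transport_zero (by omega), zero_add]
        exact Conn.refl _
      · rw [transport_pos h3 (by omega)]
        exact conn_low ((h.mem_shift (by rw [cut_zero]; omega) (by omega)).mpr he)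
    · rw [transport_shift (i := i.castSucc) (by simpa using hi) (by omega) (by omega)]
      exact conn_low ((h.mem_shift (by rw [cut_of_ne hi]; omega) (by omega)).mpr he)
  · have hrow' : x ≤ p + T + 1 → row j (i.castSucc, x) = row j (i.succ, x) := by
      intro h3
      have h4 : (i : ℕ) ≠ j := fun h5 => ((h.clean x (by omega) h3 i).1.mp he) (Fin.ext h5)
      simp only [row, Fin.val_castSucc, Fin.val_succ]
      split_ifs <;> omega
    have hb' := row_bounds (j := j) (i.castSucc, x)
    simp only at hb'
    by_cases h3 : row j (i.succ, x) ≤ p + T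
    · have := hrow' (by omega)
      rw [transport_deleted (by omega) (by omega) h3,
        transport_deleted (v := (i.castSucc, x)) (by omega) (by omega) (by omega)]
      exact Conn.refl _
    · have h4 : p + T < row j (i.castSucc, x) := by
        by_cases h5 : x ≤ p + T + 1
        · have := hrow' h5
          omega
        · omega
      rw [transport_above (v := (i.succ, x)) (by omega) (by omega) (by omega),
        transport_above (v := (i.castSucc, x)) (by omega) (by omega) (by omega)]
      refine conn_low ?_
      by_cases h5 : p + T < x
      · exact (h.mem_of_lt h5).mpr he
      · obtain rfl : x = p + T := by omega
        have := cut_bounds i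
        rw [h.mem_shift (by omega) le_rfl, (h.clean p le_rfl (by omega) i).1]
        exact (h.clean (p + T) (by omega) (by omega) i).1.mp he

lemma conn_transport_high {i : Fin m} {x : ℤ} (he : (i, x, EdgeKind.high) ∈ Γ) :
    Conn ends (insertRows F Γ p T) (transport p T j (i.castSucc, x))
      (transport p T j (i.succ, x - 1)) := by
  have hp := h.two_le
  have hT := h.le_shift
  have hcut := cut_bounds i
  have h0 : x ≠ -((m : ℤ) + 1) := by
    rintro rfl
    exact h.high_notMem i he
  by_cases h1 : x < -((m : ℤ) + 1)
  · rw [transport_below h1, transport_below (by simp only; omega)]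
    exact conn_high ((h.mem_of_lt_cut (by omega)).mpr he)
  have hb := row_bounds (j := j) (i.succ, x - 1)
  have hb' := row_bounds (j := j) (i.castSucc, x)
  simp only at hb hb'
  by_cases h2 : row j (i.succ, x - 1) ≤ p ∧ row j (i.castSucc, x) ≤ p
  · rw [transport_shift (i := i.succ) (by simp) (by omega) h2.1]
    have key : ∀ {y}, (i, y, EdgeKind.high) ∈ insertRows F Γ p T → y = x + T →
        Conn ends (insertRows F Γ p T) (i.castSucc, x + T) (i.succ, x - 1 + T) := by
      rintro y hy rfl
      have := conn_high hy
      rwa [show x + T - 1 = x - 1 + T by ring] at this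
    by_cases hi : (i : ℕ) = 0
    · obtain rfl : i = 0 := Fin.ext hi
      have h3 : 0 < x := by
        by_contra! h3
        exact (h.left x (by omega) h3).2 he
      rw [castSucc_zero', transport_pos h3 (by omega)]
      exact key ((h.mem_shift (by rw [cut_zero]; omega) (by omega)).mpr he) rfl
    · rw [transport_shift (i := i.castSucc) (by simpa using hi) (by omega) h2.2]
      exact key ((h.mem_shift (by rw [cut_of_ne hi]; omega) (by omega)).mpr he) rfl
  · by_cases h3 : x ≤ p + T + 1
    · have h4 := (h.clean x (by omega) h3 i).2.mp he
      subst h4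
      have h5 : row i (i.castSucc, x) = x := by simp [row]
      have h6 : row i (i.succ, x - 1) = x := by simp [row]
      rw [h5, h6] at h2
      by_cases h7 : x ≤ p + T
      · rw [transport_deleted (by omega) (by omega) (by omega),
          transport_deleted (v := (i.succ, x - 1)) (by omega) (by omega) (by omega)]
        exact Conn.refl _
      · rw [transport_above (by omega) (by omega) (by omega),
          transport_above (v := (i.succ, x - 1)) (by omega) (by omega) (by omega)]
        exact conn_high ((h.mem_of_lt (by omega)).mpr he)
    · rw [transport_above (by omega) (by omega) (by omega),
        transport_above (v := (i.succ, x - 1)) (by omega) (by omega) (by omega)]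
      exact conn_high ((h.mem_of_lt (by omega)).mpr he)

lemma conn_transport {u v : Vertex m ℤ} (huv : Conn ends Γ u v) :
    Conn ends (insertRows F Γ p T) (transport p T j u) (transport p T j v) := by
  induction huv with
  | refl => exact Conn.refl _
  | tail _ hl ih =>
    refine ih.trans ?_
    rcases linked_cases hl with ⟨k, x, he, ⟨rfl, rfl⟩ | ⟨rfl, rfl⟩⟩ |
      ⟨k, x, he, ⟨rfl, rfl⟩ | ⟨rfl, rfl⟩⟩
    · exact h.conn_transport_low he
    · exact (h.conn_transport_low he).symm
    · exact h.conn_transport_high he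
    · exact (h.conn_transport_high he).symm

/-- The inserted rows are paths along low edges, from the first layer on. -/
lemma conn_new_row {x : ℤ} (hx : -((m : ℤ) + 1) ≤ x) (hx' : x < T - (m + 1)) (d : ℕ) :
    ∀ i : Fin (m + 1), (i : ℕ) + d = m → (i : ℕ) ≠ 0 →
      Conn ends (insertRows F Γ p T) (i, x) (Fin.last m, x) := by
  induction d with
  | zero =>
    intro i hi _
    obtain rfl : i = Fin.last m := Fin.ext (by simpa using hi)
    exact Conn.refl _
  | succ d ih =>
    intro i hi h0
    let k : Fin m := ⟨i, by omega⟩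
    have hk : k.castSucc = i := Fin.ext rfl
    have hk0 : (k : ℕ) ≠ 0 := h0
    have h1 := conn_low ((h.mem_new (i := k) (x := x) (t := EdgeKind.low)
      (by rw [cut_of_ne hk0]; omega) (by rw [cut_of_ne hk0]; omega)).mpr (by simp [hk0]))
    rw [hk] at h1
    exact h1.trans (ih k.succ (by simp [k]; omega) (by simp [k]))

variable {I : Set (Vertex m ℤ)} {K : ℕ} (hI : I ⊆ stripInterior m)
  (hg : Good ends I (sigma m K) Γ)
include hI hg

/-- After the insertion the left and right vertices in the same part of `σ_K` are still joined: in
the lower and upper range by the same paths, at the cut by new rows, and in between by the paths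
which have moved up. -/
lemma conn_left_right (hK : m + 1 ≤ K) {x r : ℤ} (hr : InRange K r)
    (hx : r ≤ 0 ∧ x = r ∨ 0 ≤ r ∧ x = r + 1) :
    Conn ends (insertRows F Γ p T) (0, x) (Fin.last m, r) := by
  have hp := h.two_le
  have hT := h.le_shift
  have hm : 0 < m := Nat.pos_of_ne_zero (NeZero.ne m)
  have hlast : ((Fin.last m : Fin (m + 1)) : ℕ) ≠ 0 := by simpa using hm.ne'
  have hrK : r < K := by rcases hr with hr | hr <;> omega
  have hsucc : (((0 : Fin m).succ : Fin (m + 1)) : ℕ) = 1 := by rw [Fin.val_succ]; rfl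
  have hnew : ∀ r, -((m : ℤ) + 1) ≤ r → r < T - (m + 1) →
      Conn ends (insertRows F Γ p T) ((0 : Fin m).succ, r) (Fin.last m, r) := fun r h1 h2 =>
    h.conn_new_row h1 h2 (m - 1) _ (by rw [hsucc]; omega) (by rw [hsucc]; omega)
  rcases lt_or_ge r (-((m : ℤ) + 1)) with h1 | h1
  · have := h.conn_transport (sigma_conn_left_right hI hg hr hx)
    rwa [transport_below (by simp only; omega), transport_below (by simp only; omega)] at this
  rcases lt_or_ge r (T - (m + 1)) with h2 | h2
  · refine Conn.trans ?_ (hnew r h1 h2)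
    rw [← castSucc_zero']
    rcases hx with ⟨hx, rfl⟩ | ⟨hx, rfl⟩
    · exact conn_low ((h.mem_of_lt_cut (by rw [cut_zero]; omega)).mpr (h.left x h1 hx).1)
    · have := conn_high ((h.mem_new (i := 0) (x := r + 1) (t := EdgeKind.high)
        (by rw [cut_zero]; omega) (by rw [cut_zero]; omega)).mpr (by simp))
      rwa [add_sub_cancel_right] at this
  obtain rfl : x = r + 1 := by omega
  rcases lt_or_ge r T with h3 | h3
  · have := h.conn_transport (sigma_conn_left_right (x := r - T) (r := r - T) hI hg
      (Or.inr (by omega)) (by omega))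
    rwa [transport_neg (by omega) (by omega) (by omega),
      transport_shift hlast (by omega) (by rw [row_last]; omega),
      show r - T + 1 + T = r + 1 by ring, sub_add_cancel] at this
  rcases lt_or_ge r (p + T) with h4 | h4
  · have := h.conn_transport (sigma_conn_left_right (x := r - T + 1) (r := r - T) hI hg
      (Or.inr (by omega)) (by omega))
    rwa [transport_pos (by omega) (by omega),
      transport_shift hlast (by omega) (by rw [row_last]; omega),
      show r - T + 1 + T = r + 1 by ring, sub_add_cancel] at this
  · have := h.conn_transport (sigma_conn_left_right hI hg hr hx)
    rwa [transport_above (by omega) (by omega) (by rw [row_zero]; omega),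
      transport_above (by omega) (by omega) (by rw [row_last]; omega)] at this

/-- The insertion of rows preserves the boundary partition `σ_K`. -/
lemma good_insertRows (hIw : ∀ v ∈ stripInterior m, -((m : ℤ) + 1) ≤ v.2 → v.2 ≤ p → v ∈ I)
    (hK : m + 1 ≤ K) (hcard : (insertRows F Γ p T).card ≤ Γ.card) :
    Good ends I (sigma m K) (insertRows F Γ p T) := by
  have hp := h.two_le
  have hT := h.le_shift
  refine hg.of_card_le hcard ?_ ?_
  · -- Every vertex is the image of a vertex under `transport`, or it lies in a new row.
    have hb : ∀ b, b ∉ I → ∃ b', b' ∉ I ∧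
        Conn ends (insertRows F Γ p T) (transport p T j b) b' := by
      rintro ⟨i, x⟩ hb
      rcases lt_or_ge x (-((m : ℤ) + 1)) with h1 | h1
      · exact ⟨_, hb, by rw [transport_below h1]; exact Conn.refl _⟩
      rcases lt_or_ge (p + T) (row j (i, x)) with h2 | h2
      · exact ⟨_, hb, by rw [transport_above (by omega) (by omega) h2]; exact Conn.refl _⟩
      rcases lt_or_ge p (row j (i, x)) with h3 | h3
      · exact ⟨(0, 0), left_notMem hI 0, by
          rw [transport_deleted (by omega) h3 h2]; exact Conn.refl _⟩
      have hrow := row_bounds (j := j) (i, x)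
      simp only at hrow
      by_cases h4 : i = Fin.last m
      · subst h4
        refine ⟨(Fin.last m, x + T), right_notMem hI _, ?_⟩
        rw [transport_shift (fun h => last_ne_zero (Fin.ext h)) h1 h3]
        exact Conn.refl _
      obtain rfl : i = 0 := by
        by_contra h5
        exact hb (hIw _ ⟨h5, h4⟩ h1 (by simp only; omega))
      rcases lt_trichotomy x 0 with h5 | rfl | h5
      · refine ⟨(0, x + 1 + T), left_notMem hI _, ?_⟩
        rw [transport_neg (by omega) h1 h5]
        exact Conn.refl _
      · refine ⟨(Fin.last m, 0 + T), right_notMem hI _, ?_⟩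
        have := h.conn_transport (sigma_conn_left_right (x := 0) (r := 0) hI hg
          (Or.inl rfl) (by omega))
        rwa [transport_shift (x := 0) (fun h => last_ne_zero (Fin.ext h)) (by omega)
          (by rw [row_last]; omega)] at this
      · refine ⟨(0, x + T), left_notMem hI _, ?_⟩
        rw [transport_pos h5 (by omega)]
        exact Conn.refl _
    have hall : ∀ v, ∃ b', b' ∉ I ∧
        Conn ends (insertRows F Γ p T) (transport p T j v) b' := by
      intro v
      by_cases hv : v ∈ I
      · obtain ⟨b, hbI, hvb⟩ := hg.grounded v hv
        obtain ⟨b', hb', h'⟩ := hb b hbI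
        exact ⟨b', hb', (h.conn_transport hvb).trans h'⟩
      · exact hb v hv
    rintro ⟨i, x⟩ hv
    have hi : (i : ℕ) ≠ 0 := fun h => (hI hv).1 (Fin.ext h)
    rcases lt_or_ge x (-((m : ℤ) + 1)) with h1 | h1
    · have := hall (i, x)
      rwa [transport_below h1] at this
    rcases lt_or_ge (p + T) (row j (i, x)) with h2 | h2
    · have := hall (i, x)
      rwa [transport_above (by omega) (by omega) h2] at this
    rcases lt_or_ge x (T - (m + 1)) with h3 | h3
    · exact ⟨_, right_notMem hI x, h.conn_new_row h1 h3 (m - i) i (by omega) hi⟩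
    · have := hall (i, x - T)
      rwa [transport_shift hi (by omega) (by simp only [row] at h2 ⊢; split_ifs at h2 ⊢ <;> omega),
        sub_add_cancel] at this
  · have key : ∀ r, InRange K r → ∀ b : Vertex m ℤ, SigmaPart r b →
        Conn ends (insertRows F Γ p T) b (Fin.last m, r) := by
      rintro r hr ⟨i, x⟩ (hb | ⟨hb, hx⟩)
      · rw [hb]
        exact Conn.refl _
      · simp only at hb hx
        subst hb
        exact h.conn_left_right hI hg hK hr hx
    intro b c _ _ hbc
    rcases (sigma_iff K b c).mp hbc with rfl | ⟨r, hr, hb, hc⟩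
    · exact Conn.refl _
    · exact (key r hr b hb).trans (key r hr c hc).symm

end Insertable

end NNetwork

/-! ### The weight gained by inserting rows -/

lemma prod_Ico_mul_prod_Ico (g : ℤ → ℝ) {a b d : ℤ} (hab : a ≤ b) (hbd : b ≤ d) :
    (∏ x ∈ Finset.Ico a b, g x) * ∏ x ∈ Finset.Ico b d, g x = ∏ x ∈ Finset.Ico a d, g x := by
  rw [← Finset.Ico_union_Ico_eq_Ico hab hbd,
    Finset.prod_union (Finset.Ico_disjoint_Ico_consecutive a b d)]

/-- If `g'` arises from `g` by inserting at `s` the `T` values of `f` and deleting those after `p`,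
then their products differ by the products of the values inserted and deleted. -/
lemma prod_insert_mul {g g' f : ℤ → ℝ} {s p T X Y : ℤ} (hs : Y ≤ s) (hsp : s ≤ p + 1) (hT : 0 ≤ T)
    (hX : p + T + 1 ≤ X) (h1 : ∀ x < s, g' x = g x) (h2 : ∀ x, s ≤ x → x < s + T → g' x = f x)
    (h3 : ∀ x, s ≤ x → x ≤ p → g' (x + T) = g x) (h4 : ∀ x, p + T < x → g' x = g x) :
    (∏ x ∈ Finset.Ico Y X, g' x) * ∏ x ∈ Finset.Ico (p + 1) (p + 1 + T), g x =
      (∏ x ∈ Finset.Ico Y X, g x) * ∏ x ∈ Finset.Ico s (s + T), f x := by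
  rw [← prod_Ico_mul_prod_Ico g' hs (show s ≤ X by omega),
    ← prod_Ico_mul_prod_Ico g' (show s ≤ s + T by omega) (show s + T ≤ X by omega),
    ← prod_Ico_mul_prod_Ico g' (show s + T ≤ p + 1 + T by omega) (show p + 1 + T ≤ X by omega),
    ← prod_Ico_mul_prod_Ico g hs (show s ≤ X by omega),
    ← prod_Ico_mul_prod_Ico g hsp (show p + 1 ≤ X by omega),
    ← prod_Ico_mul_prod_Ico g (show p + 1 ≤ p + 1 + T by omega) (show p + 1 + T ≤ X by omega)]
  have e1 : ∏ x ∈ Finset.Ico Y s, g' x = ∏ x ∈ Finset.Ico Y s, g x :=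
    Finset.prod_congr rfl fun x hx => h1 x (Finset.mem_Ico.mp hx).2
  have e2 : ∏ x ∈ Finset.Ico s (s + T), g' x = ∏ x ∈ Finset.Ico s (s + T), f x :=
    Finset.prod_congr rfl fun x hx => h2 x (Finset.mem_Ico.mp hx).1 (Finset.mem_Ico.mp hx).2
  have e3 : ∏ x ∈ Finset.Ico (s + T) (p + 1 + T), g' x = ∏ x ∈ Finset.Ico s (p + 1), g x := by
    rw [← Finset.map_add_right_Ico, Finset.prod_map]
    refine Finset.prod_congr rfl fun x hx => ?_
    rw [Finset.mem_Ico] at hx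
    exact h3 x hx.1 (by omega)
  have e4 : ∏ x ∈ Finset.Ico (p + 1 + T) X, g' x = ∏ x ∈ Finset.Ico (p + 1 + T) X, g x :=
    Finset.prod_congr rfl fun x hx => h4 x (by have := (Finset.mem_Ico.mp hx).1; omega)
  rw [e1, e2, e3, e4]
  ring

lemma prod_Ico_period {n : ℕ} [NeZero n] (f : ZMod n → ℝ) (a : ℤ) :
    ∏ x ∈ Finset.Ico a (a + n), f x = ∏ i, f i := by
  classical
  have hinj : Set.InjOn (fun x : ℤ => (x : ZMod n)) (Finset.Ico a (a + n) : Finset ℤ) := by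
    intro x hx y hy hxy
    simp only [Finset.coe_Ico, Set.mem_Ico] at hx hy
    have h1 := (ZMod.intCast_eq_intCast_iff_dvd_sub x y n).mp hxy
    have h2 := Int.eq_zero_of_abs_lt_dvd h1 (by rw [abs_lt]; omega)
    omega
  have himage : (Finset.Ico a (a + n)).image (fun x : ℤ => (x : ZMod n)) = Finset.univ := by
    apply Finset.eq_univ_of_card
    rw [Finset.card_image_of_injOn hinj, Int.card_Ico, ZMod.card]
    simp
  rw [← himage, Finset.prod_image hinj]

lemma prod_Ico_periods {n : ℕ} [NeZero n] (f : ZMod n → ℝ) (a : ℤ) (t : ℕ) :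
    ∏ x ∈ Finset.Ico a (a + n * t), f x = (∏ i, f i) ^ t := by
  induction t with
  | zero => simp
  | succ t ih =>
    rw [pow_succ, ← ih, ← prod_Ico_period f (a + n * t), prod_Ico_mul_prod_Ico]
    · congr 2
      push_cast
      ring
    · have : (0 : ℤ) ≤ n * t := by positivity
      omega
    · omega

namespace NNetwork

open EdgeSet

variable {n m : ℕ} {F Γ : Finset (Edge m ℤ)} {p T : ℤ} {j : Fin m}

/-- The factor by which the edge `(i, x, t)` contributes to the weight of `Γ`. -/
def factor (u : Edge m (ZMod n) → ℝ) (Γ : Finset (Edge m ℤ)) (i : Fin m) (t : EdgeKind) (x : ℤ) :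
    ℝ :=
  if (i, x, t) ∈ Γ then u (i, x, t) else 1

lemma prod_eq_prod_factor (u : Edge m (ZMod n) → ℝ) {Y X : ℤ}
    (hΓ : ∀ e ∈ Γ, Y ≤ e.2.1 ∧ e.2.1 < X) :
    ∏ e ∈ Γ, u (e.1, e.2.1, e.2.2) = ∏ i, ((∏ x ∈ Finset.Ico Y X, factor u Γ i EdgeKind.low x) *
      ∏ x ∈ Finset.Ico Y X, factor u Γ i EdgeKind.high x) := by
  have hsub : Γ ⊆ Finset.univ ×ˢ (Finset.Ico Y X ×ˢ {EdgeKind.low, EdgeKind.high}) := by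
    rintro ⟨i, x, t⟩ he
    simp only [Finset.mem_product, Finset.mem_univ, Finset.mem_Ico, true_and, Finset.mem_insert,
      Finset.mem_singleton]
    refine ⟨hΓ _ he, ?_⟩
    cases t <;> simp
  rw [← Finset.inter_eq_right.mpr hsub, ← Finset.prod_ite_mem, Finset.prod_product]
  refine Finset.prod_congr rfl fun i _ => ?_
  rw [Finset.prod_product, ← Finset.prod_mul_distrib]
  refine Finset.prod_congr rfl fun x _ => ?_
  rw [Finset.prod_pair (fun h => EdgeKind.noConfusion h)]
  rw [Finset.inter_eq_right.mpr hsub]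
  rfl

lemma prod_ite_eq_mul_radius [NeZero n] {u : Edge m (ZMod n) → ℝ} (hu : ∀ e, 0 < u e) (j : Fin m)
    (t : ℕ) :
    ∏ i : Fin m, (if i = j then (∏ x, u (i, x, EdgeKind.high)) ^ t
      else (∏ x, u (i, x, EdgeKind.low)) ^ t) =
      (∏ i : Fin m, (∏ x, u (i, x, EdgeKind.low)) ^ t) * radius u j ^ t := by
  have hpos : ∀ i, (0 : ℝ) < (∏ x, u (i, x, EdgeKind.low)) ^ t := fun i =>
    pow_pos (Finset.prod_pos fun x _ => hu _) t
  have h1 : radius u j ^ t = ∏ i : Fin m, if i = j then radius u i ^ t else 1 := by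
    rw [Finset.prod_ite_eq' Finset.univ j fun i => radius u i ^ t]
    simp
  rw [h1, ← Finset.prod_mul_distrib]
  refine Finset.prod_congr rfl fun i _ => ?_
  split_ifs
  · change _ = _ * ((∏ x, u (i, x, EdgeKind.high)) / ∏ x, u (i, x, EdgeKind.low)) ^ t
    rw [div_pow, mul_div_cancel₀ _ (hpos i).ne']
  · rw [mul_one]

namespace Insertable

variable [NeZero m] [NeZero n] {t : ℕ} (h : Insertable F Γ p (n * t) j)
include h

/-- Inserting `n * t` rows, which descend in the first gap, and deleting as many rows, which descend
after the layer `j`, multiplies the weight by a power of the ratio of radii. -/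
lemma prod_insertRows_mul {u : Edge m (ZMod n) → ℝ} (hu : ∀ e, 0 < u e) :
    (∏ e ∈ insertRows F Γ p (n * t), u (e.1, e.2.1, e.2.2)) * radius u j ^ t =
      (∏ e ∈ Γ, u (e.1, e.2.1, e.2.2)) * radius u 0 ^ t := by
  have hp := h.two_le
  have hT := h.le_shift
  obtain ⟨B, hB⟩ : ∃ B : ℤ, ∀ e ∈ F, |e.2.1| ≤ B := by
    obtain ⟨B, hB⟩ := (F.image fun e => |e.2.1|).bddAbove
    exact ⟨B, fun e he => hB (Finset.mem_coe.mpr (Finset.mem_image_of_mem _ he))⟩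
  set X : ℤ := max B (p + n * t) + m + 2 with hX
  have hXB : B < X := by have := le_max_left B (p + n * t); omega
  have hXp : p + n * t + m + 2 ≤ X := by have := le_max_right B (p + n * t); omega
  have hF : ∀ e ∈ F, -X ≤ e.2.1 ∧ e.2.1 < X := by
    intro e he
    have := abs_le.mp (hB e he)
    omega
  have hsub : insertRows F Γ p (n * t) ⊆ F := by
    classical exact Finset.filter_subset _ _
  rw [prod_eq_prod_factor u fun e he => hF e (hsub he),
    prod_eq_prod_factor u fun e he => hF e (h.subset he)]
  have key : ∀ (i : Fin m) (τ : EdgeKind),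
      (∏ x ∈ Finset.Ico (-X) X, factor u (insertRows F Γ p (n * t)) i τ x) *
        (if τ = EdgeKind.low ↔ i ≠ j then (∏ x, u (i, x, τ)) ^ t else 1) =
      (∏ x ∈ Finset.Ico (-X) X, factor u Γ i τ x) *
        (if τ = EdgeKind.low ↔ i ≠ 0 then (∏ x, u (i, x, τ)) ^ t else 1) := by
    intro i τ
    have hcut := cut_bounds i
    have hτ : τ ≠ EdgeKind.low ↔ τ = EdgeKind.high := by
      cases τ <;> simp
    have hi0 : (i : ℕ) = 0 ↔ i = 0 := ⟨fun h => Fin.ext h, fun h => congrArg Fin.val h⟩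
    have := prod_insert_mul (g := factor u Γ i τ) (g' := factor u (insertRows F Γ p (n * t)) i τ)
      (f := fun x => if τ = EdgeKind.low ↔ i ≠ 0 then u (i, x, τ) else 1) (s := cut i) (p := p)
      (T := n * t) (X := X) (Y := -X) (by omega) (by omega) (by omega) (by omega)
      (fun x hx => by simp only [factor, h.mem_of_lt_cut hx])
      (fun x hx hx' => by
        simp only [factor, h.mem_new hx hx', hi0]
        congr 1
        rw [← hτ]
        exact propext (by tauto))
      (fun x hx hx' => by
        simp only [factor, h.mem_shift hx hx']
        simp)
      (fun x hx => by simp only [factor, h.mem_of_lt hx])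
    have e1 : ∏ x ∈ Finset.Ico (p + 1) (p + 1 + n * t), factor u Γ i τ x =
        if τ = EdgeKind.low ↔ i ≠ j then (∏ x, u (i, x, τ)) ^ t else 1 := by
      rw [← prod_Ico_periods (fun x => u (i, x, τ)) (p + 1)]
      have h2 : ∀ x ∈ Finset.Ico (p + 1) (p + 1 + (n : ℤ) * t), factor u Γ i τ x =
          if τ = EdgeKind.low ↔ i ≠ j then u (i, x, τ) else 1 := fun x hx => by
        rw [Finset.mem_Ico] at hx
        have h1 := h.clean x (by omega) (by omega) i
        rw [factor]
        congr 1
        cases τ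
        · simp [h1.1]
        · simp [h1.2]
      rw [Finset.prod_congr rfl h2]
      split_ifs
      · rfl
      · exact Finset.prod_const_one
    have e2 : ∏ x ∈ Finset.Ico (cut i) (cut i + n * t),
        (if τ = EdgeKind.low ↔ i ≠ 0 then u (i, x, τ) else 1) =
        if τ = EdgeKind.low ↔ i ≠ 0 then (∏ x, u (i, x, τ)) ^ t else 1 := by
      rw [← prod_Ico_periods (fun x => u (i, x, τ)) (cut i)]
      split_ifs
      · rfl
      · exact Finset.prod_const_one
    rw [← e1, ← e2]
    exact this
  -- the product of the conductances in rows which descend after the layer `l`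
  have hD : ∀ l : Fin m, ∏ i : Fin m,
      ((if EdgeKind.low = EdgeKind.low ↔ i ≠ l then (∏ x, u (i, x, EdgeKind.low)) ^ t else 1) *
        (if EdgeKind.high = EdgeKind.low ↔ i ≠ l then (∏ x, u (i, x, EdgeKind.high)) ^ t else 1)) =
      (∏ i : Fin m, (∏ x, u (i, x, EdgeKind.low)) ^ t) * radius u l ^ t := by
    intro l
    rw [← prod_ite_eq_mul_radius hu l t]
    refine Finset.prod_congr rfl fun i _ => ?_
    by_cases hil : i = l <;> simp [hil]
  have hpos : (0 : ℝ) < ∏ i : Fin m, (∏ x, u (i, x, EdgeKind.low)) ^ t :=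
    Finset.prod_pos fun i _ => pow_pos (Finset.prod_pos fun x _ => hu _) t
  refine mul_left_cancel₀ hpos.ne' ?_
  rw [mul_left_comm, ← hD j, mul_left_comm, ← hD 0, ← Finset.prod_mul_distrib,
    ← Finset.prod_mul_distrib]
  refine Finset.prod_congr rfl fun i _ => ?_
  rw [mul_mul_mul_comm, key, key, mul_mul_mul_comm]

/-- The insertion does not decrease the weight if the radius of the first gap is the largest. -/
lemma prod_le_prod_insertRows {u : Edge m (ZMod n) → ℝ} (hu : ∀ e, 0 < u e)
    (hR : radius u j ≤ radius u 0) :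
    ∏ e ∈ Γ, u (e.1, e.2.1, e.2.2) ≤ ∏ e ∈ insertRows F Γ p (n * t), u (e.1, e.2.1, e.2.2) := by
  have hrad : ∀ i, 0 < radius u i := fun i =>
    div_pos (Finset.prod_pos fun x _ => hu _) (Finset.prod_pos fun x _ => hu _)
  have h1 := h.prod_insertRows_mul hu
  have h2 : radius u j ^ t ≤ radius u 0 ^ t := pow_le_pow_left₀ (hrad j).le hR t
  have h3 : 0 ≤ ∏ e ∈ Γ, u (e.1, e.2.1, e.2.2) := Finset.prod_nonneg fun e _ => (hu _).le
  refine le_of_mul_le_mul_right ?_ (pow_pos (hrad j) t)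
  rw [h1]
  exact mul_le_mul_of_nonneg_left h2 h3

/-- The insertion does not increase the number of edges: this is the bound on weights for the
constant conductance `1 / 2`. -/
lemma card_insertRows_le : (insertRows F Γ p (n * t)).card ≤ Γ.card := by
  have := h.prod_le_prod_insertRows (u := fun _ => (1 / 2 : ℝ)) (fun _ => by norm_num) le_rfl
  simp only [Finset.prod_const] at this
  exact (pow_le_pow_iff_right_of_lt_one₀ (by norm_num) (by norm_num)).mp this

end Insertable

end NNetwork

/-! ### The low edge at the left vertex `1` is rarely used -/

namespace EdgeSet

variable {E ι : Type} {F : Finset E} {c : E → ℝ}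

lemma wsum_le_sum_wsum (hc : ∀ e, 0 < c e) (s : Finset ι) {P : Finset E → Prop}
    {Q : ι → Finset E → Prop} (h : ∀ Γ ⊆ F, P Γ → ∃ i ∈ s, Q i Γ) :
    wsum c F P ≤ ∑ i ∈ s, wsum c F (Q i) := by
  classical
  simp only [wsum_eq]
  rw [Finset.sum_comm]
  refine Finset.sum_le_sum fun Γ hΓ => ?_
  have hnn : ∀ i ∈ s, 0 ≤ if Q i Γ then ∏ e ∈ Γ, c e else 0 := fun i _ => by
    split_ifs
    · exact prod_nonneg' hc Γ
    · exact le_rfl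
  by_cases hP : P Γ
  · obtain ⟨i, hi, hQ⟩ := h Γ (Finset.mem_powerset.mp hΓ) hP
    rw [if_pos hP]
    have := Finset.single_le_sum hnn hi
    rwa [if_pos hQ] at this
  · rw [if_neg hP]
    exact Finset.sum_nonneg hnn

/-- If the sets with property `P` are mapped to sets with property `Q` in several ways, without
decreasing the weight and such that the argument and the way can be recovered from the image, then
the weight of `Q` is a multiple of the weight of `P`. -/
lemma card_mul_wsum_le (hc : ∀ e, 0 < c e) (s : Finset ι) {P Q : Finset E → Prop}
    (g : ι → Finset E → Finset E)
    (hg : ∀ i ∈ s, ∀ Γ ⊆ F, P Γ → g i Γ ⊆ F ∧ Q (g i Γ) ∧ ∏ e ∈ Γ, c e ≤ ∏ e ∈ g i Γ, c e)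
    (hinj : ∀ i ∈ s, ∀ j ∈ s, ∀ Γ, ∀ Δ, P Γ → P Δ → g i Γ = g j Δ → i = j ∧ Γ = Δ) :
    s.card * wsum c F P ≤ wsum c F Q := by
  classical
  set A : Finset (ι × Finset E) := s ×ˢ (F.powerset.filter P) with hA
  have hmem : ∀ z ∈ A, z.1 ∈ s ∧ z.2 ⊆ F ∧ P z.2 := by
    intro z hz
    simpa [hA, Finset.mem_product, Finset.mem_filter, Finset.mem_powerset] using hz
  have h1 : s.card * wsum c F P = ∑ z ∈ A, ∏ e ∈ z.2, c e := by
    rw [hA, Finset.sum_product]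
    change _ = ∑ _i ∈ s, ∑ Γ ∈ F.powerset with P Γ, ∏ e ∈ Γ, c e
    rw [Finset.sum_const, nsmul_eq_mul]
    congr 1
  have h2 : Set.InjOn (fun z : ι × Finset E => g z.1 z.2) A := by
    intro z hz w hw hzw
    have hz := hmem z hz
    have hw := hmem w hw
    obtain ⟨h3, h4⟩ := hinj _ hz.1 _ hw.1 _ _ hz.2.2 hw.2.2 hzw
    exact Prod.ext h3 h4
  rw [h1]
  calc ∑ z ∈ A, ∏ e ∈ z.2, c e ≤ ∑ z ∈ A, ∏ e ∈ g z.1 z.2, c e :=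
        Finset.sum_le_sum fun z hz => (hg _ (hmem z hz).1 _ (hmem z hz).2.1 (hmem z hz).2.2).2.2
    _ = ∑ Δ ∈ A.image fun z => g z.1 z.2, ∏ e ∈ Δ, c e := by
        rw [Finset.sum_image h2]
    _ ≤ _ := by
        refine Finset.sum_le_sum_of_subset_of_nonneg (fun Δ hΔ => ?_)
          fun Δ _ _ => prod_nonneg' hc Δ
        obtain ⟨z, hz, rfl⟩ := Finset.mem_image.mp hΔ
        have h3 := hg _ (hmem z hz).1 _ (hmem z hz).2.1 (hmem z hz).2.2
        rw [Finset.mem_filter, Finset.mem_powerset]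
        exact ⟨h3.1, h3.2.1⟩

end EdgeSet

namespace NNetwork

open EdgeSet

variable {n m : ℕ} [NeZero m] {F Γ Δ : Finset (Edge m ℤ)} {p T T' : ℤ} {j : Fin m}

/-- The number of inserted rows can be read off from the edges at the left vertices: the low edge at
the left vertex `1` is moved up by it. -/
lemma Insertable.le_of_eq (h : Insertable F Γ p T j) (h' : Insertable F Δ p T' j)
    (hΓ : ((0, 1, EdgeKind.low) : Edge m ℤ) ∈ Γ)
    (heq : insertRows F Γ p T = insertRows F Δ p T') : T' ≤ T := by
  by_contra! hlt
  have hp := h.two_le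
  have hT := h.le_shift
  have h1 := (h.mem_shift (i := 0) (x := 1) (by rw [cut_zero]) (by omega)).mpr hΓ
  rw [heq, h'.mem_new (by rw [cut_zero]; omega) (by rw [cut_zero]; omega)] at h1
  exact EdgeKind.noConfusion (h1.mp rfl)

/-- The original edge set can be recovered, since the deleted rows are determined by `j`. -/
lemma Insertable.eq_of_eq (h : Insertable F Γ p T j) (h' : Insertable F Δ p T j)
    (heq : insertRows F Γ p T = insertRows F Δ p T) : Γ = Δ := by
  have hT := h.le_shift
  ext ⟨i, x, t⟩
  rcases lt_or_ge x (cut i) with h1 | h1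
  · rw [← h.mem_of_lt_cut h1, heq, h'.mem_of_lt_cut h1]
  rcases lt_or_ge p x with h2 | h2
  · rcases lt_or_ge (p + T) x with h3 | h3
    · rw [← h.mem_of_lt h3, heq, h'.mem_of_lt h3]
    · have h4 := h.clean x (by omega) (by omega) i
      have h5 := h'.clean x (by omega) (by omega) i
      cases t
      · rw [h4.1, h5.1]
      · rw [h4.2, h5.2]
  · rw [← h.mem_shift h1 h2, heq, h'.mem_shift h1 h2]

variable {I : Set (Vertex m ℤ)} {K : ℕ}

/-- A grove with boundary partition `σ_K` contains a block of `L` rows from which rows can be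
removed. -/
lemma exists_insertable (hI : I ⊆ stripInterior m) (hΓF : Γ ⊆ F)
    (hF : ∀ e : Edge m ℤ, -(K : ℤ) ≤ e.2.1 → e.2.1 ≤ K → e ∈ F)
    (hg : Good ends I (sigma m K) Γ) {L : ℕ} (hL : 2 ≤ L) (hK : 2 + m * L + m ≤ K)
    (hK' : 2 * m + 2 ≤ K) :
    ∃ b < m, ∃ j, (2 : ℤ) + b * L + L ≤ K ∧
      ∀ T : ℤ, m + 2 ≤ T → T + 3 ≤ L → Insertable F Γ (2 + b * L) T j := by
  obtain ⟨b, hb, hconst⟩ := exists_constant_block hI hg L hK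
  have h1 : (b + 1) * L ≤ m * L := Nat.mul_le_mul_right _ hb
  have h2 : ((b + 1) * L : ℤ) ≤ m * L := by exact_mod_cast h1
  have h3 : (2 : ℤ) + m * L + m ≤ K := by exact_mod_cast hK
  have h4 : (0 : ℤ) ≤ b * L := by positivity
  have h5 : ((b + 1) * L : ℤ) = b * L + L := by ring
  obtain ⟨j, hj⟩ := exists_clean (p := 2 + b * L) (q := b * L + L) hI hg (by omega) (by omega)
    (by omega) (by rw [hconst]; congr 1; push_cast; ring)
  refine ⟨b, hb, j, by omega, fun T hT hTL => ⟨hΓF, fun x hx hx' => hj x hx (by omega), ?_, ?_,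
    by omega, hT, fun e he he' => hF e (by omega) (by omega)⟩⟩
  · exact fun i => sigma_high_notMem hI hg (by omega) (by omega) i
  · exact fun x hx hx' => sigma_low_mem hI hg (by omega) hx' (by omega)

/-- The groves with boundary partition `σ_K` which contain the low edge at the left vertex `1` have
a small share in the total weight of the groves with this partition: rows can be inserted into them
in many ways, without decreasing the weight by the assumption on the radii. -/
lemma mul_wsum_sigma_low_le [NeZero n] {c : Edge m (ZMod n) → ℝ} (hc : ∀ e, 0 < c e)
    (hR : ∀ k, radius c k ≤ radius c 0) (hI : I ⊆ stripInterior m)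
    (hIw : ∀ v ∈ stripInterior m, -(K : ℤ) ≤ v.2 → v.2 ≤ K → v ∈ I)
    (hF : ∀ e : Edge m ℤ, -(K : ℤ) ≤ e.2.1 → e.2.1 ≤ K → e ∈ F) (N : ℕ)
    (hK : 2 + m * (n * (m + 2 + N) + 3) + m ≤ K) (hK' : 2 * m + 2 ≤ K) :
    N * wsum (universalCover c).conductance F
        (fun Γ => Good ends I (sigma m K) Γ ∧ ((0, 1, EdgeKind.low) : Edge m ℤ) ∈ Γ) ≤
      m ^ 2 * wsum (universalCover c).conductance F (Good ends I (sigma m K)) := by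
  have hc' : ∀ e, 0 < (universalCover c).conductance e := fun e => hc _
  have hn : 0 < n := Nat.pos_of_ne_zero (NeZero.ne n)
  -- There are `N` admissible numbers `n * t` of new rows, and blocks of length `L` are long enough
  -- for all of them. A block starts in one of `m` rows and descends after one of `m` layers.
  set L := n * (m + 2 + N) + 3 with hL
  set s : Finset ℕ := Finset.Ico (m + 2) (m + 2 + N) with hs
  let Q : ℕ × Fin m → Finset (Edge m ℤ) → Prop := fun z Γ =>
    (Good ends I (sigma m K) Γ ∧ ((0, 1, EdgeKind.low) : Edge m ℤ) ∈ Γ) ∧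
      (2 : ℤ) + z.1 * L + L ≤ K ∧ ∀ t ∈ s, Insertable F Γ (2 + z.1 * L) (n * t) z.2
  have hbound : ∀ t ∈ s, (m : ℤ) + 2 ≤ n * t ∧ (n : ℤ) * t + 3 ≤ L := by
    intro t ht
    rw [hs, Finset.mem_Ico] at ht
    have h1 : m + 2 ≤ n * t := ht.1.trans (Nat.le_mul_of_pos_left t hn)
    have h2 : n * t + 3 ≤ L := by
      rw [hL]
      have := Nat.mul_le_mul_left n ht.2.le
      omega
    exact ⟨by exact_mod_cast h1, by exact_mod_cast h2⟩
  have h1 := wsum_le_sum_wsum (F := F) hc' (Finset.range m ×ˢ (Finset.univ : Finset (Fin m)))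
    (P := fun Γ => Good ends I (sigma m K) Γ ∧ ((0, 1, EdgeKind.low) : Edge m ℤ) ∈ Γ) (Q := Q) (by
      intro Γ hΓ hP
      obtain ⟨b, hb, j, hbK, h⟩ := exists_insertable hI hΓ hF hP.1 (L := L) (by omega) hK hK'
      refine ⟨(b, j), by simp [hb], hP, hbK, fun t ht => ?_⟩
      exact h _ (hbound t ht).1 (hbound t ht).2)
  have h2 : ∀ z, N * wsum (universalCover c).conductance F (Q z) ≤
      wsum (universalCover c).conductance F (Good ends I (sigma m K)) := by
    intro z
    have := card_mul_wsum_le (F := F) hc' s (P := Q z) (Q := Good ends I (sigma m K))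
      (fun t Γ => insertRows F Γ (2 + z.1 * L) (n * t)) (by
        rintro t ht Γ hΓ ⟨⟨hg, -⟩, hzK, h⟩
        have h' := h t ht
        have hz : (0 : ℤ) ≤ z.1 * L := by positivity
        refine ⟨?_, h'.good_insertRows hI hg (fun v hv h3 h4 => hIw v hv (by omega) (by omega))
          (by omega) h'.card_insertRows_le, h'.prod_le_prod_insertRows hc (hR _)⟩
        classical exact Finset.filter_subset _ _) (by
        rintro t ht t' ht' Γ Δ ⟨⟨-, hΓ⟩, -, h⟩ ⟨⟨-, hΔ⟩, -, h'⟩ heq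
        have h3 := (h t ht).le_of_eq (h' t' ht') hΓ heq
        have h4 := (h' t' ht').le_of_eq (h t ht) hΔ heq.symm
        have h5 : n * t = n * t' := by exact_mod_cast le_antisymm h4 h3
        obtain rfl := Nat.eq_of_mul_eq_mul_left hn h5
        exact ⟨rfl, (h t ht).eq_of_eq (h' t ht) heq⟩)
    rwa [hs, Nat.card_Ico, add_tsub_cancel_left] at this
  calc _ ≤ (N : ℝ) * ∑ z ∈ Finset.range m ×ˢ (Finset.univ : Finset (Fin m)),
        wsum (universalCover c).conductance F (Q z) :=
      mul_le_mul_of_nonneg_left h1 (Nat.cast_nonneg N)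
    _ = ∑ z ∈ Finset.range m ×ˢ (Finset.univ : Finset (Fin m)),
        N * wsum (universalCover c).conductance F (Q z) := Finset.mul_sum _ _ _
    _ ≤ ∑ z ∈ Finset.range m ×ˢ (Finset.univ : Finset (Fin m)),
        wsum (universalCover c).conductance F (Good ends I (sigma m K)) :=
      Finset.sum_le_sum fun z _ => h2 z
    _ = _ := by
      rw [Finset.sum_const, Finset.card_product, Finset.card_range, Finset.card_fin, nsmul_eq_mul]
      push_cast
      ring

end NNetwork

/-! ### Adding the high edge at the left vertex `1` -/

namespace EdgeSet

variable {E : Type} [DecidableEq E] {F : Finset E} {c : E → ℝ} {P R : Finset E → Prop} {e : E}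

lemma mul_wsum_le (hc : ∀ e, 0 < c e) (he : e ∈ F) (hP : ∀ Γ, P Γ → e ∉ Γ)
    (h : ∀ Γ, P Γ → R (insert e Γ)) : c e * wsum c F P ≤ wsum c F R := by
  have h1 := sum_mul_wsum_le (F := F) hc (fun e' Γ => e' = e ∧ P Γ)
    (fun e' Γ h => h.1 ▸ hP Γ h.2) R (fun Δ e₁ _ e₂ _ h h' => h.1.trans h'.1.symm)
    (fun Δ e' he' h' => by
      have := h _ h'.2
      rwa [← h'.1, Finset.insert_erase he'] at this)
  have h2 := Finset.single_le_sum (f := fun e' => c e' * wsum c F fun Γ => e' = e ∧ P Γ)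
    (fun e' _ => mul_nonneg (hc e').le (wsum_nonneg hc _)) he
  simp only [true_and] at h2
  exact h2.trans h1

lemma wsum_le_mul (hc : ∀ e, 0 < c e) (h : ∀ Γ, R Γ → e ∈ Γ ∧ P (Γ.erase e)) :
    wsum c F R ≤ c e * wsum c F P := by
  refine (wsum_le_sum_mul hc (fun e' Γ => e' = e ∧ e ∉ Γ ∧ P Γ) (fun e' Γ h => h.1 ▸ h.2.1) R
    fun Δ hΔ => ⟨e, (h Δ hΔ).1, rfl, Finset.notMem_erase _ _, (h Δ hΔ).2⟩).trans ?_
  calc _ ≤ ∑ e' ∈ F, if e' = e then c e * wsum c F P else 0 := by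
        refine Finset.sum_le_sum fun e' _ => ?_
        split_ifs with h1
        · subst h1
          exact mul_le_mul_of_nonneg_left (wsum_mono hc subset_rfl fun _ _ h => h.2.2) (hc _).le
        · rw [wsum_eq_zero fun _ _ h => h1 h.1, mul_zero]
    _ ≤ _ := by
        rw [Finset.sum_ite_eq']
        split_ifs
        · exact le_rfl
        · exact mul_nonneg (hc e).le (wsum_nonneg hc _)

end EdgeSet

namespace NNetwork

open EdgeSet

variable {m : ℕ} [NeZero m] {K : ℕ}

lemma tau_left_one_iff {v : Vertex m ℤ} : tau m K (0, 1) v ↔ v = (0, 1) := by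
  rw [tau_iff]
  constructor
  · rintro (h | ⟨r, -, (h | ⟨-, h⟩), -⟩)
    · exact h.symm
    · exact absurd (congrArg Prod.fst h).symm last_ne_zero
    · simp only at h
      omega
  · rintro rfl
    exact Or.inl rfl

/-- `σ_K` is obtained from `τ_K` by joining the part of the left vertex `0` to the left
vertex `1`. -/
lemma sigma_iff_tau (b d : Vertex m ℤ) : sigma m K b d ↔
    tau m K b d ∨ (tau m K b (0, 1) ∧ tau m K (0, 0) d) ∨
      (tau m K b (0, 0) ∧ tau m K (0, 1) d) := by
  have hone : ∀ v : Vertex m ℤ, tau m K v (0, 1) ↔ v = (0, 1) := fun v =>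
    ⟨fun h => tau_left_one_iff.mp ((tau m K).symm h), fun h => h ▸ (tau m K).refl _⟩
  have hzero : ∀ v : Vertex m ℤ, tau m K (0, 0) v ↔ TauPart 0 v := by
    intro v
    rw [tau_iff]
    constructor
    · rintro (rfl | ⟨r, hr, (h | ⟨-, h⟩), h'⟩)
      · exact Or.inr ⟨rfl, by simp⟩
      · exact absurd (congrArg Prod.fst h).symm last_ne_zero
      · simp only at h
        obtain rfl : r = 0 := by omega
        exact h'
    · exact fun h => Or.inr ⟨0, Or.inl rfl, Or.inr ⟨rfl, by simp⟩, h⟩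
  have hzero' : ∀ v : Vertex m ℤ, tau m K v (0, 0) ↔ TauPart 0 v := fun v =>
    ⟨fun h => (hzero v).mp ((tau m K).symm h), fun h => (tau m K).symm ((hzero v).mpr h)⟩
  rw [hone, hzero, hzero', tau_left_one_iff]
  have hpart : ∀ r (v : Vertex m ℤ), r ≠ 0 → (SigmaPart r v ↔ TauPart r v) := by
    intro r v hr
    unfold SigmaPart TauPart
    have : (0 ≤ r ∧ v.2 = r + 1) ↔ (1 ≤ r ∧ v.2 = r + 1) := by omega
    rw [this]
  have hpart0 : ∀ v : Vertex m ℤ, SigmaPart 0 v ↔ TauPart 0 v ∨ v = (0, 1) := by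
    rintro ⟨i, x⟩
    unfold SigmaPart TauPart
    simp only [Prod.mk.injEq]
    have : ¬ (1 : ℤ) ≤ 0 := by omega
    simp only [this, le_refl, true_and, false_and, or_false, zero_add]
    tauto
  rw [sigma_iff, tau_iff]
  constructor
  · rintro (h | ⟨r, hr, hb, hd⟩)
    · exact Or.inl (Or.inl h)
    · by_cases h0 : r = 0
      · subst h0
        rw [hpart0] at hb hd
        rcases hb with hb | rfl <;> rcases hd with hd | rfl
        · exact Or.inl (Or.inr ⟨0, hr, hb, hd⟩)
        · exact Or.inr (Or.inr ⟨hb, rfl⟩)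
        · exact Or.inr (Or.inl ⟨rfl, hd⟩)
        · exact Or.inl (Or.inl rfl)
      · rw [hpart r _ h0] at hb hd
        exact Or.inl (Or.inr ⟨r, hr, hb, hd⟩)
  · rintro ((h | ⟨r, hr, hb, hd⟩) | ⟨rfl, hd⟩ | ⟨hb, rfl⟩)
    · exact Or.inl h
    · refine Or.inr ⟨r, hr, ?_⟩
      by_cases h0 : r = 0
      · subst h0
        exact ⟨(hpart0 _).mpr (Or.inl hb), (hpart0 _).mpr (Or.inl hd)⟩
      · exact ⟨(hpart r _ h0).mpr hb, (hpart r _ h0).mpr hd⟩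
    · exact Or.inr ⟨0, Or.inl rfl, (hpart0 _).mpr (Or.inr rfl), (hpart0 _).mpr (Or.inl hd)⟩
    · exact Or.inr ⟨0, Or.inl rfl, (hpart0 _).mpr (Or.inl hb), (hpart0 _).mpr (Or.inr rfl)⟩

variable {I : Set (Vertex m ℤ)} {Γ : Finset (Edge m ℤ)}

lemma ends_high_one : ends ((0, 1, EdgeKind.high) : Edge m ℤ) =
    s(((0, 1) : Vertex m ℤ), ((0 : Fin m).succ, 0)) := by
  rw [← castSucc_zero']
  simp [ends]

/-- Adding the high edge at the left vertex `1` joins this vertex to the component of the left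
vertex `0`, which contains the other end of the edge. -/
lemma good_insert_high (hI : I ⊆ stripInterior m) (hK : m + 1 ≤ K)
    (hg : Good ends I (tau m K) Γ) :
    ((0, 1, EdgeKind.high) : Edge m ℤ) ∉ Γ ∧
      Good ends I (sigma m K) (insert (0, 1, EdgeKind.high) Γ) := by
  have h00 := left_notMem hI 0
  have h01 := left_notMem hI 1
  have hlow : ((0, 0, EdgeKind.low) : Edge m ℤ) ∈ Γ :=
    (low_mem_high_notMem ((hg.type _ _ h00 (right_notMem hI 0)).mpr
      (tau_left_right (Or.inl rfl) (by omega)))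
      fun _ hv => tau_confined_below hI hg (by omega) hv).1
  have hc : Conn ends Γ (0, 0) ((0 : Fin m).succ, 0) := by
    have := conn_low hlow
    rwa [castSucc_zero'] at this
  have hn : ¬ Conn ends Γ (0, 1) ((0 : Fin m).succ, 0) := fun h => by
    have := congrArg Prod.snd
      (tau_left_one_iff.mp ((hg.type _ _ h01 h00).mp (h.trans hc.symm)))
    simp at this
  refine ⟨fun he => hn (Conn.of_mem he ends_high_one), hg.forest.insert ends_high_one hn, ?_, ?_⟩
  · intro v hv
    obtain ⟨b, hb, h⟩ := hg.grounded v hv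
    exact ⟨b, hb, h.mono (Finset.subset_insert _ _)⟩
  · intro b d hb hd
    rw [conn_insert ends_high_one, sigma_iff_tau, ← hg.type b d hb hd, ← hg.type b _ hb h01,
      ← hg.type _ d h00 hd, ← hg.type b _ hb h00, ← hg.type _ d h01 hd]
    have h1 : Conn ends Γ ((0 : Fin m).succ, 0) d ↔ Conn ends Γ (0, 0) d :=
      ⟨hc.trans, hc.symm.trans⟩
    have h2 : Conn ends Γ b ((0 : Fin m).succ, 0) ↔ Conn ends Γ b (0, 0) :=
      ⟨fun h => h.trans hc.symm, fun h => h.trans hc⟩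
    rw [h1, h2]

/-- If the low edge at the left vertex `1` is not used, then the high edge is, and without it the
vertex is isolated. -/
lemma good_erase_high (hI : I ⊆ stripInterior m) (hK : m + 1 ≤ K)
    (hg : Good ends I (sigma m K) Γ) (hf : ((0, 1, EdgeKind.low) : Edge m ℤ) ∉ Γ) :
    ((0, 1, EdgeKind.high) : Edge m ℤ) ∈ Γ ∧
      Good ends I (tau m K) (Γ.erase (0, 1, EdgeKind.high)) := by
  have h00 := left_notMem hI 0
  have h01 := left_notMem hI 1
  have hne : ((0, 1) : Vertex m ℤ) ≠ (0, 0) := by simp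
  have he : ((0, 1, EdgeKind.high) : Edge m ℤ) ∈ Γ := by
    have h10 : Conn ends Γ (0, 1) (0, 0) := by
      refine (hg.type _ _ h01 h00).mpr ?_
      exact (sigma m K).trans (sigma_left_right (r := 0) (Or.inl rfl) (by omega))
        ((sigma m K).symm (sigma_left_right (r := 0) (Or.inl rfl) (by omega)))
    obtain ⟨e, he, u, hu, -⟩ := h10.exists_first hne
    rcases linked_left ⟨e, he, hu⟩ with h3 | h3
    · exact absurd h3.1 hf
    · exact h3.1
  refine ⟨he, ?_⟩
  set Δ := Γ.erase (0, 1, EdgeKind.high) with hΔ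
  have hsub : Δ ⊆ Γ := Finset.erase_subset _ _
  have hiso : ∀ v, Conn ends Δ (0, 1) v → v = (0, 1) := by
    intro v hv
    by_contra hne'
    obtain ⟨e, he, u, hu, -⟩ := hv.exists_first (Ne.symm hne')
    rcases linked_left ⟨e, he, hu⟩ with h3 | h3
    · exact hf (hsub h3.1)
    · exact Finset.notMem_erase _ _ h3.1
  have hc : Conn ends Δ (0, 0) ((0 : Fin m).succ, 0) := by
    have := conn_low (Finset.mem_erase.mpr ⟨fun h => by simp at h,
      (sigma_low_mem hI hg (x := 0) (by omega) le_rfl (by omega)).1⟩ : (0, 0, EdgeKind.low) ∈ Δ)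
    rwa [castSucc_zero'] at this
  have hconn : ∀ x y, Conn ends Γ x y ↔ Conn ends Δ x y ∨
      (Conn ends Δ x (0, 1) ∧ Conn ends Δ ((0 : Fin m).succ, 0) y) ∨
      (Conn ends Δ x ((0 : Fin m).succ, 0) ∧ Conn ends Δ (0, 1) y) := fun x y =>
    conn_erase ends_high_one he
  refine ⟨hg.forest.mono hsub, ?_, ?_⟩
  · intro v hv
    obtain ⟨b, hb, h⟩ := hg.grounded v hv
    rcases (hconn v b).mp h with h | ⟨h, -⟩ | ⟨h, -⟩
    · exact ⟨b, hb, h⟩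
    · exact ⟨_, h01, h⟩
    · exact ⟨_, h00, h.trans hc.symm⟩
  · have hone : ∀ d, tau m K (0, 1) d → Conn ends Δ (0, 1) d := fun d hd => by
      rw [tau_left_one_iff.mp hd]
      exact Conn.refl _
    intro b d hb hd
    constructor
    · intro h
      rcases (sigma_iff_tau b d).mp ((hg.type b d hb hd).mp (h.mono hsub)) with
        h' | ⟨h', -⟩ | ⟨-, h'⟩
      · exact h'
      · obtain rfl := tau_left_one_iff.mp ((tau m K).symm h')
        rw [hiso _ h]
      · obtain rfl := tau_left_one_iff.mp h'
        rw [hiso _ h.symm]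
    · intro h
      rcases (hconn b d).mp ((hg.type b d hb hd).mpr ((sigma_iff_tau b d).mpr (Or.inl h))) with
        h' | ⟨h', -⟩ | ⟨-, h'⟩
      · exact h'
      · obtain rfl := hiso _ h'.symm
        exact hone _ h
      · obtain rfl := hiso _ h'
        exact (hone _ ((tau m K).symm h)).symm

variable {F : Finset (Edge m ℤ)} {c : Edge m ℤ → ℝ}

lemma mul_wsum_tau_le (hc : ∀ e, 0 < c e) (hI : I ⊆ stripInterior m) (hK : m + 1 ≤ K)
    (he : (0, 1, EdgeKind.high) ∈ F) :
    c (0, 1, EdgeKind.high) * wsum c F (Good ends I (tau m K)) ≤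
      wsum c F (Good ends I (sigma m K)) :=
  mul_wsum_le hc he (fun _ hg => (good_insert_high hI hK hg).1)
    fun _ hg => (good_insert_high hI hK hg).2

lemma wsum_sigma_le (hc : ∀ e, 0 < c e) (hI : I ⊆ stripInterior m) (hK : m + 1 ≤ K) :
    wsum c F (Good ends I (sigma m K)) ≤
      c (0, 1, EdgeKind.high) * wsum c F (Good ends I (tau m K)) +
        wsum c F (fun Γ => Good ends I (sigma m K) Γ ∧ ((0, 1, EdgeKind.low) : Edge m ℤ) ∈ Γ) := by
  rw [wsum_add (Good ends I (sigma m K))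
    (fun Γ => Good ends I (sigma m K) Γ ∧ ((0, 1, EdgeKind.low) : Edge m ℤ) ∉ Γ)
    (fun Γ => Good ends I (sigma m K) Γ ∧ ((0, 1, EdgeKind.low) : Edge m ℤ) ∈ Γ)
    (fun Γ _ => by tauto) (fun Γ _ => by tauto)]
  exact add_le_add_left (wsum_le_mul hc fun Γ hΓ => good_erase_high hI hK hΓ.1 hΓ.2) _

end NNetwork

/-! ### The limits -/

namespace NNetwork

open EdgeSet

variable {n m : ℕ} {c : Edge m (ZMod n) → ℝ} {S S' : Finset (Vertex m ℤ)} {K : ℕ}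
  {V : ℕ → Finset (Vertex m ℤ)}

lemma wsum_good_eq_pos (hc : ∀ e, 0 < c e) (S : Finset (Vertex m ℤ)) :
    0 < wsum (universalCover c).conductance ((universalCover c).truncEdges S)
      (Good ends ((universalCover c).truncInterior S) Eq) := by
  obtain ⟨Γ, hΓ, hg⟩ := exists_good_eq c S
  exact wsum_pos (fun e => hc _) hΓ hg

lemma mem_truncEdges_of_window (hS : Window K S) {e : Edge m ℤ} (h : -(K : ℤ) - 1 ≤ e.2.1)
    (h' : e.2.1 ≤ K + 1) : e ∈ (universalCover c).truncEdges S := by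
  obtain ⟨i, x, t⟩ := e
  rw [mem_truncEdges_iff]
  exact ⟨(i.castSucc, x), hS _ h h', by cases t <;> exact Sym2.mem_mk_left _ _⟩

lemma mem_truncInterior_of_window (hS : Window K S) {v : Vertex m ℤ} (hv : v ∈ stripInterior m)
    (h : -(K : ℤ) - 1 ≤ v.2) (h' : v.2 ≤ K + 1) : v ∈ (universalCover c).truncInterior S := by
  rw [truncInterior_eq]
  exact ⟨hS v h h', hv⟩

lemma eventually_window (hV : Monotone V) (hcover : ∀ v, ∃ N, v ∈ V N) (K : ℕ) :
    ∀ᶠ N in atTop, Window K (V N) := by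
  set W : Finset (Vertex m ℤ) := Finset.univ ×ˢ Finset.Icc (-(K : ℤ) - 1) (K + 1) with hW
  have h : ∀ᶠ N in atTop, ∀ v ∈ W, v ∈ V N := by
    rw [Filter.eventually_all_finset]
    intro v _
    obtain ⟨N, hN⟩ := hcover v
    exact eventually_atTop.mpr ⟨N, fun M hM => hV hM hN⟩
  filter_upwards [h] with N hN v h1 h2
  exact hN v (by rw [hW]; simp [h1, h2])

/-- The property of `σ_K` and `τ_K` that two different vertices in the same part are boundary
vertices with index in the window, and that one of them lies on the left. -/
def Localized (K : ℕ) (π : Setoid (Vertex m ℤ)) : Prop :=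
  ∀ u v, π u v → u = v ∨
    ((u.1 = 0 ∨ u.1 = Fin.last m) ∧ (v.1 = 0 ∨ v.1 = Fin.last m) ∧ (u.1 = 0 ∨ v.1 = 0) ∧
      (-(K : ℤ) - 1 ≤ u.2 ∧ u.2 ≤ K + 1) ∧ (-(K : ℤ) - 1 ≤ v.2 ∧ v.2 ≤ K + 1))

/-- The normalized weight of a boundary partition in the truncation to `S`. -/
def truncRatio (c : Edge m (ZMod n) → ℝ) (S : Finset (Vertex m ℤ)) (π : Setoid (Vertex m ℤ)) : ℝ :=
  ratio ends (universalCover c).conductance ((universalCover c).truncEdges S)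
    ((universalCover c).truncInterior S) π

/-- The normalized weight increases with the truncation: the new edges at first join boundary
vertices, and then the new interior vertices are made interior. -/
lemma truncRatio_mono (hc : ∀ e, 0 < c e) (hSS : S ⊆ S') {π : Setoid (Vertex m ℤ)}
    (hπ : Localized K π) : truncRatio c S π ≤ truncRatio c S' π := by
  classical
  have hc' : ∀ e, 0 < (universalCover c).conductance e := fun e => hc _
  have h1 := ratio_mono_edges (ends := ends) (π := π)
    (I := (universalCover c).truncInterior S) hc'
    (F := (universalCover c).truncEdges S) (F' := (universalCover c).truncEdges S') (by
      intro e he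
      rw [mem_truncEdges_iff] at he ⊢
      obtain ⟨u, hu, hue⟩ := he
      exact ⟨u, hSS hu, hue⟩) (by
      intro e _ he v hv hvI
      exact he ((mem_truncEdges_iff c S e).mpr ⟨v, hvI.1, hv⟩))
  set J : Finset (Vertex m ℤ) := S'.filter fun v => v ∈ stripInterior m ∧ v ∉ S with hJ
  have hJm : ∀ v, v ∈ J ↔ v ∈ S' ∧ v ∈ stripInterior m ∧ v ∉ S := fun v => by
    rw [hJ, Finset.mem_filter]
  have hunion : (↑J ∪ (universalCover c).truncInterior S : Set (Vertex m ℤ)) =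
      (universalCover c).truncInterior S' := by
    ext v
    rw [truncInterior_eq, truncInterior_eq]
    simp only [Set.mem_union, Finset.mem_coe, hJm, Set.mem_ofPred_eq]
    have := @hSS v
    tauto
  have hiso : ∀ x ∈ J, ∀ b, π x b → b = x := by
    intro x hx b hb
    rcases hπ x b hb with h | ⟨h, -⟩
    · exact h.symm
    · have h2 := ((hJm x).mp hx).2.1
      exact absurd h (not_or.mpr h2)
  have h2 := ratio_mono_vertices (ends := ends) (π := π) hc'
    (F := (universalCover c).truncEdges S')
    (I := (universalCover c).truncInterior S) (S.finite_toSet.subset fun v hv => hv.1) J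
    (fun x hx hxI => ((hJm x).mp hx).2.2 hxI.1)
    (fun x hx b => ⟨fun h => hiso x hx b (π.symm h), fun h => h ▸ π.refl _⟩)
    (fun x hx b => ⟨fun h => hiso x hx b h, fun h => h ▸ π.refl _⟩)
    (by rw [hunion]; exact wsum_good_eq_pos hc S')
  rw [hunion] at h2
  exact h1.trans h2.2

variable [NeZero m]

lemma localized_sigma : Localized K (sigma m K) := by
  rintro ⟨i, x⟩ ⟨k, y⟩ h
  rcases (sigma_iff K _ _).mp h with h | ⟨r, hr, hu, hv⟩
  · exact Or.inl h
  have hrb : -(K : ℤ) ≤ r ∧ r ≤ K := by rcases hr with hr | hr <;> omega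
  rcases hu with hu | ⟨hu, hx⟩ <;> rcases hv with hv | ⟨hv, hy⟩
  · exact Or.inl (hu.trans hv.symm)
  all_goals
    right
    simp only [Prod.mk.injEq] at *
    refine ⟨?_, ?_, ?_, ?_, ?_⟩ <;> omega

lemma localized_tau : Localized K (tau m K) := fun u v h =>
  localized_sigma u v ((sigma_iff_tau u v).mpr (Or.inl h))

lemma exists_low_edge (v : Vertex m ℤ) : ∃ e : Edge m ℤ, v ∈ ends e := by
  obtain ⟨i, x⟩ := v
  by_cases h : (i : ℕ) < m
  · exact ⟨(⟨i, h⟩, x, EdgeKind.low), Sym2.mem_mk_left _ _⟩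
  · have hm : 0 < m := Nat.pos_of_ne_zero (NeZero.ne m)
    obtain ⟨k, rfl⟩ : ∃ k : Fin m, k.succ = i :=
      ⟨⟨m - 1, by omega⟩, Fin.ext (by simp only [Fin.val_succ]; omega)⟩
    exact ⟨(k, x, EdgeKind.low), Sym2.mem_mk_right _ _⟩

lemma isTruncVertex_of_mem {v : Vertex m ℤ} (hv : v ∈ S) :
    (universalCover c).IsTruncVertex S v := by
  obtain ⟨e, he⟩ := exists_low_edge v
  exact ⟨e, ⟨v, hv, he⟩, he⟩

lemma uPrTrunc_eq (hc : ∀ e, 0 < c e) (hS : Window K S) {π : Setoid (Vertex m ℤ)}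
    (hπ : Localized K π) : uPrTrunc c S π = truncRatio c S π := by
  refine ElectricalNetwork.uPr_truncation (fun e => hc _)
    (fun v hv => isTruncVertex_of_mem hv.1) π ?_
  intro u v huv
  rcases hπ u v huv with h | ⟨-, -, -, hu, hv⟩
  · exact Or.inl h
  · exact Or.inr ⟨isTruncVertex_of_mem (hS _ hu.1 hu.2), isTruncVertex_of_mem (hS _ hv.1 hv.2)⟩

lemma eq_low_or_high_of_left_mem {x : ℤ} {e : Edge m ℤ} (he : ((0, x) : Vertex m ℤ) ∈ ends e) :
    e = (0, x, EdgeKind.low) ∨ e = (0, x, EdgeKind.high) := by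
  obtain ⟨k, y, t⟩ := e
  cases t <;> simp only [ends, Sym2.mem_iff, Prod.mk.injEq] at he <;>
  rcases he with ⟨h1, rfl⟩ | ⟨h1, -⟩
  · left
    rw [← Fin.castSucc_injective _ (castSucc_zero'.trans h1)]
  · exact absurd h1.symm (Fin.succ_ne_zero k)
  · right
    rw [← Fin.castSucc_injective _ (castSucc_zero'.trans h1)]
  · exact absurd h1.symm (Fin.succ_ne_zero k)

/-- The normalized weights are bounded uniformly in the truncation, by the conductances at the left
vertices in the window. -/
lemma exists_truncRatio_le (hc : ∀ e, 0 < c e) (K : ℕ) : ∃ C : ℝ, ∀ S,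
    ∀ π : Setoid (Vertex m ℤ), Localized K π → truncRatio c S π ≤ C := by
  classical
  have hc' : ∀ e, 0 < (universalCover c).conductance e := fun e => hc _
  set Y : Finset ℤ := Finset.Icc (-(K : ℤ) - 1) (K + 1) with hY
  set B : Finset (Vertex m ℤ) := Y.image fun x => (0, x) with hB
  set g : ℤ → ℝ := fun x => (universalCover c).conductance (0, x, EdgeKind.low) +
    (universalCover c).conductance (0, x, EdgeKind.high) with hg
  have hg0 : ∀ x, 0 ≤ g x := fun x => add_nonneg (hc' _).le (hc' _).le
  refine ⟨(1 + ∑ x ∈ Y, g x) ^ B.card, fun S π hπ => ?_⟩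
  rw [truncRatio, ratio, div_le_iff₀ (wsum_good_eq_pos hc S)]
  refine le_trans ?_ (wsum_sparse_le hc' B ?_ ?_)
  · refine wsum_mono hc' subset_rfl fun Γ _ hΓ => ⟨hΓ.forest, hΓ.grounded, fun u v hu hv huv => ?_⟩
    rcases hπ u v ((hΓ.type u v hu hv).mp huv) with h | ⟨-, -, h | h, hu', hv'⟩
    · exact Or.inl h
    · refine Or.inr (Or.inl ?_)
      rw [hB, Finset.coe_image]
      exact ⟨u.2, by simpa [hY] using hu', by rw [← h]⟩
    · refine Or.inr (Or.inr ?_)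
      rw [hB, Finset.coe_image]
      exact ⟨v.2, by simpa [hY] using hv', by rw [← h]⟩
  · intro b hb
    obtain ⟨x, -, rfl⟩ := Finset.mem_image.mp hb
    exact left_notMem (truncInterior_subset c S) x
  · intro b hb
    obtain ⟨x, hx, rfl⟩ := Finset.mem_image.mp hb
    refine le_trans ?_ (Finset.single_le_sum (fun x _ => hg0 x) hx)
    have hsub :
        ((universalCover c).truncEdges S).filter (fun e => ((0, x) : Vertex m ℤ) ∈ ends e) ⊆
          {(0, x, EdgeKind.low), (0, x, EdgeKind.high)} := by
      intro e he
      rw [Finset.mem_filter] at he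
      simpa using eq_low_or_high_of_left_mem he.2
    refine (Finset.sum_le_sum_of_subset_of_nonneg hsub fun e _ _ => (hc' e).le).trans ?_
    rw [Finset.sum_pair (by simp)]

lemma exists_tendsto_truncRatio (hc : ∀ e, 0 < c e) (hV : Monotone V) {π : Setoid (Vertex m ℤ)}
    (hπ : Localized K π) : ∃ l, Tendsto (fun N => truncRatio c (V N) π) atTop (𝓝 l) ∧
      ∀ N, truncRatio c (V N) π ≤ l := by
  obtain ⟨C, hC⟩ := exists_truncRatio_le (c := c) hc K
  have hmono : Monotone fun N => truncRatio c (V N) π := fun M N h => truncRatio_mono hc (hV h) hπ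
  have hbdd : BddAbove (Set.range fun N => truncRatio c (V N) π) := by
    refine ⟨C, ?_⟩
    rintro _ ⟨N, rfl⟩
    exact hC _ _ hπ
  exact ⟨_, tendsto_atTop_ciSup hmono hbdd, fun N => le_ciSup hbdd N⟩

lemma truncRatio_tau_pos (hc : ∀ e, 0 < c e) (hS : Window K S) : 0 < truncRatio c S (tau m K) := by
  obtain ⟨Γ, hΓ, hg⟩ := exists_good_tau (c := c) hS
  exact div_pos (wsum_pos (fun e => hc _) hΓ hg) (wsum_good_eq_pos hc S)

lemma conductance_high_one : (universalCover c).conductance (0, 1, EdgeKind.high) =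
    (cylinder c).conductance (0, (1 : ZMod n), EdgeKind.high) := by
  change c (0, ((1 : ℤ) : ZMod n), EdgeKind.high) = c (0, (1 : ZMod n), EdgeKind.high)
  rw [Int.cast_one]

lemma mul_truncRatio_tau_le (hc : ∀ e, 0 < c e) (hS : Window K S) (hK : m + 1 ≤ K) :
    (cylinder c).conductance (0, (1 : ZMod n), EdgeKind.high) * truncRatio c S (tau m K) ≤
      truncRatio c S (sigma m K) := by
  have h := mul_wsum_tau_le (c := (universalCover c).conductance) (fun e => hc _)
    (truncInterior_subset c S) hK
    (mem_truncEdges_of_window (c := c) (e := (0, 1, EdgeKind.high)) hS (by simp only; omega)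
      (by simp only; omega))
  rw [conductance_high_one] at h
  rw [truncRatio, truncRatio, ratio, ratio, mul_div_assoc']
  exact div_le_div_of_nonneg_right h (wsum_good_eq_pos hc S).le

/-- The upper bound for the normalized weight of `σ_K`, up to an error which is small for large `N`.
-/
lemma mul_truncRatio_sigma_le [NeZero n] (hc : ∀ e, 0 < c e) (hR : ∀ k, radius c k ≤ radius c 0)
    (hS : Window K S) (N : ℕ) (hK : 2 + m * (n * (m + 2 + N) + 3) + m ≤ K) (hK' : 2 * m + 2 ≤ K) :
    (N - m ^ 2 : ℝ) * truncRatio c S (sigma m K) ≤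
      N * ((cylinder c).conductance (0, (1 : ZMod n), EdgeKind.high) *
        truncRatio c S (tau m K)) := by
  have h1 := wsum_sigma_le (c := (universalCover c).conductance) (K := K)
    (F := (universalCover c).truncEdges S) (fun e => hc _) (truncInterior_subset c S) (by omega)
  have h2 := mul_wsum_sigma_low_le (F := (universalCover c).truncEdges S) hc hR
    (truncInterior_subset c S)
    (fun v hv h h' => mem_truncInterior_of_window (c := c) hS hv (by omega) (by omega))
    (fun e h h' => mem_truncEdges_of_window (c := c) hS (by omega) (by omega)) N hK hK'
  rw [conductance_high_one] at h1
  have h3 := mul_le_mul_of_nonneg_left h1 (Nat.cast_nonneg (α := ℝ) N)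
  rw [truncRatio, truncRatio, ratio, ratio, mul_div_assoc', mul_div_assoc', mul_div_assoc']
  refine div_le_div_of_nonneg_right ?_ (wsum_good_eq_pos hc S).le
  linarith

end NNetwork

end

theorem mainTheorem3 {n m : ℕ} [NeZero n] [NeZero m]
    (c : NNetwork.Edge m (ZMod n) → ℝ) (hc : ∀ e, 0 < c e)
    (hR : ∀ k l : Fin m, k ≤ l → NNetwork.radius c l ≤ NNetwork.radius c k)
    (V : ℕ → Finset (NNetwork.Vertex m ℤ)) (hV : ∀ N, V N ⊆ V (N + 1))
    (hcover : ∀ v, ∃ N, v ∈ V N) :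
    ∃ ℓ : ℕ → ℝ,
      (∀ K : ℕ, Tendsto (fun N : ℕ =>
          NNetwork.uPrTrunc c (V N) (NNetwork.sigma m K) /
            NNetwork.uPrTrunc c (V N) (NNetwork.tau m K))
        atTop (𝓝 (ℓ K))) ∧
      Tendsto ℓ atTop
        (𝓝 ((NNetwork.cylinder c).conductance (0, (1 : ZMod n), EdgeKind.high))) := by
  have hVm : Monotone V := monotone_nat_of_le_succ hV
  choose s hs _ using fun K =>
    NNetwork.exists_tendsto_truncRatio (K := K) hc hVm NNetwork.localized_sigma
  choose t ht ht' using fun K =>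
    NNetwork.exists_tendsto_truncRatio (K := K) hc hVm NNetwork.localized_tau
  have hwin := NNetwork.eventually_window hVm hcover
  have hpos : ∀ K, 0 < t K := fun K => by
    obtain ⟨N, hN⟩ := (hwin K).exists
    exact (NNetwork.truncRatio_tau_pos hc hN).trans_le (ht' K N)
  have ha : 0 < (NNetwork.cylinder c).conductance (0, (1 : ZMod n), EdgeKind.high) := hc _
  set a := (NNetwork.cylinder c).conductance (0, (1 : ZMod n), EdgeKind.high)
  have hlow : ∀ K, m + 1 ≤ K → a ≤ s K / t K := fun K hK => by
    rw [le_div_iff₀ (hpos K)]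
    refine le_of_tendsto_of_tendsto ((ht K).const_mul a) (hs K) ?_
    filter_upwards [hwin K] with N hN
    exact NNetwork.mul_truncRatio_tau_le hc hN hK
  have hup : ∀ M K : ℕ, 2 + m * (n * (m + 2 + M) + 3) + m ≤ K → 2 * m + 2 ≤ K →
      (M - m ^ 2 : ℝ) * (s K / t K) ≤ M * a := fun M K hK hK' => by
    rw [mul_div_assoc', div_le_iff₀ (hpos K), mul_assoc]
    refine le_of_tendsto_of_tendsto ((hs K).const_mul _) (((ht K).const_mul a).const_mul _) ?_
    filter_upwards [hwin K] with N hN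
    exact NNetwork.mul_truncRatio_sigma_le hc (fun k => hR 0 k (Fin.zero_le _)) hN M hK hK'
  refine ⟨fun K => s K / t K, fun K => ?_, ?_⟩
  · refine ((hs K).div (ht K) (hpos K).ne').congr' ?_
    filter_upwards [hwin K] with N hN
    rw [Pi.div_apply, NNetwork.uPrTrunc_eq hc hN NNetwork.localized_sigma,
      NNetwork.uPrTrunc_eq hc hN NNetwork.localized_tau]
  · rw [tendsto_order]
    refine ⟨fun b hb => ?_, fun b hb => ?_⟩
    · filter_upwards [eventually_ge_atTop (m + 1)] with K hK
      exact hb.trans_le (hlow K hK)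
    · -- For large `M` the upper bound `M * a / (M - m ^ 2)` is less than `b`.
      obtain ⟨M, hM⟩ := exists_nat_gt (b * m ^ 2 / (b - a))
      have hba : 0 < b - a := sub_pos.mpr hb
      rw [div_lt_iff₀ hba] at hM
      filter_upwards [eventually_ge_atTop (2 + m * (n * (m + 2 + M) + 3) + m),
        eventually_ge_atTop (2 * m + 2)] with K hK hK'
      by_contra! hcon
      have h1 := hup M K hK hK'
      have hm : (m : ℝ) ^ 2 < M := by nlinarith
      nlinarith [mul_le_mul_of_nonneg_left hcon (sub_nonneg.mpr hm.le)]
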